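/- Let $(X,\omega)$ be a symplectic orbifold of dimension $2n$: $X$ is a Hausdorff, second countable space with orbifold charts $U_\alpha\to U_\alpha/\Gamma_\alpha\cong V_\alpha\subset X$ ($U_\alpha\subset\mathbb R^{2n}$ open and connected, $\Gamma_\alpha<\mathrm{Diff}(U_\alpha)$ finite), any two charts being related near each common point by smooth equivariant open embeddings $U_\delta\to U_\alpha$, $U_\delta\to U_\beta$ over $X$ of a third chart; and $\omega$ consists of closed nondegenerate $\Gamma_\alpha$-invariant $2$-forms on the $U_\alpha$ that agree under these embeddings. For $x\in X$ let $\Gamma_x$ be its isotropy group, acting on the tangent space of a chart at $x$. Let $D\subset X$ be a nonempty homogeneous isotropy submanifold, i.e. there is a finite group $H<\mathrm O(2n)$ such that $D=\Sigma_H=\overline{\Sigma}_H$, where $\Sigma_H$ is the set of points $x$ for which the linear group $\Gamma_x$ is conjugate to $H$. For $x\in D$ the tangent space $T_xD$ is the subspace fixed by $\Gamma_x$, and the orbifold normal bundle is $\nu_D=\bigcup_{x\in D}(T_xD)^{\perp\omega}/\Gamma_x$, glued from the charts by the differentials of the embeddings of charts. Then $\nu_D$ is Hausdorff and second countable, and there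 are $d,k$ with $d+k=n$ ($\dim D=2d$, codimension $2k$) such that the following hold. 1. $\nu_D$ has an orbifold atlas with charts $\Phi_a:B_a\times\mathbb C^k\to\nu_D$, $B_a\subset\mathbb C^d$ open, such that - the group of the chart is a finite group $\Gamma_a<\mathrm U(k)$ acting by $\gamma(x,m)=(x,\gamma m)$; - $\Phi_a$ is compatible with the symplectic orbifold vector bundle structure of $\nu_D$: locally in $x$ it is induced by smooth local parametrizations of $D$ and linear isomorphisms $\mathbb C^k\to(T_xD)^{\perp\omega}$ that depend smoothly on $x$ and carry the standard symplectic form of $\mathbb C^k$ to $\omega_x$; - any two groups $\Gamma_a,\Gamma_b$ are conjugate by a real linear automorphism of $\mathbb C^k$, and they are conjugate in $\mathrm U(k)$ if the two charts meet fibres over the same connected component of $D$; - every change of charts (the composite $\imath_{\delta b}\circ\imath_{\delta a}^{-1}$ for embeddings $\imath_{\delta a},\imath_{\delta b}$ of a chart $\delta$ of the atlas into the charts $a$, $b$) has the form $(x,m)\mapsto(\psi_{ab}(x),A_{ab}(x)m)$ with $\psi_{ab}$ smooth and $A_{ab}$ a smooth map with values in $\mathrm U(k)$. 2. If $D$ is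 connected, there are a single subgroup $\Gamma<\mathrm U(k)$ and an atlas as in 1 with $\Gamma_a=\Gamma$ for all $a$, in which all $A_{ab}$ take values in the normalizer $N_{\mathrm U(k)}(\Gamma)=\{A\in\mathrm U(k): A\Gamma A^{-1}=\Gamma\}$. -/

import Mathlib

open scoped ContDiff

universe uE uX uI uG

set_option linter.checkUnivs false

/-! ### Orbifolds -/

/-- An orbifold chart `(U, V, φ, G)` on `X` modelled on `E`: a connected open set `U ⊆ E`, a finite
group `G` acting effectively on `U` by diffeomorphisms (so `G` is a finite subgroup of `Diff U`),
and a `G`-invariant map `φ` inducing a homeomorphism of `U / G` onto the open set `V = φ '' U`.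
The functions `act g` and `φ` are only meaningful on `U`. -/
structure OrbifoldChart (E : Type uE) [NormedAddCommGroup E] [NormedSpace ℝ E]
    (X : Type uX) [TopologicalSpace X] where
  U : Set E
  isOpen_U : IsOpen U
  isConnected_U : IsConnected U
  G : Type uG
  group : Group G
  finite : Finite G
  act : G → E → E
  act_mapsTo : ∀ g, Set.MapsTo (act g) U U
  act_one : ∀ u ∈ U, act 1 u = u
  act_mul : ∀ g h, ∀ u ∈ U, act (g * h) u = act g (act h u)
  act_smooth : ∀ g, ContDiffOn ℝ ∞ (act g) U
  act_faithful : ∀ g, (∀ u ∈ U, act g u = u) → g = 1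
  φ : E → X
  φ_continuousOn : ContinuousOn φ U
  φ_open : ∀ W ⊆ U, IsOpen W → IsOpen (φ '' W)
  φ_eq_iff : ∀ u ∈ U, ∀ u' ∈ U, φ u = φ u' ↔ ∃ g, act g u = u'

attribute [instance] OrbifoldChart.group OrbifoldChart.finite

namespace OrbifoldChart

variable {E : Type uE} [NormedAddCommGroup E] [NormedSpace ℝ E]
  {X : Type uX} [TopologicalSpace X]

/-- The open subset `V = φ(U)` of `X` covered by the chart. -/
def V (c : OrbifoldChart.{uE, uX, uG} E X) : Set X := c.φ '' c.U

/-- `f` is an embedding of the chart `c` into the chart `c'`: a diffeomorphism of `U` onto an open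
subset of `U'`, over `X`, and equivariant along a group monomorphism. -/
structure IsEmbedding (c c' : OrbifoldChart.{uE, uX, uG} E X) (f : E → E) : Prop where
  mapsTo : Set.MapsTo f c.U c'.U
  smooth : ContDiffOn ℝ ∞ f c.U
  isOpen_image : IsOpen (f '' c.U)
  smooth_inverse : ∃ f' : E → E, ContDiffOn ℝ ∞ f' (f '' c.U) ∧ ∀ u ∈ c.U, f' (f u) = u
  comm : ∀ u ∈ c.U, c'.φ (f u) = c.φ u
  equivariant : ∃ ρ : c.G →* c'.G, Function.Injective ρ ∧
    ∀ g, ∀ u ∈ c.U, f (c.act g u) = c'.act (ρ g) (f u)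

/-- The isotropy group at the point `φ u`, as a group of linear automorphisms of `T_u U = E`: the
differentials at `u` of the elements of `G` which fix `u`. -/
def isotropy (c : OrbifoldChart.{uE, uX, uG} E X) (u : E) : Set (E →L[ℝ] E) :=
  {L | ∃ g, c.act g u = u ∧ L = fderiv ℝ (c.act g) u}

/-- The subspace of `T_u U = E` fixed by the isotropy group. -/
def fixedSpace (c : OrbifoldChart.{uE, uX, uG} E X) (u : E) : Submodule ℝ E where
  carrier := {v | ∀ L ∈ c.isotropy u, L v = v}
  zero_mem' := fun L _ => map_zero L
  add_mem' := fun {v w} hv hw L hL => by rw [map_add, hv L hL, hw L hL]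
  smul_mem' := fun r v hv L hL => by rw [map_smul, hv L hL]

end OrbifoldChart

/-- An orbifold atlas on `X` modelled on `E`. -/
structure OrbifoldAtlas (E : Type uE) [NormedAddCommGroup E] [NormedSpace ℝ E]
    (X : Type uX) [TopologicalSpace X] where
  Index : Type uI
  chart : Index → OrbifoldChart.{uE, uX, uG} E X
  cover : ∀ x, ∃ α, x ∈ (chart α).V
  compat : ∀ α β, ∀ x ∈ (chart α).V ∩ (chart β).V, ∃ δ,
    x ∈ (chart δ).V ∧ (chart δ).V ⊆ (chart α).V ∩ (chart β).V ∧
    (∃ f, (chart δ).IsEmbedding (chart α) f) ∧ (∃ f, (chart δ).IsEmbedding (chart β) f)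

namespace OrbifoldAtlas

variable {E : Type uE} [NormedAddCommGroup E] [NormedSpace ℝ E]
  {X : Type uX} [TopologicalSpace X]

/-- An orbifold symplectic form: smooth 2-forms on the charts which are invariant under the local
groups, agree under the embeddings of charts, and are closed and nondegenerate. -/
structure SymplecticForm (A : OrbifoldAtlas.{uE, uX, uI, uG} E X) where
  form : A.Index → E → E [⋀^Fin 2]→L[ℝ] ℝ
  smooth : ∀ α, ContDiffOn ℝ ∞ (form α) (A.chart α).U
  invariant : ∀ α, ∀ g, ∀ u ∈ (A.chart α).U, ∀ v w,
    form α ((A.chart α).act g u)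
      ![fderiv ℝ ((A.chart α).act g) u v, fderiv ℝ ((A.chart α).act g) u w] = form α u ![v, w]
  agree : ∀ δ α f, (A.chart δ).IsEmbedding (A.chart α) f → ∀ u ∈ (A.chart δ).U, ∀ v w,
    form α (f u) ![fderiv ℝ f u v, fderiv ℝ f u w] = form δ u ![v, w]
  closed : ∀ α, ∀ u ∈ (A.chart α).U, extDeriv (form α) u = 0
  nondegenerate : ∀ α, ∀ u ∈ (A.chart α).U, ∀ v, (∀ w, form α u ![v, w] = 0) → v = 0

/-- The isotropy subset `Σ_H` of a finite linear group `H < O(E)`: the points of `X` whose isotropy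
group, acting on the tangent space of a chart, is linearly conjugate to `H`. -/
def isotropySubset {F : Type uE} [NormedAddCommGroup F] [InnerProductSpace ℝ F]
    (A : OrbifoldAtlas.{uE, uX, uI, uG} F X) (H : Subgroup (F ≃ₗᵢ[ℝ] F)) : Set X :=
  {x | ∃ α, ∃ u ∈ (A.chart α).U, (A.chart α).φ u = x ∧ ∃ T : F ≃L[ℝ] F,
    ∀ L : F →L[ℝ] F, L ∈ (A.chart α).isotropy u ↔ ∃ h ∈ H, ∀ v, T (L v) = h (T v)}

/-- `D` is a homogeneous isotropy submanifold: `D = closure Σ_H = Σ_H` for a finite `H < O(E)`. -/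
def IsHomogeneousIsotropy {F : Type uE} [NormedAddCommGroup F] [InnerProductSpace ℝ F]
    (A : OrbifoldAtlas.{uE, uX, uI, uG} F X) (D : Set X) : Prop :=
  ∃ H : Subgroup (F ≃ₗᵢ[ℝ] F), Finite H ∧ D = A.isotropySubset H ∧
    closure (A.isotropySubset H) = A.isotropySubset H

/-! ### The orbifold normal bundle -/

variable {A : OrbifoldAtlas.{uE, uX, uI, uG} E X}

/-- The symplectic orthogonal `(T_u D)^⊥ ⊆ T_u U = E`, where `T_u D` is the subspace fixed by the
isotropy group. -/
def SymplecticForm.normalSpace (σ : A.SymplecticForm) (α : A.Index) (u : E) :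
    Submodule ℝ E where
  carrier := {v | ∀ w ∈ (A.chart α).fixedSpace u, σ.form α u ![v, w] = 0}
  zero_mem' := fun w _ => (σ.form α u).map_coord_zero 0 rfl
  add_mem' := fun {v v'} hv hv' w hw => by
    rw [ContinuousAlternatingMap.vecCons_add, hv w hw, hv' w hw, add_zero]
  smul_mem' := fun r v hv w hw => by
    rw [ContinuousAlternatingMap.vecCons_smul, hv w hw, smul_zero]

/-- The normal vectors to the preimages of `D` in the charts: triples `(α, u, v)` with
`φ_α u ∈ D` and `v ∈ (T_u D)^⊥`. -/
abbrev SymplecticForm.NormalVector (σ : A.SymplecticForm) (D : Set X) : Type (max uE uI) :=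
  Σ α : A.Index, {p : E × E //
    p.1 ∈ (A.chart α).U ∧ (A.chart α).φ p.1 ∈ D ∧ p.2 ∈ σ.normalSpace α p.1}

/-- Two normal vectors are identified by the differential of an embedding of charts; among these
are the elements of the local groups, which are embeddings of a chart into itself. -/
def SymplecticForm.NormalRel (σ : A.SymplecticForm) (D : Set X)
    (p q : σ.NormalVector D) : Prop :=
  ∃ f, (A.chart p.1).IsEmbedding (A.chart q.1) f ∧
    q.2.1 = (f p.2.1.1, fderiv ℝ f p.2.1.1 p.2.1.2)

/-- The orbifold normal bundle `ν_D = ⋃_{x ∈ D} (T_x D)^⊥ / Γ_x`, obtained by gluing the normal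
vectors in the charts along the equivalence relation generated by `NormalRel`. -/
def SymplecticForm.NormalBundle (σ : A.SymplecticForm) (D : Set X) : Type (max uE uI) :=
  Quot (σ.NormalRel D)

/-- `ν_D` carries the quotient topology. -/
instance SymplecticForm.instTopologicalSpaceNormalBundle (σ : A.SymplecticForm) (D : Set X) :
    TopologicalSpace (σ.NormalBundle D) :=
  inferInstanceAs (TopologicalSpace (Quot (σ.NormalRel D)))

/-- The projection `ν_D → D ⊆ X`. -/
def SymplecticForm.normalProj (σ : A.SymplecticForm) (D : Set X) : σ.NormalBundle D → X :=
  Quot.lift (fun p => (A.chart p.1).φ p.2.1.1) (by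
    rintro p q ⟨f, hf, hq⟩
    have h1 : q.2.1.1 = f p.2.1.1 := by rw [hq]
    change (A.chart p.1).φ p.2.1.1 = (A.chart q.1).φ q.2.1.1
    rw [h1, hf.comm _ p.2.2.1])

end OrbifoldAtlas

/-! ### Unitary atlases of the normal bundle -/

/-- Complex Euclidean space `ℂ^k`. -/
abbrev CSpace (k : ℕ) : Type := EuclideanSpace ℂ (Fin k)

/-- The group `U(k)`. -/
abbrev UGroup (k : ℕ) : Type := Matrix.unitaryGroup (Fin k) ℂ

/-- The standard action of `U(k)` on `ℂ^k`. -/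
noncomputable def UGroup.apply {k : ℕ} (M : UGroup k) (m : CSpace k) : CSpace k :=
  WithLp.toLp 2 (Matrix.mulVec (M : Matrix (Fin k) (Fin k) ℂ) (WithLp.ofLp m))

namespace OrbifoldAtlas

variable {E : Type uE} [NormedAddCommGroup E] [NormedSpace ℝ E]
  {X : Type uX} [TopologicalSpace X] {A : OrbifoldAtlas.{uE, uX, uI, uG} E X}

/-- `Φ : B × ℂ^k → ν_D` is compatible with the symplectic orbifold vector bundle structure of `ν_D`
over the submanifold `D`. Locally in `B` it lifts to a chart of `X`, as `(x, m) ↦ (j x, L x m)` with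
`j` a local parametrization of (the preimage of) `D` and `L x` a linear isomorphism of `ℂ^k` onto
the normal space at `j x`, both smooth in `x`, where `L x` carries the standard symplectic form
`∑ dx_i ∧ dy_i = Im ⟨·, ·⟩` of `ℂ^k` to the given one. -/
def SymplecticForm.IsNormalTrivialization (σ : A.SymplecticForm) (D : Set X) {d k : ℕ}
    (B : Set (CSpace d)) (Φ : CSpace d × CSpace k → σ.NormalBundle D) : Prop :=
  ∀ x₀ ∈ B, ∃ (α : A.Index) (W : Set (CSpace d)) (j : CSpace d → E)
    (L : CSpace d → CSpace k →L[ℝ] E),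
    IsOpen W ∧ x₀ ∈ W ∧ W ⊆ B ∧ ContDiffOn ℝ ∞ j W ∧ ContDiffOn ℝ ∞ L W ∧
    ∀ x ∈ W,
      Function.Injective (fderiv ℝ j x) ∧
      Set.range (fderiv ℝ j x) = ((A.chart α).fixedSpace (j x) : Set E) ∧
      Function.Injective (L x) ∧
      Set.range (L x) = (σ.normalSpace α (j x) : Set E) ∧
      (∀ m m', σ.form α (j x) ![L x m, L x m'] = (inner ℂ m m').im) ∧
      ∀ m, ∃ h, Φ (x, m) = Quot.mk _ ⟨α, ⟨(j x, L x m), h⟩⟩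

/-- `N` is an atlas of `ν_D` as an orbifold bundle of fibre `ℂ^k / Γ`: each chart is defined on a
product `B a × ℂ^k`, its group is a subgroup `Γ a < U(k)` acting by `γ (x, m) = (x, γ m)`, the chart
is compatible with the structure of `ν_D`, and all the groups `Γ a` are conjugate to one another
by real linear automorphisms of `ℂ^k`. -/
structure SymplecticForm.IsBundleAtlas (σ : A.SymplecticForm) (D : Set X) {d k : ℕ}
    (N : OrbifoldAtlas (CSpace d × CSpace k) (σ.NormalBundle D))
    (B : N.Index → Set (CSpace d)) (Γ : N.Index → Subgroup (UGroup k)) : Prop where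
  domain : ∀ a, (N.chart a).U = B a ×ˢ Set.univ
  action : ∀ a, ∃ e : (N.chart a).G ≃* Γ a, ∀ g, ∀ x ∈ B a, ∀ m,
    (N.chart a).act g (x, m) = (x, UGroup.apply (e g : UGroup k) m)
  trivialization : ∀ a, σ.IsNormalTrivialization D (B a) (N.chart a).φ
  conjugate : ∀ a b, ∃ T : CSpace k ≃ₗ[ℝ] CSpace k,
    (∀ γ ∈ Γ a, ∃ γ' ∈ Γ b, ∀ m, T (γ.apply m) = γ'.apply (T m)) ∧
    (∀ γ' ∈ Γ b, ∃ γ ∈ Γ a, ∀ m, T (γ.apply m) = γ'.apply (T m))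

/-- The transition functions take values in the subgroup `S` of `U(k)`: every change of charts
`g ∘ f⁻¹ : f(U_δ) → g(U_δ)`, where `f`, `g` are embeddings of a chart `δ` into charts `a`, `b`, is of
the form `(x, m) ↦ (ψ x, P x m)` with `ψ` smooth and `P` a smooth map with values in `S`, both on
the projection of `f(U_δ)` to `ℂ^d`. -/
def TransitionsIn {Y : Type uX} [TopologicalSpace Y] {d k : ℕ}
    (N : OrbifoldAtlas.{0, uX, uI, uG} (CSpace d × CSpace k) Y)
    (S : Subgroup (UGroup k)) : Prop :=
  ∀ δ a b f g, (N.chart δ).IsEmbedding (N.chart a) f → (N.chart δ).IsEmbedding (N.chart b) g →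
    ∃ (ψ : CSpace d → CSpace d) (P : CSpace d → UGroup k),
      ContDiffOn ℝ ∞ ψ (Prod.fst '' (f '' (N.chart δ).U)) ∧
      (∀ i j, ContDiffOn ℝ ∞ (fun x => (P x : Matrix (Fin k) (Fin k) ℂ) i j)
        (Prod.fst '' (f '' (N.chart δ).U))) ∧
      (∀ x ∈ Prod.fst '' (f '' (N.chart δ).U), P x ∈ S) ∧
      ∀ p ∈ (N.chart δ).U, g p = (ψ (f p).1, (P (f p).1).apply (f p).2)

end OrbifoldAtlas

set_option linter.unusedSectionVars false

open Set Filter Topology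

/-! Near a point `u` of a chart over `D`, averaging over the stabilizer of `u` linearizes its
action. A nearby point has its stabilizer inside that of `u`; if it lies in `D` as well, both
stabilizers have the order of `H` and hence coincide. So `D` is locally the fixed subspace, and
along it the isotropy representation is constant in the linear coordinates. This produces a `Frame`:
a local parametrization of `D` with a smooth frame of the normal spaces in which the local group
acts by a constant finite set of linear maps (`exists_frame`). The tangent and normal spaces are
image and kernel of the averaging operator of the isotropy group, so both are symplectic and of even
dimension.

Frames become unitary with the help of a global fibre metric `q` on the normal bundle
(`exists_quadratic`). An inner product g and a symplectic form ω determine a complex structure J by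
polar decomposition: if A is defined by g(Au, v) = ω(u, v), then J = A S⁻¹ with S the positive
square root of -A². This J is unique (`IsPolar.unique`), hence invariant under everything that
preserves g and ω, in particular under isotropy and transition maps. It depends smoothly on g and ω,
because squaring is a local diffeomorphism near a positive operator: its derivative X ↦ SX + XS is
injective (`sylvester_eq_zero`). A frame is unitary when ω is standard and multiplication by i
preserves `q`; then i is the J of the pair, and a transition map between two unitary frames commutes
with i and preserves ω, so it lies in U(k) (`IsUnitary.exists_eq_clm`).

The groups of two unitary frames over the same point are therefore conjugate in U(k). Once a
representative of each conjugacy class of subgroups is fixed and every frame is turned by a constant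
unitary map, they are equal. The group is then locally constant along `D`, hence constant on
connected parts, and transition maps normalize it. Frames over different components are compared
through `H` only, which gives a real linear conjugacy.

An embedding between the resulting charts is a priori an arbitrary smooth map over the normal
bundle. On a fibre it agrees, vector by vector, with one of finitely many linear maps; smoothness
and homogeneity then force it to be a single one of them (`exists_embedding_eq`). -/

/-- The smooth inverse function theorem on an open set. -/
theorem exists_smooth_openPartialHomeomorph {E F : Type*} [NormedAddCommGroup E] [NormedSpace ℝ E]
    [CompleteSpace E] [NormedAddCommGroup F] [NormedSpace ℝ F] {f : E → F} {U : Set E}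
    (hU : IsOpen U) (hf : ContDiffOn ℝ ∞ f U) {u : E} (hu : u ∈ U) (f' : E ≃L[ℝ] F)
    (hf' : HasFDerivAt f (f' : E →L[ℝ] F) u) :
    ∃ e : OpenPartialHomeomorph E F, u ∈ e.source ∧ e.source ⊆ U ∧ (∀ x, e x = f x) ∧
      ContDiffOn ℝ ∞ e.symm e.target ∧
      ∀ x ∈ e.source, ∃ e' : E ≃L[ℝ] F, HasFDerivAt f (e' : E →L[ℝ] F) x := by
  have hcu : ContDiffAt ℝ ∞ f u := hf.contDiffAt (hU.mem_nhds hu)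
  have hcont : ContinuousOn (fderiv ℝ f) U := hf.continuousOn_fderiv_of_isOpen hU (by simp)
  -- Restricting to the points where the differential is invertible makes the inverse smooth on its
  -- whole domain, not just near the image of `u`.
  have hopen : IsOpen (U ∩ fderiv ℝ f ⁻¹' range ((↑) : (E ≃L[ℝ] F) → (E →L[ℝ] F))) :=
    hcont.isOpen_inter_preimage hU ContinuousLinearEquiv.isOpen
  set e := (hcu.toOpenPartialHomeomorph f hf' (by simp)).restrOpen _ hopen with he
  have hecoe : ∀ x, e x = f x := fun x => rfl
  have hsub : e.source ⊆ U ∩ fderiv ℝ f ⁻¹' range ((↑) : (E ≃L[ℝ] F) → (E →L[ℝ] F)) := by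
    intro x hx
    rw [he, OpenPartialHomeomorph.restrOpen_source] at hx
    exact hx.2
  have hder : ∀ x ∈ e.source, ∃ e' : E ≃L[ℝ] F, HasFDerivAt f (e' : E →L[ℝ] F) x := by
    intro x hx
    obtain ⟨hxU, e', he'⟩ := hsub hx
    refine ⟨e', ?_⟩
    rw [he']
    exact ((hf.contDiffAt (hU.mem_nhds hxU)).differentiableAt (by simp)).hasFDerivAt
  refine ⟨e, ?_, fun x hx => (hsub hx).1, hecoe, ?_, hder⟩
  · rw [he, OpenPartialHomeomorph.restrOpen_source]
    exact ⟨hcu.mem_toOpenPartialHomeomorph_source hf' (by simp), hu, f', by rw [hf'.fderiv]⟩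
  · intro y hy
    obtain ⟨e', he'⟩ := hder _ (e.map_target hy)
    exact (e.contDiffAt_symm hy he'
      (hf.contDiffAt (hU.mem_nhds (hsub (e.map_target hy)).1))).contDiffWithinAt

/-! ### Finite group actions in a chart: linearization, faithfulness of isotropy, embeddings. -/

namespace OrbifoldChart

variable {E : Type uE} [NormedAddCommGroup E] [NormedSpace ℝ E]
  {X : Type uX} [TopologicalSpace X] (c : OrbifoldChart.{uE, uX, uG} E X)

theorem act_mem (g : c.G) {u : E} (hu : u ∈ c.U) : c.act g u ∈ c.U := c.act_mapsTo g hu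

theorem act_inv_act (g : c.G) {u : E} (hu : u ∈ c.U) : c.act g⁻¹ (c.act g u) = u := by
  rw [← c.act_mul _ _ u hu, inv_mul_cancel, c.act_one u hu]

theorem act_act_inv (g : c.G) {u : E} (hu : u ∈ c.U) : c.act g (c.act g⁻¹ u) = u := by
  rw [← c.act_mul _ _ u hu, mul_inv_cancel, c.act_one u hu]

theorem φ_act (g : c.G) {u : E} (hu : u ∈ c.U) : c.φ (c.act g u) = c.φ u :=
  ((c.φ_eq_iff u hu _ (c.act_mem g hu)).2 ⟨g, rfl⟩).symm

theorem contDiffAt_act (g : c.G) {u : E} (hu : u ∈ c.U) : ContDiffAt ℝ ∞ (c.act g) u :=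
  (c.act_smooth g).contDiffAt (c.isOpen_U.mem_nhds hu)

theorem hasFDerivAt_act (g : c.G) {u : E} (hu : u ∈ c.U) :
    HasFDerivAt (c.act g) (fderiv ℝ (c.act g) u) u :=
  ((c.contDiffAt_act g hu).differentiableAt (by simp)).hasFDerivAt

theorem continuousAt_act (g : c.G) {u : E} (hu : u ∈ c.U) : ContinuousAt (c.act g) u :=
  (c.contDiffAt_act g hu).continuousAt

theorem fderiv_act_one {u : E} (hu : u ∈ c.U) :
    fderiv ℝ (c.act 1) u = ContinuousLinearMap.id ℝ E := by
  have : c.act 1 =ᶠ[𝓝 u] id := by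
    filter_upwards [c.isOpen_U.mem_nhds hu] with x hx using c.act_one x hx
  rw [this.fderiv_eq, fderiv_id]

theorem fderiv_act_mul (g h : c.G) {u : E} (hu : u ∈ c.U) :
    fderiv ℝ (c.act (g * h)) u =
      (fderiv ℝ (c.act g) (c.act h u)).comp (fderiv ℝ (c.act h) u) := by
  have : c.act (g * h) =ᶠ[𝓝 u] c.act g ∘ c.act h := by
    filter_upwards [c.isOpen_U.mem_nhds hu] with x hx using c.act_mul g h x hx
  rw [this.fderiv_eq]
  exact ((c.hasFDerivAt_act g (c.act_mem h hu)).comp u (c.hasFDerivAt_act h hu)).fderiv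

/-- The stabilizer of a point of the chart. -/
def stab (u : c.U) : Subgroup c.G where
  carrier := {g | c.act g u = u}
  one_mem' := c.act_one u u.2
  mul_mem' := fun {g h} (hg : c.act g u = u) (hh : c.act h u = u) => by
    change c.act (g * h) u = u
    rw [c.act_mul g h u u.2, hh, hg]
  inv_mem' := fun {g} (hg : c.act g u = u) => by
    change c.act g⁻¹ u = u
    conv_lhs => rw [← hg]
    rw [c.act_inv_act g u.2]

theorem mem_stab {u : c.U} {g : c.G} : g ∈ c.stab u ↔ c.act g u = u := Iff.rfl

theorem act_inv_eq {g : c.G} {u : E} (hu : u ∈ c.U) (h : c.act g u = u) : c.act g⁻¹ u = u :=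
  (c.stab ⟨u, hu⟩).inv_mem (c.mem_stab.2 h)

theorem act_mul_eq {g h : c.G} {u : E} (hu : u ∈ c.U) (hg : c.act g u = u) (hh : c.act h u = u) :
    c.act (g * h) u = u :=
  (c.stab ⟨u, hu⟩).mul_mem (c.mem_stab.2 hg) (c.mem_stab.2 hh)

/-- The isotropy representation of the stabilizer of `u`. -/
noncomputable def isotropyRep (u : c.U) : c.stab u →* (E →L[ℝ] E) where
  toFun g := fderiv ℝ (c.act g) u
  map_one' := c.fderiv_act_one u.2
  map_mul' g h := by
    change fderiv ℝ (c.act (g.1 * h.1)) u = _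
    rw [c.fderiv_act_mul _ _ u.2, c.mem_stab.1 h.2]
    rfl

theorem mem_isotropy_iff (u : c.U) (L : E →L[ℝ] E) :
    L ∈ c.isotropy u ↔ ∃ g, c.isotropyRep u g = L := by
  constructor
  · rintro ⟨g, hg, rfl⟩
    exact ⟨⟨g, hg⟩, rfl⟩
  · rintro ⟨g, rfl⟩
    exact ⟨g, g.2, rfl⟩

/-- Linearization of the action of the stabilizer near a point. -/
theorem exists_linearization [CompleteSpace E] {u : E} (hu : u ∈ c.U) :
    ∃ e : OpenPartialHomeomorph E E, u ∈ e.source ∧ e.source ⊆ c.U ∧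
      ContDiffOn ℝ ∞ e c.U ∧ ContDiffOn ℝ ∞ e.symm e.target ∧
      (∀ x ∈ e.source, ∃ e' : E ≃L[ℝ] E, HasFDerivAt e (e' : E →L[ℝ] E) x) ∧
      ∀ g, c.act g u = u → ∀ x ∈ c.U, e (c.act g x) = fderiv ℝ (c.act g) u (e x) := by
  classical
  have := Fintype.ofFinite (c.stab ⟨u, hu⟩)
  set ρ := c.isotropyRep ⟨u, hu⟩ with hρ
  -- Averaging: the sum of dg⁻¹ ∘ g over the stabilizer intertwines the action with its differential
  -- at `u`. Its own differential at `u` is the order of the stabilizer times the identity, so it is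
  -- a local diffeomorphism.
  set ψ : E → E := fun x => ∑ g : c.stab ⟨u, hu⟩, ρ g⁻¹ (c.act g x) with hψ
  have hsm : ContDiffOn ℝ ∞ ψ c.U := by
    refine ContDiffOn.sum fun g _ => ?_
    exact (ρ g⁻¹).contDiff.comp_contDiffOn (c.act_smooth g)
  have hder : HasFDerivAt ψ (∑ g : c.stab ⟨u, hu⟩, (ρ g⁻¹).comp (ρ g)) u := by
    refine HasFDerivAt.fun_sum fun g _ => ?_
    exact (ρ g⁻¹).hasFDerivAt.comp u (c.hasFDerivAt_act g hu)
  have hsum : (∑ g : c.stab ⟨u, hu⟩, (ρ g⁻¹).comp (ρ g)) =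
      (Fintype.card (c.stab ⟨u, hu⟩) : ℝ) • ContinuousLinearMap.id ℝ E := by
    have : ∀ g, (ρ g⁻¹).comp (ρ g) = ContinuousLinearMap.id ℝ E := fun g => by
      change ρ g⁻¹ * ρ g = 1
      rw [← map_mul, inv_mul_cancel, map_one]
    simp [this, Nat.cast_smul_eq_nsmul]
  have hcard : (Fintype.card (c.stab ⟨u, hu⟩) : ℝ) ≠ 0 := by
    exact_mod_cast Fintype.card_ne_zero
  obtain ⟨e, h1, h2, h3, h4, h5⟩ := exists_smooth_openPartialHomeomorph c.isOpen_U hsm hu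
    (ContinuousLinearEquiv.smulLeft (Units.mk0 _ hcard)) (by
      rw [hsum] at hder
      exact hder)
  have hee : (e : E → E) = ψ := funext h3
  refine ⟨e, h1, h2, hee ▸ hsm, h4, by rwa [hee], ?_⟩
  intro g hg x hx
  rw [hee, hψ]
  simp only [map_sum]
  refine Fintype.sum_equiv (Equiv.mulRight ⟨g, hg⟩) _ _ fun h => ?_
  simp only [Equiv.coe_mulRight, mul_inv_rev, map_mul]
  change ρ h⁻¹ (c.act h (c.act g x)) =
    (ρ ⟨g, hg⟩) (((ρ (⟨g, hg⟩ : c.stab ⟨u, hu⟩)⁻¹).comp (ρ h⁻¹)) (c.act (h.1 * g) x))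
  have key : ρ ⟨g, hg⟩ * ρ (⟨g, hg⟩ : c.stab ⟨u, hu⟩)⁻¹ = 1 := by
    rw [← map_mul, mul_inv_cancel, map_one]
  rw [c.act_mul _ _ x hx]
  exact (congrArg (fun T : E →L[ℝ] E => T (ρ h⁻¹ (c.act h (c.act g x)))) key).symm

/-- In the linearizing coordinate `g` acts by its differential at `u`, which is the identity. -/
theorem eventually_act_eq_self [CompleteSpace E] {u : E} (hu : u ∈ c.U) {g : c.G}
    (hg : c.act g u = u) (hd : fderiv ℝ (c.act g) u = ContinuousLinearMap.id ℝ E) :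
    ∀ᶠ x in 𝓝 u, c.act g x = x := by
  obtain ⟨e, h1, h2, -, -, -, h6⟩ := c.exists_linearization hu
  have hs := e.open_source.mem_nhds h1
  have hs' : c.act g ⁻¹' e.source ∈ 𝓝 u := (c.continuousAt_act g hu).preimage_mem_nhds (by rwa [hg])
  filter_upwards [hs, hs'] with x hx hx'
  refine e.injOn hx' hx ?_
  rw [h6 g hg x (h2 hx), hd]
  rfl

/-- The interior of the fixed set of `g` is closed in `U`: at a limit point both `g` and its
differential are trivial by continuity, so by linearization `g` is trivial nearby. Connectedness of
`U` and effectiveness of the action conclude. -/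
theorem eq_one_of_eventually [CompleteSpace E] {u : E} (hu : u ∈ c.U) {g : c.G}
    (hg : ∀ᶠ x in 𝓝 u, c.act g x = x) : g = 1 := by
  have hclosed : ∀ x ∈ c.U, x ∈ closure (interior {x | c.act g x = x}) →
      x ∈ interior {x | c.act g x = x} := by
    intro x hx hcl
    have hfix : c.act g x = x := by
      have h1 : Tendsto (c.act g) (𝓝[interior {x | c.act g x = x}] x) (𝓝 (c.act g x)) :=
        (c.continuousAt_act g hx).tendsto.mono_left nhdsWithin_le_nhds
      have h2 : Tendsto (c.act g) (𝓝[interior {x | c.act g x = x}] x) (𝓝 x) := by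
        refine (tendsto_id.mono_left nhdsWithin_le_nhds).congr' ?_
        filter_upwards [self_mem_nhdsWithin] with y hy
        exact (show c.act g y = y from
          (interior_subset hy : y ∈ {x | c.act g x = x})).symm
      have := mem_closure_iff_nhdsWithin_neBot.1 hcl
      exact tendsto_nhds_unique h1 h2
    have hder : fderiv ℝ (c.act g) x = ContinuousLinearMap.id ℝ E := by
      have hc : ContinuousAt (fderiv ℝ (c.act g)) x :=
        ((c.act_smooth g).continuousOn_fderiv_of_isOpen c.isOpen_U (by simp)).continuousAt
          (c.isOpen_U.mem_nhds hx)
      have h1 : Tendsto (fderiv ℝ (c.act g)) (𝓝[interior {x | c.act g x = x}] x) (𝓝 _) :=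
        hc.tendsto.mono_left nhdsWithin_le_nhds
      have h2 : Tendsto (fderiv ℝ (c.act g)) (𝓝[interior {x | c.act g x = x}] x)
          (𝓝 (ContinuousLinearMap.id ℝ E)) := by
        refine tendsto_const_nhds.congr' ?_
        filter_upwards [self_mem_nhdsWithin] with y hy
        have : c.act g =ᶠ[𝓝 y] id := mem_interior_iff_mem_nhds.1 hy
        rw [this.fderiv_eq, fderiv_id]
      have := mem_closure_iff_nhdsWithin_neBot.1 hcl
      exact tendsto_nhds_unique h1 h2
    exact mem_interior_iff_mem_nhds.2 (c.eventually_act_eq_self hx hfix hder)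
  have hsub : c.U ⊆ interior {x | c.act g x = x} :=
    c.isConnected_U.isPreconnected.subset_of_closure_inter_subset isOpen_interior
      ⟨u, hu, mem_interior_iff_mem_nhds.2 hg⟩ fun x hx => hclosed x hx.2 hx.1
  exact c.act_faithful g fun x hx => (interior_subset (hsub hx) : x ∈ {x | c.act g x = x})

/-- An element with trivial differential at a fixed point is trivial near that point, hence
everywhere. -/
theorem isotropyRep_injective [CompleteSpace E] (u : c.U) :
    Function.Injective (c.isotropyRep u) := by
  rw [injective_iff_map_eq_one']
  intro g
  refine ⟨fun h => Subtype.ext ?_, fun h => by rw [h, map_one]⟩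
  exact c.eq_one_of_eventually u.2 (c.eventually_act_eq_self u.2 g.2 h)

/-- Points with trivial stabilizer are dense. -/
theorem exists_free_point [CompleteSpace E] {W : Set E} (hW : IsOpen W) (hWU : W ⊆ c.U)
    (hne : W.Nonempty) : ∃ x ∈ W, ∀ g, c.act g x = x → g = 1 := by
  classical
  have := Fintype.ofFinite c.G
  -- The fixed sets are avoided one element at a time: a nontrivial element moves some point of any
  -- nonempty open set, and being moved is an open condition.
  suffices h : ∀ s : Finset c.G, ∃ V ⊆ W, IsOpen V ∧ V.Nonempty ∧
      ∀ x ∈ V, ∀ g ∈ s, c.act g x = x → g = 1 by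
    obtain ⟨V, hV, -, ⟨x, hx⟩, h⟩ := h Finset.univ
    exact ⟨x, hV hx, fun g => h x hx g (Finset.mem_univ g)⟩
  intro s
  induction s using Finset.induction_on with
  | empty => exact ⟨W, Subset.rfl, hW, hne, by simp⟩
  | insert g s _ ih =>
    obtain ⟨V, hV, hVo, ⟨x, hx⟩, h⟩ := ih
    by_cases hg : g = 1
    · refine ⟨V, hV, hVo, ⟨x, hx⟩, fun y hy g' hg' he => ?_⟩
      rcases Finset.mem_insert.1 hg' with rfl | hg'
      · exact hg
      · exact h y hy g' hg' he
    · have : ∃ y ∈ V, c.act g y ≠ y := by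
        by_contra! hcon
        exact hg (c.eq_one_of_eventually (hWU (hV hx))
          (by filter_upwards [hVo.mem_nhds hx] with y hy using hcon y hy))
      obtain ⟨y, hy, hgy⟩ := this
      have hop : IsOpen (V ∩ (fun z => (c.act g z, z)) ⁻¹' (diagonal E)ᶜ) := by
        refine ContinuousOn.isOpen_inter_preimage ?_ hVo isClosed_diagonal.isOpen_compl
        exact (((c.act_smooth g).continuousOn).mono (hV.trans hWU)).prodMk continuousOn_id
      refine ⟨_, inter_subset_left.trans hV, hop, ⟨y, hy, hgy⟩, fun z hz g' hg' he => ?_⟩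
      rcases Finset.mem_insert.1 hg' with rfl | hg'
      · exact absurd he hz.2
      · exact h z hz.1 g' hg' he

variable {c}

namespace IsEmbedding

variable {c' c'' : OrbifoldChart.{uE, uX, uG} E X} {f f₁ f₂ : E → E}

theorem contDiffAt (hf : c.IsEmbedding c' f) {u : E} (hu : u ∈ c.U) : ContDiffAt ℝ ∞ f u :=
  hf.smooth.contDiffAt (c.isOpen_U.mem_nhds hu)

theorem hasFDerivAt (hf : c.IsEmbedding c' f) {u : E} (hu : u ∈ c.U) :
    HasFDerivAt f (fderiv ℝ f u) u :=
  ((hf.contDiffAt hu).differentiableAt (by simp)).hasFDerivAt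

theorem injOn (hf : c.IsEmbedding c' f) : InjOn f c.U := by
  obtain ⟨f', -, h⟩ := hf.smooth_inverse
  intro u hu v hv huv
  rw [← h u hu, ← h v hv, huv]

theorem isOpen_image_of_subset (hf : c.IsEmbedding c' f) {W : Set E} (hW : IsOpen W)
    (hWU : W ⊆ c.U) : IsOpen (f '' W) := by
  obtain ⟨f', hf', h⟩ := hf.smooth_inverse
  have : f '' W = f '' c.U ∩ f' ⁻¹' W := by
    ext y
    constructor
    · rintro ⟨x, hx, rfl⟩
      exact ⟨⟨x, hWU hx, rfl⟩, by rwa [mem_preimage, h x (hWU hx)]⟩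
    · rintro ⟨⟨x, hx, rfl⟩, hy⟩
      rw [mem_preimage, h x hx] at hy
      exact ⟨x, hy, rfl⟩
  rw [this]
  exact hf'.continuousOn.isOpen_inter_preimage hf.isOpen_image hW

/-- The differential of an embedding is invertible, with inverse the differential of the inverse. -/
theorem exists_fderiv_equiv (hf : c.IsEmbedding c' f) {u : E} (hu : u ∈ c.U) :
    ∃ T : E ≃L[ℝ] E, (T : E →L[ℝ] E) = fderiv ℝ f u := by
  obtain ⟨f', hf', h⟩ := hf.smooth_inverse
  have hd' : HasFDerivAt f' (fderiv ℝ f' (f u)) (f u) :=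
    (((hf'.contDiffAt (hf.isOpen_image.mem_nhds ⟨u, hu, rfl⟩))).differentiableAt
      (by simp)).hasFDerivAt
  have h1 : (fderiv ℝ f' (f u)).comp (fderiv ℝ f u) = ContinuousLinearMap.id ℝ E := by
    have := hd'.comp u (hf.hasFDerivAt hu)
    refine this.unique ((hasFDerivAt_id u).congr_of_eventuallyEq ?_)
    filter_upwards [c.isOpen_U.mem_nhds hu] with x hx using h x hx
  have h2 : (fderiv ℝ f u).comp (fderiv ℝ f' (f u)) = ContinuousLinearMap.id ℝ E := by
    have hfu : HasFDerivAt f (fderiv ℝ f u) (f' (f u)) := by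
      rw [h u hu]
      exact hf.hasFDerivAt hu
    have := hfu.comp (f u) hd'
    refine this.unique ((hasFDerivAt_id (f u)).congr_of_eventuallyEq ?_)
    filter_upwards [hf.isOpen_image.mem_nhds ⟨u, hu, rfl⟩] with y hy
    obtain ⟨x, hx, rfl⟩ := hy
    simp [h x hx]
  exact ⟨ContinuousLinearEquiv.equivOfInverse _ _ (fun v => congrArg (fun T : E →L[ℝ] E => T v) h1)
    (fun v => congrArg (fun T : E →L[ℝ] E => T v) h2), rfl⟩

theorem id (c : OrbifoldChart.{uE, uX, uG} E X) : c.IsEmbedding c _root_.id where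
  mapsTo := fun _ h => h
  smooth := contDiffOn_id
  isOpen_image := by rw [image_id]; exact c.isOpen_U
  smooth_inverse := ⟨_root_.id, contDiffOn_id, fun _ _ => rfl⟩
  comm := fun _ _ => rfl
  equivariant := ⟨MonoidHom.id _, Function.injective_id, fun _ _ _ => rfl⟩

theorem comp {f' : E → E} (hf' : c'.IsEmbedding c'' f') (hf : c.IsEmbedding c' f) :
    c.IsEmbedding c'' (f' ∘ f) where
  mapsTo := hf'.mapsTo.comp hf.mapsTo
  smooth := hf'.smooth.comp hf.smooth hf.mapsTo
  isOpen_image := by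
    rw [image_comp]
    exact hf'.isOpen_image_of_subset hf.isOpen_image (image_subset_iff.2 hf.mapsTo)
  smooth_inverse := by
    obtain ⟨k, hk, h⟩ := hf.smooth_inverse
    obtain ⟨k', hk', h'⟩ := hf'.smooth_inverse
    refine ⟨k ∘ k', hk.comp (hk'.mono ?_) ?_, fun u hu => ?_⟩
    · rw [image_comp]
      exact image_mono (image_subset_iff.2 hf.mapsTo)
    · rintro _ ⟨u, hu, rfl⟩
      exact ⟨u, hu, (h' _ (hf.mapsTo hu)).symm⟩
    · simp only [Function.comp_apply]
      rw [h' _ (hf.mapsTo hu), h u hu]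
  comm := fun u hu => by
    rw [Function.comp_apply, hf'.comm _ (hf.mapsTo hu), hf.comm u hu]
  equivariant := by
    obtain ⟨ρ, hρ, h⟩ := hf.equivariant
    obtain ⟨ρ', hρ', h'⟩ := hf'.equivariant
    refine ⟨ρ'.comp ρ, hρ'.comp hρ, fun g u hu => ?_⟩
    simp only [Function.comp_apply, MonoidHom.comp_apply]
    rw [h g u hu, h' _ _ (hf.mapsTo hu)]

theorem act (c : OrbifoldChart.{uE, uX, uG} E X) (g : c.G) : c.IsEmbedding c (c.act g) where
  mapsTo := c.act_mapsTo g
  smooth := c.act_smooth g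
  isOpen_image := by
    have : c.act g '' c.U = c.U := by
      refine Subset.antisymm (image_subset_iff.2 (c.act_mapsTo g)) fun u hu => ?_
      exact ⟨c.act g⁻¹ u, c.act_mem _ hu, c.act_act_inv g hu⟩
    rw [this]
    exact c.isOpen_U
  smooth_inverse := ⟨c.act g⁻¹, (c.act_smooth g⁻¹).mono (image_subset_iff.2 (c.act_mapsTo g)),
    fun u hu => c.act_inv_act g hu⟩
  comm := fun u hu => c.φ_act g hu
  equivariant := by
    refine ⟨(MulAut.conj g).toMonoidHom, (MulAut.conj g).injective, fun h u hu => ?_⟩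
    change _ = c.act (g * h * g⁻¹) _
    rw [c.act_mul _ _ _ (c.act_mem g hu), c.act_inv_act g hu, c.act_mul _ _ _ hu]

/-- An embedding identifies the stabilizers. -/
theorem exists_stab [CompleteSpace E] (hf : c.IsEmbedding c' f) {u : E} (hu : u ∈ c.U) {g' : c'.G}
    (hg' : c'.act g' (f u) = f u) :
    ∃ g, c.act g u = u ∧ ∀ x ∈ c.U, f (c.act g x) = c'.act g' (f x) := by
  obtain ⟨ρ, -, hρ⟩ := hf.equivariant
  have hfu := hf.mapsTo hu
  have hop : IsOpen (c'.U ∩ c'.act g' ⁻¹' (f '' c.U)) :=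
    (c'.act_smooth g').continuousOn.isOpen_inter_preimage c'.isOpen_U hf.isOpen_image
  -- Take a free point `y` such that `y` and `g'` applied to `y` both lie in the image of `f`. Their
  -- preimages lie in one orbit of `c.G`, and freeness identifies `g'` with the image under `ρ` of
  -- the element that links them.
  obtain ⟨y, ⟨⟨hy1, x₂, hx₂, hy2⟩, x₁, hx₁, rfl⟩, hfree⟩ :=
    c'.exists_free_point (hop.inter hf.isOpen_image) (fun _ h => h.1.1)
      ⟨f u, ⟨hfu, by rw [mem_preimage, hg']; exact ⟨u, hu, rfl⟩⟩, u, hu, rfl⟩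
  have hφ : c.φ x₁ = c.φ x₂ := by
    rw [← hf.comm _ hx₁, ← hf.comm _ hx₂, hy2, c'.φ_act g' hy1]
  obtain ⟨g, hg⟩ := (c.φ_eq_iff _ hx₁ _ hx₂).1 hφ
  have hgg : g' = ρ g := by
    have : (ρ g)⁻¹ * g' = 1 := by
      apply hfree
      rw [c'.act_mul _ _ _ hy1, ← hy2, ← hg, hρ g _ hx₁, c'.act_inv_act _ hy1]
    rw [inv_mul_eq_one] at this
    exact this.symm
  refine ⟨g, hf.injOn (c.act_mem g hu) hu ?_, fun x hx => by rw [hρ g x hx, hgg]⟩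
  rw [hρ g u hu, ← hgg, hg']

theorem exists_stab' (hf : c.IsEmbedding c' f) {u : E} (hu : u ∈ c.U) {g : c.G}
    (hg : c.act g u = u) :
    ∃ g', c'.act g' (f u) = f u ∧ ∀ x ∈ c.U, f (c.act g x) = c'.act g' (f x) := by
  obtain ⟨ρ, -, hρ⟩ := hf.equivariant
  exact ⟨ρ g, by rw [← hρ g u hu, hg], hρ g⟩

theorem fderiv_comp_act (hf : c.IsEmbedding c' f) {u : E} (hu : u ∈ c.U) {g : c.G} {g' : c'.G}
    (hg : c.act g u = u) (h : ∀ x ∈ c.U, f (c.act g x) = c'.act g' (f x)) :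
    (fderiv ℝ f u).comp (fderiv ℝ (c.act g) u) =
      (fderiv ℝ (c'.act g') (f u)).comp (fderiv ℝ f u) := by
  have h1 : HasFDerivAt (f ∘ c.act g) ((fderiv ℝ f u).comp (fderiv ℝ (c.act g) u)) u := by
    refine HasFDerivAt.comp u ?_ (c.hasFDerivAt_act g hu)
    rw [hg]
    exact hf.hasFDerivAt hu
  have h2 := (c'.hasFDerivAt_act g' (hf.mapsTo hu)).comp u (hf.hasFDerivAt hu)
  refine h1.unique (h2.congr_of_eventuallyEq ?_)
  filter_upwards [c.isOpen_U.mem_nhds hu] with x hx using h x hx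

theorem forall_isotropy [CompleteSpace E] (hf : c.IsEmbedding c' f) {u : E} (hu : u ∈ c.U) :
    (∀ L ∈ c.isotropy u, ∃ L' ∈ c'.isotropy (f u), L'.comp (fderiv ℝ f u) =
      (fderiv ℝ f u).comp L) ∧
    (∀ L' ∈ c'.isotropy (f u), ∃ L ∈ c.isotropy u, L'.comp (fderiv ℝ f u) =
      (fderiv ℝ f u).comp L) := by
  constructor
  · rintro _ ⟨g, hg, rfl⟩
    obtain ⟨g', hg', h⟩ := hf.exists_stab' hu hg
    exact ⟨_, ⟨g', hg', rfl⟩, (hf.fderiv_comp_act hu hg h).symm⟩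
  · rintro _ ⟨g', hg', rfl⟩
    obtain ⟨g, hg, h⟩ := hf.exists_stab hu hg'
    exact ⟨_, ⟨g, hg, rfl⟩, (hf.fderiv_comp_act hu hg h).symm⟩

end IsEmbedding

end OrbifoldChart

/-! ### Differentials of maps that preserve orbits. -/

namespace OrbifoldChart

variable {E : Type uE} [NormedAddCommGroup E] [NormedSpace ℝ E]
  {X : Type uX} [TopologicalSpace X] {c : OrbifoldChart.{uE, uX, uG} E X}

/-- A differentiable map which moves points only within orbits has the differential of a group
element. -/
theorem exists_fderiv_eq_of_eventually {w : E} (hw : w ∈ c.U) {h : E → E} (hhw : h w = w)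
    {T : E →L[ℝ] E} (hT : HasFDerivAt h T w) (hev : ∀ᶠ x in 𝓝 w, ∃ g, c.act g x = h x) :
    ∃ g, c.act g w = w ∧ T = fderiv ℝ (c.act g) w := by
  have key : ∀ v, ∃ g : c.stab ⟨w, hw⟩, T v = fderiv ℝ (c.act g) w v := by
    intro v
    by_contra! hcon
    have hline : HasDerivAt (fun t : ℝ => w + t • v) v 0 := by
      simpa using ((hasDerivAt_id (0 : ℝ)).smul_const v).const_add w
    have hcont : Tendsto (fun t : ℝ => w + t • v) (𝓝 0) (𝓝 w) := by
      simpa using hline.continuousAt.tendsto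
    have hT' : HasDerivAt (fun t : ℝ => h (w + t • v)) (T v) 0 := by
      have hT2 : HasFDerivAt h T (w + (0 : ℝ) • v) := by simpa using hT
      exact hT2.comp_hasDerivAt (0 : ℝ) hline
    -- Along the line through `w` in the direction `v` each `g` disagrees with `h` for small nonzero
    -- `t`: to first order if `g` fixes `w`, already to order zero otherwise. This contradicts
    -- `hev`, since the group is finite.
    have hne : ∀ g : c.G, ∀ᶠ t in 𝓝[≠] (0 : ℝ), c.act g (w + t • v) ≠ h (w + t • v) := by
      intro g
      by_cases hg : c.act g w = w
      · have hg' : HasDerivAt (fun t : ℝ => c.act g (w + t • v)) (fderiv ℝ (c.act g) w v) 0 := by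
          have hg2 : HasFDerivAt (c.act g) (fderiv ℝ (c.act g) w) (w + (0 : ℝ) • v) := by
            simpa using c.hasFDerivAt_act g hw
          exact hg2.comp_hasDerivAt (0 : ℝ) hline
        have := (hg'.sub hT').eventually_ne (c := 0)
          (sub_ne_zero.2 (hcon ⟨g, hg⟩).symm)
        filter_upwards [this] with t ht hcon'
        exact ht (sub_eq_zero.2 hcon')
      · have h1 : Tendsto (fun t : ℝ => c.act g (w + t • v)) (𝓝 0) (𝓝 (c.act g w)) :=
          (c.continuousAt_act g hw).tendsto.comp hcont
        have h2 : Tendsto (fun t : ℝ => h (w + t • v)) (𝓝 0) (𝓝 w) := by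
          have := hT.continuousAt.tendsto.comp hcont
          rwa [hhw] at this
        refine (((h1.sub h2).eventually_ne (sub_ne_zero.2 hg)).filter_mono
          nhdsWithin_le_nhds).mono fun t ht => sub_ne_zero.1 ht
    have h1 := (eventually_all.2 hne).and ((hcont.eventually hev).filter_mono nhdsWithin_le_nhds)
    obtain ⟨t, ht, g, hg⟩ := h1.exists
    exact ht g hg
  -- The element found so far depends on `v`. A real vector space is not a finite union of proper
  -- subspaces, so one element serves all `v`.
  obtain ⟨g, hg⟩ := Subspace.exists_eq_top_of_iUnion_eq_univ
    (p := fun g : c.stab ⟨w, hw⟩ =>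
      LinearMap.ker ((T - fderiv ℝ (c.act g) w : E →L[ℝ] E) : E →ₗ[ℝ] E)) (by
    refine eq_univ_of_forall fun v => ?_
    obtain ⟨g, hg⟩ := key v
    exact mem_iUnion.2 ⟨g, by simp [hg]⟩)
  refine ⟨g, g.2, ?_⟩
  have := LinearMap.ker_eq_top.1 hg
  ext v
  have h3 := congrArg (fun L : E →ₗ[ℝ] E => L v) this
  simpa [sub_eq_zero] using h3

/-- Two embeddings which agree at a point differ there by the differential of a group element. -/
theorem IsEmbedding.exists_fderiv_eq {c' : OrbifoldChart.{uE, uX, uG} E X} {f₁ f₂ : E → E}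
    (h₁ : c.IsEmbedding c' f₁) (h₂ : c.IsEmbedding c' f₂) {w : E} (hw : w ∈ c.U)
    (h : f₁ w = f₂ w) :
    ∃ g, c.act g w = w ∧ fderiv ℝ f₂ w = (fderiv ℝ f₁ w).comp (fderiv ℝ (c.act g) w) := by
  -- Since both embeddings lie over `X`, the map f₁⁻¹ ∘ f₂ fixes `w` and moves points within orbits
  -- only.
  obtain ⟨k, hk, hkf⟩ := h₁.smooth_inverse
  have hmem : ∀ᶠ x in 𝓝 w, x ∈ c.U ∧ f₂ x ∈ f₁ '' c.U := by
    refine (c.isOpen_U.eventually_mem hw).and ?_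
    exact (h₂.contDiffAt hw).continuousAt.eventually
      (h₁.isOpen_image.eventually_mem (h ▸ ⟨w, hw, rfl⟩))
  have hkd : HasFDerivAt k (fderiv ℝ k (f₂ w)) (f₂ w) :=
    ((hk.contDiffAt (h₁.isOpen_image.mem_nhds (h ▸ ⟨w, hw, rfl⟩))).differentiableAt
      (by simp)).hasFDerivAt
  have hd := hkd.comp w (h₂.hasFDerivAt hw)
  have hkw : (k ∘ f₂) w = w := by rw [Function.comp_apply, ← h, hkf w hw]
  obtain ⟨g, hg, hgT⟩ := exists_fderiv_eq_of_eventually hw hkw hd (by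
    filter_upwards [hmem] with x hx
    obtain ⟨hx, y, hy, hyx⟩ := hx
    rw [Function.comp_apply, ← hyx, hkf y hy]
    refine (c.φ_eq_iff x hx y hy).1 ?_
    rw [← h₂.comm x hx, ← hyx, h₁.comm y hy])
  refine ⟨g, hg, ?_⟩
  have h1 : HasFDerivAt f₁ (fderiv ℝ f₁ w) ((k ∘ f₂) w) := by
    rw [hkw]
    exact h₁.hasFDerivAt hw
  rw [← hgT]
  refine (h₂.hasFDerivAt hw).unique ((h1.comp w hd).congr_of_eventuallyEq ?_)
  filter_upwards [hmem] with x hx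
  obtain ⟨hx, y, hy, hyx⟩ := hx
  simp only [Function.comp_apply]
  rw [← hyx, hkf y hy]

end OrbifoldChart

/-! ### Comparing points and isotropy groups in different charts. -/

namespace OrbifoldAtlas

variable {E : Type uE} [NormedAddCommGroup E] [NormedSpace ℝ E]
  {X : Type uX} [TopologicalSpace X] {A : OrbifoldAtlas.{uE, uX, uI, uG} E X}

/-- Points of two charts over the same point of `X` come from a common chart. -/
theorem exists_embeddings {α β : A.Index} {u w : E} (hu : u ∈ (A.chart α).U)
    (hw : w ∈ (A.chart β).U) (h : (A.chart α).φ u = (A.chart β).φ w) :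
    ∃ δ, ∃ z ∈ (A.chart δ).U, ∃ f g, (A.chart δ).IsEmbedding (A.chart α) f ∧
      (A.chart δ).IsEmbedding (A.chart β) g ∧ f z = u ∧ g z = w := by
  obtain ⟨δ, ⟨z, hz, hzx⟩, -, ⟨f, hf⟩, ⟨g, hg⟩⟩ :=
    A.compat α β ((A.chart α).φ u) ⟨⟨u, hu, rfl⟩, ⟨w, hw, h.symm⟩⟩
  -- Compatibility of the atlas reaches `u` and `w` only up to the local groups; composing with
  -- group elements corrects this.
  obtain ⟨a, ha⟩ := ((A.chart α).φ_eq_iff _ (hf.mapsTo hz) _ hu).1 (by rw [hf.comm z hz, hzx])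
  obtain ⟨b, hb⟩ := ((A.chart β).φ_eq_iff _ (hg.mapsTo hz) _ hw).1 (by rw [hg.comm z hz, hzx, h])
  exact ⟨δ, z, hz, _, _, (OrbifoldChart.IsEmbedding.act _ a).comp hf,
    (OrbifoldChart.IsEmbedding.act _ b).comp hg, ha, hb⟩

section

variable {F : Type uE} [NormedAddCommGroup F] [InnerProductSpace ℝ F] [CompleteSpace F]
  {A : OrbifoldAtlas.{uE, uX, uI, uG} F X}

/-- Membership in the isotropy subset can be tested in every chart. -/
theorem mem_isotropySubset_iff {H : Subgroup (F ≃ₗᵢ[ℝ] F)} {α : A.Index} {u : F}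
    (hu : u ∈ (A.chart α).U) :
    (A.chart α).φ u ∈ A.isotropySubset H ↔ ∃ T : F ≃L[ℝ] F,
      ∀ L : F →L[ℝ] F, L ∈ (A.chart α).isotropy u ↔ ∃ h ∈ H, ∀ v, T (L v) = h (T v) := by
  constructor
  · rintro ⟨β, w, hw, hwu, T, hT⟩
    obtain ⟨δ, z, hz, f, g, hf, hg, rfl, rfl⟩ := exists_embeddings hu hw hwu.symm
    obtain ⟨a, ha⟩ := hf.exists_fderiv_equiv hz
    obtain ⟨b, hb⟩ := hg.exists_fderiv_equiv hz
    have hf' := hf.forall_isotropy hz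
    have hg' := hg.forall_isotropy hz
    rw [← ha] at hf'
    rw [← hb] at hg'
    refine ⟨a.symm.trans (b.trans T), fun L => ⟨fun hL => ?_, ?_⟩⟩
    · obtain ⟨L₀, hL₀, h₀⟩ := hf'.2 L hL
      obtain ⟨L₁, hL₁, h₁⟩ := hg'.1 L₀ hL₀
      obtain ⟨h, hh, hhT⟩ := (hT L₁).1 hL₁
      refine ⟨h, hh, fun v => ?_⟩
      have e0 : ∀ v, L (a v) = a (L₀ v) := fun v => congrArg (fun S : F →L[ℝ] F => S v) h₀
      have e1 : ∀ v, L₁ (b v) = b (L₀ v) := fun v => congrArg (fun S : F →L[ℝ] F => S v) h₁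
      simp only [ContinuousLinearEquiv.trans_apply]
      rw [← hhT, e1, ← a.apply_symm_apply v, e0]
      simp
    · rintro ⟨h, hh, hhT⟩
      have : ((T.symm : F →L[ℝ] F).comp ((h.toContinuousLinearEquiv : F →L[ℝ] F).comp
          (T : F →L[ℝ] F))) ∈
          (A.chart β).isotropy (g z) := (hT _).2 ⟨h, hh, fun v => by simp⟩
      obtain ⟨L₀, hL₀, h₀⟩ := hg'.2 _ this
      obtain ⟨L₁, hL₁, h₁⟩ := hf'.1 L₀ hL₀
      convert hL₁
      ext v
      have e0 : ∀ v, T.symm (h (T (b v))) = b (L₀ v) :=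
        fun v => congrArg (fun S : F →L[ℝ] F => S v) h₀
      have e1 : ∀ v, L₁ (a v) = a (L₀ v) := fun v => congrArg (fun S : F →L[ℝ] F => S v) h₁
      have := hhT v
      simp only [ContinuousLinearEquiv.trans_apply] at this
      rw [← ContinuousLinearEquiv.eq_symm_apply, e0] at this
      rw [a.symm_apply_eq.1 (b.injective this), ← e1, a.apply_symm_apply]
  · rintro ⟨T, hT⟩
    exact ⟨α, u, hu, rfl, T, hT⟩

end

end OrbifoldAtlas

namespace OrbifoldChart.IsEmbedding

variable {E : Type uE} [NormedAddCommGroup E] [NormedSpace ℝ E] [CompleteSpace E]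
  {X : Type uX} [TopologicalSpace X] {c c' : OrbifoldChart.{uE, uX, uG} E X} {f : E → E}

theorem fderiv_mem_fixedSpace_iff (hf : c.IsEmbedding c' f) {u : E} (hu : u ∈ c.U) {w : E} :
    fderiv ℝ f u w ∈ c'.fixedSpace (f u) ↔ w ∈ c.fixedSpace u := by
  obtain ⟨a, ha⟩ := hf.exists_fderiv_equiv hu
  have h := hf.forall_isotropy hu
  rw [← ha] at h ⊢
  constructor
  · intro hw L hL
    obtain ⟨L', hL', e⟩ := h.1 L hL
    have := congrArg (fun S : E →L[ℝ] E => S w) e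
    exact a.injective (this.symm.trans (hw L' hL'))
  · intro hw L' hL'
    obtain ⟨L, hL, e⟩ := h.2 L' hL'
    have := congrArg (fun S : E →L[ℝ] E => S w) e
    exact this.trans (congrArg a (hw L hL))

end OrbifoldChart.IsEmbedding

/-! ### Equality in the normal bundle. -/

namespace OrbifoldAtlas.SymplecticForm

variable {E : Type uE} [NormedAddCommGroup E] [NormedSpace ℝ E] [CompleteSpace E]
  {X : Type uX} [TopologicalSpace X] {A : OrbifoldAtlas.{uE, uX, uI, uG} E X}
  (σ : A.SymplecticForm) {D : Set X}

theorem fderiv_mem_normalSpace_iff {δ α : A.Index} {f : E → E}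
    (hf : (A.chart δ).IsEmbedding (A.chart α) f) {u : E} (hu : u ∈ (A.chart δ).U) {v : E} :
    fderiv ℝ f u v ∈ σ.normalSpace α (f u) ↔ v ∈ σ.normalSpace δ u := by
  constructor
  · intro hv w hw
    rw [← σ.agree δ α f hf u hu]
    exact hv _ ((hf.fderiv_mem_fixedSpace_iff hu).2 hw)
  · intro hv w hw
    obtain ⟨a, ha⟩ := hf.exists_fderiv_equiv hu
    have hw' : fderiv ℝ f u (a.symm w) = w := by
      rw [← ha]
      exact a.apply_symm_apply w
    rw [← hw', σ.agree δ α f hf u hu]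
    exact hv _ ((hf.fderiv_mem_fixedSpace_iff hu).1 (by rwa [hw']))

/-- Two normal vectors are linked if they are the images of a common vector under embeddings. -/
def NormalLink (p q : σ.NormalVector D) : Prop :=
  ∃ δ, ∃ z ∈ (A.chart δ).U, ∃ f g, (A.chart δ).IsEmbedding (A.chart p.1) f ∧
    (A.chart δ).IsEmbedding (A.chart q.1) g ∧ f z = p.2.1.1 ∧ g z = q.2.1.1 ∧
    ∃ ζ, fderiv ℝ f z ζ = p.2.1.2 ∧ fderiv ℝ g z ζ = q.2.1.2

variable {σ}

/-- The two spans meeting at `q` are joined by a chart `ε` over both. Its two embeddings into the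
chart of `q` agree at the point, but their differentials may differ by that of a stabilizer element
`k`; this element is absorbed into the leg towards `p`. -/
theorem NormalLink.trans {p q r : σ.NormalVector D} (h₁ : σ.NormalLink p q)
    (h₂ : σ.NormalLink q r) : σ.NormalLink p r := by
  obtain ⟨δ, z, hz, f, g, hf, hg, hfp, hgq, ζ, hζp, hζq⟩ := h₁
  obtain ⟨δ', z', hz', f', g', hf', hg', hfq, hgr, ζ', hζq', hζr⟩ := h₂
  obtain ⟨ε, w, hw, a, b, ha, hb, haw, hbw⟩ := exists_embeddings hz hz' (by
    rw [← hg.comm z hz, ← hf'.comm z' hz', hgq, hfq])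
  obtain ⟨k, hk, hkd⟩ := (hg.comp ha).exists_fderiv_eq (hf'.comp hb) hw (by
    simp only [Function.comp_apply]
    rw [haw, hbw, hgq, hfq])
  have hfd : fderiv ℝ (f ∘ a ∘ (A.chart ε).act k) w =
      (fderiv ℝ f z).comp ((fderiv ℝ a w).comp (fderiv ℝ ((A.chart ε).act k) w)) := by
    have h1 := (A.chart ε).hasFDerivAt_act k hw
    have h2 : HasFDerivAt a (fderiv ℝ a w) ((A.chart ε).act k w) := by
      rw [hk]
      exact ha.hasFDerivAt hw
    have h3 : HasFDerivAt f (fderiv ℝ f z) ((a ∘ (A.chart ε).act k) w) := by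
      rw [Function.comp_apply, hk, haw]
      exact hf.hasFDerivAt hz
    exact (h3.comp w (h2.comp w h1)).fderiv
  have hgd : fderiv ℝ (g' ∘ b) w = (fderiv ℝ g' z').comp (fderiv ℝ b w) := by
    have h3 : HasFDerivAt g' (fderiv ℝ g' z') (b w) := by
      rw [hbw]
      exact hg'.hasFDerivAt hz'
    exact (h3.comp w (hb.hasFDerivAt hw)).fderiv
  have hgad : fderiv ℝ (g ∘ a) w = (fderiv ℝ g z).comp (fderiv ℝ a w) := by
    have h3 : HasFDerivAt g (fderiv ℝ g z) (a w) := by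
      rw [haw]
      exact hg.hasFDerivAt hz
    exact (h3.comp w (ha.hasFDerivAt hw)).fderiv
  have hfbd : fderiv ℝ (f' ∘ b) w = (fderiv ℝ f' z').comp (fderiv ℝ b w) := by
    have h3 : HasFDerivAt f' (fderiv ℝ f' z') (b w) := by
      rw [hbw]
      exact hf'.hasFDerivAt hz'
    exact (h3.comp w (hb.hasFDerivAt hw)).fderiv
  obtain ⟨b', hb'⟩ := hb.exists_fderiv_equiv hw
  obtain ⟨T, hT⟩ := hg.exists_fderiv_equiv hz
  have hbζ : fderiv ℝ b w (b'.symm ζ') = ζ' := by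
    rw [← hb']
    exact b'.apply_symm_apply ζ'
  refine ⟨ε, w, hw, f ∘ a ∘ (A.chart ε).act k, g' ∘ b,
    hf.comp (ha.comp (OrbifoldChart.IsEmbedding.act _ k)), hg'.comp hb, ?_, ?_, b'.symm ζ', ?_, ?_⟩
  · simp only [Function.comp_apply]
    rw [hk, haw, hfp]
  · simp only [Function.comp_apply]
    rw [hbw, hgr]
  · rw [hfd, ← hζp]
    refine congrArg (fderiv ℝ f z) (T.injective ?_)
    have h4 := congrArg (fun S : E →L[ℝ] E => S (b'.symm ζ')) hkd
    rw [hgad, hfbd] at h4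
    simp only [ContinuousLinearMap.comp_apply] at h4
    rw [hbζ, hζq', ← hζq] at h4
    change (T : E →L[ℝ] E) _ = (T : E →L[ℝ] E) _
    rw [hT]
    exact h4.symm
  · rw [hgd, ContinuousLinearMap.comp_apply, hbζ, hζr]

theorem normalLink_equivalence : Equivalence (σ.NormalLink (D := D)) where
  refl p := ⟨p.1, p.2.1.1, p.2.2.1, id, id, .id _, .id _, rfl, rfl, p.2.1.2, by simp, by simp⟩
  symm := by
    rintro p q ⟨δ, z, hz, f, g, hf, hg, hfp, hgq, ζ, hζp, hζq⟩
    exact ⟨δ, z, hz, g, f, hg, hf, hgq, hfp, ζ, hζq, hζp⟩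
  trans := NormalLink.trans

/-- Linkage is an equivalence relation containing `NormalRel`, so it contains the relation generated
by it. A chain of identifications is thus replaced by a single span of embeddings. -/
theorem mk_eq_mk_iff {p q : σ.NormalVector D} :
    (Quot.mk _ p : σ.NormalBundle D) = Quot.mk _ q ↔ σ.NormalLink p q := by
  constructor
  · intro h
    have h1 := Quot.eqvGen_exact h
    have h2 : ∀ a b : σ.NormalVector D, σ.NormalRel D a b → σ.NormalLink a b := by
      rintro a b ⟨f, hf, hq⟩
      refine ⟨a.1, a.2.1.1, a.2.2.1, id, f, .id _, hf, rfl, ?_, a.2.1.2, by simp, ?_⟩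
      · rw [hq]
      · rw [hq]
    exact normalLink_equivalence.eqvGen_iff.1 (h1.mono h2)
  · rintro ⟨δ, z, hz, f, g, hf, hg, hfp, hgq, ζ, hζp, hζq⟩
    have hζ : ζ ∈ σ.normalSpace δ z := by
      rw [← σ.fderiv_mem_normalSpace_iff hf hz, hζp, hfp]
      exact p.2.2.2.2
    have hzD : (A.chart δ).φ z ∈ D := by
      rw [← hf.comm z hz, hfp]
      exact p.2.2.2.1
    let s : σ.NormalVector D := ⟨δ, (z, ζ), hz, hzD, hζ⟩
    have h1 : (Quot.mk _ s : σ.NormalBundle D) = Quot.mk _ p :=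
      Quot.sound ⟨f, hf, Prod.ext hfp.symm hζp.symm⟩
    have h2 : (Quot.mk _ s : σ.NormalBundle D) = Quot.mk _ q :=
      Quot.sound ⟨g, hg, Prod.ext hgq.symm hζq.symm⟩
    exact h1.symm.trans h2

/-- Normal vectors in one chart are identified exactly by the local group. -/
theorem NormalLink.exists_act {α : A.Index} {p q} (h : σ.NormalLink (D := D) ⟨α, p⟩ ⟨α, q⟩) :
    ∃ g, (A.chart α).act g p.1.1 = q.1.1 ∧ fderiv ℝ ((A.chart α).act g) p.1.1 p.1.2 = q.1.2 := by
  obtain ⟨δ, z, hz, f, g, hf, hg, hfp, hgq, ζ, hζp, hζq⟩ := h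
  simp only at hf hg hfp hgq hζp hζq
  have hp : p.1.1 ∈ (A.chart α).U := p.2.1
  have hq : q.1.1 ∈ (A.chart α).U := q.2.1
  -- The element `a` matches the base points. What remains between `a` ∘ `f` and `g` is a stabilizer
  -- element of `z`, which `f` transports to an element `k'` of the local group of `α`.
  obtain ⟨a, ha⟩ := ((A.chart α).φ_eq_iff _ hp _ hq).1 (by
    rw [← hfp, ← hgq, hf.comm z hz, hg.comm z hz])
  have haf : (A.chart δ).IsEmbedding (A.chart α) ((A.chart α).act a ∘ f) :=
    (OrbifoldChart.IsEmbedding.act _ a).comp hf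
  obtain ⟨k, hk, hkd⟩ := haf.exists_fderiv_eq hg hz (by rw [Function.comp_apply, hfp, ha, hgq])
  obtain ⟨k', hk', hk2⟩ := hf.exists_stab' hz hk
  rw [hfp] at hk'
  refine ⟨a * k', by rw [(A.chart α).act_mul _ _ _ hp, hk', ha], ?_⟩
  rw [(A.chart α).fderiv_act_mul _ _ hp, hk', ← hζp, ← hζq, hkd]
  have h1 : fderiv ℝ ((A.chart α).act a ∘ f) z =
      (fderiv ℝ ((A.chart α).act a) p.1.1).comp (fderiv ℝ f z) := by
    have h3 : HasFDerivAt ((A.chart α).act a) (fderiv ℝ ((A.chart α).act a) p.1.1) (f z) := by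
      rw [hfp]
      exact (A.chart α).hasFDerivAt_act a hp
    exact (h3.comp z (hf.hasFDerivAt hz)).fderiv
  have h2 := congrArg (fun S : E →L[ℝ] E => S ζ) (hf.fderiv_comp_act hz hk hk2)
  rw [hfp] at h2
  rw [h1]
  simp only [ContinuousLinearMap.comp_apply] at h2 ⊢
  rw [h2]

end OrbifoldAtlas.SymplecticForm

/-! ### The averaging operator and the splitting into tangent and normal space. -/

/-- A continuous alternating 2-form as a continuous bilinear form. -/
noncomputable def ContinuousAlternatingMap.bilinearCLM (E : Type*) [NormedAddCommGroup E]
    [NormedSpace ℝ E] : (E [⋀^Fin 2]→L[ℝ] ℝ) →L[ℝ] (E →L[ℝ] E →L[ℝ] ℝ) :=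
  (ContinuousLinearMap.compL ℝ E _ _
    (continuousMultilinearCurryFin1 ℝ E ℝ).toContinuousLinearEquiv.toContinuousLinearMap).comp
  ((continuousMultilinearCurryLeftEquiv ℝ
      (fun _ : Fin 2 => E) ℝ).toContinuousLinearEquiv.toContinuousLinearMap.comp
    (ContinuousAlternatingMap.toContinuousMultilinearMapCLM ℝ))

theorem ContinuousAlternatingMap.bilinearCLM_apply {E : Type*} [NormedAddCommGroup E]
    [NormedSpace ℝ E] (f : E [⋀^Fin 2]→L[ℝ] ℝ) (v w : E) :
    ContinuousAlternatingMap.bilinearCLM E f v w = f ![v, w] := by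
  change f (Fin.cons v (Fin.snoc 0 w)) = f ![v, w]
  congr 1
  ext i
  fin_cases i <;> simp

namespace OrbifoldChart

variable {E : Type uE} [NormedAddCommGroup E] [NormedSpace ℝ E]
  {X : Type uX} [TopologicalSpace X] (c : OrbifoldChart.{uE, uX, uG} E X)

/-- The sum of the elements of the isotropy group. -/
noncomputable def isotropySum (u : E) : E →L[ℝ] E :=
  ∑ g ∈ (Set.toFinite {g : c.G | c.act g u = u}).toFinset, fderiv ℝ (c.act g) u

theorem mem_fixedSpace {u v : E} :
    v ∈ c.fixedSpace u ↔ ∀ g, c.act g u = u → fderiv ℝ (c.act g) u v = v :=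
  ⟨fun h g hg => h _ ⟨g, hg, rfl⟩, fun h _ ⟨g, hg, hL⟩ => hL ▸ h g hg⟩

theorem isotropySum_apply (u v : E) : c.isotropySum u v =
    ∑ g ∈ (Set.toFinite {g : c.G | c.act g u = u}).toFinset, fderiv ℝ (c.act g) u v := by
  rw [isotropySum, sum_apply]

theorem isotropySum_mem {u : E} (hu : u ∈ c.U) (v : E) : c.isotropySum u v ∈ c.fixedSpace u := by
  rw [mem_fixedSpace]
  intro h hh
  rw [isotropySum_apply, map_sum]
  refine Finset.sum_equiv (Equiv.mulLeft h) (fun g => ?_) fun g hg => ?_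
  · simp only [Finite.mem_toFinset, mem_ofPred_eq, Equiv.coe_mulLeft]
    refine ⟨fun hg => c.act_mul_eq hu hh hg, fun hg => ?_⟩
    have := c.act_mul_eq hu (c.act_inv_eq hu hh) hg
    rwa [inv_mul_cancel_left] at this
  · simp only [Finite.mem_toFinset, mem_ofPred_eq] at hg
    simp only [Equiv.coe_mulLeft]
    rw [c.fderiv_act_mul _ _ hu, hg]
    rfl

theorem isotropySum_of_mem {u v : E} (hv : v ∈ c.fixedSpace u) :
    c.isotropySum u v = ((Set.toFinite {g : c.G | c.act g u = u}).toFinset.card : ℝ) • v := by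
  rw [isotropySum_apply, Nat.cast_smul_eq_nsmul, ← Finset.sum_const]
  refine Finset.sum_congr rfl fun g hg => ?_
  exact c.mem_fixedSpace.1 hv g (by simpa using hg)

theorem card_stab_ne_zero {u : E} (hu : u ∈ c.U) :
    ((Set.toFinite {g : c.G | c.act g u = u}).toFinset.card : ℝ) ≠ 0 := by
  rw [Nat.cast_ne_zero, Finset.card_ne_zero]
  exact ⟨1, by simpa using c.act_one u hu⟩

end OrbifoldChart

namespace OrbifoldAtlas.SymplecticForm

variable {E : Type uE} [NormedAddCommGroup E] [NormedSpace ℝ E]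
  {X : Type uX} [TopologicalSpace X] {A : OrbifoldAtlas.{uE, uX, uI, uG} E X}
  (σ : A.SymplecticForm) {D : Set X}

/-- The symplectic form as a field of bilinear forms. -/
noncomputable def bil (α : A.Index) (u : E) : E →L[ℝ] E →L[ℝ] ℝ :=
  ContinuousAlternatingMap.bilinearCLM E (σ.form α u)

theorem bil_apply (α : A.Index) (u v w : E) : σ.bil α u v w = σ.form α u ![v, w] :=
  ContinuousAlternatingMap.bilinearCLM_apply _ _ _

theorem bil_smooth (α : A.Index) : ContDiffOn ℝ ∞ (σ.bil α) (A.chart α).U := by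
  have h : ContDiff ℝ ∞ (ContinuousAlternatingMap.bilinearCLM E) :=
    ContinuousLinearMap.contDiff (E := E [⋀^Fin 2]→L[ℝ] ℝ) (F := E →L[ℝ] E →L[ℝ] ℝ) _
  exact h.comp_contDiffOn (σ.smooth α)

theorem bil_self (α : A.Index) (u v : E) : σ.bil α u v v = 0 := by
  rw [bil_apply]
  exact (σ.form α u).map_eq_zero_of_eq _ (i := 0) (j := 1) rfl (by simp)

theorem bil_swap (α : A.Index) (u v w : E) : σ.bil α u v w = - σ.bil α u w v := by
  have := σ.bil_self α u (v + w)
  simp only [map_add, add_apply, bil_self] at this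
  linarith

theorem bil_nondegenerate {α : A.Index} {u : E} (hu : u ∈ (A.chart α).U) {v : E}
    (h : ∀ w, σ.bil α u v w = 0) : v = 0 :=
  σ.nondegenerate α u hu v fun w => by rw [← bil_apply, h]

theorem bil_fderiv {δ α : A.Index} {f : E → E} (hf : (A.chart δ).IsEmbedding (A.chart α) f)
    {u : E} (hu : u ∈ (A.chart δ).U) (v w : E) :
    σ.bil α (f u) (fderiv ℝ f u v) (fderiv ℝ f u w) = σ.bil δ u v w := by
  rw [bil_apply, bil_apply, σ.agree δ α f hf u hu]

theorem bil_act {α : A.Index} {u : E} (hu : u ∈ (A.chart α).U) {g : (A.chart α).G}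
    (hg : (A.chart α).act g u = u) (v w : E) :
    σ.bil α u (fderiv ℝ ((A.chart α).act g) u v) (fderiv ℝ ((A.chart α).act g) u w) =
      σ.bil α u v w := by
  have := σ.invariant α g u hu v w
  rw [hg] at this
  rw [bil_apply, bil_apply, this]

/-- Each isotropy element preserves the form, so its adjoint is its inverse; summing over the group
makes the operator self-adjoint. -/
theorem bil_isotropySum {α : A.Index} {u : E} (hu : u ∈ (A.chart α).U) (v w : E) :
    σ.bil α u ((A.chart α).isotropySum u v) w = σ.bil α u v ((A.chart α).isotropySum u w) := by
  rw [OrbifoldChart.isotropySum_apply, OrbifoldChart.isotropySum_apply, map_sum, map_sum,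
    sum_apply]
  refine Finset.sum_equiv (Equiv.inv _) (fun g => ?_) fun g hg => ?_
  · simp only [Finite.mem_toFinset, mem_ofPred_eq, Equiv.inv_apply]
    refine ⟨fun h => (A.chart α).act_inv_eq hu h, fun h => ?_⟩
    simpa using (A.chart α).act_inv_eq hu h
  · simp only [Finite.mem_toFinset, mem_ofPred_eq] at hg
    have hg' := (A.chart α).act_inv_eq hu hg
    rw [← σ.bil_act hu hg']
    have h1 := (A.chart α).fderiv_act_mul g⁻¹ g hu
    rw [inv_mul_cancel, (A.chart α).fderiv_act_one hu, hg] at h1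
    have h2 := congrArg (fun S : E →L[ℝ] E => S v) h1
    simp only [ContinuousLinearMap.comp_apply, ContinuousLinearMap.id_apply] at h2
    rw [← h2]
    rfl

theorem mem_normalSpace {α : A.Index} {u v : E} :
    v ∈ σ.normalSpace α u ↔ ∀ w ∈ (A.chart α).fixedSpace u, σ.bil α u v w = 0 := by
  simp only [bil_apply]
  rfl

/-- The normal space is the kernel of the averaging operator. -/
theorem mem_normalSpace_iff {α : A.Index} {u v : E} (hu : u ∈ (A.chart α).U) :
    v ∈ σ.normalSpace α u ↔ (A.chart α).isotropySum u v = 0 := by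
  rw [mem_normalSpace]
  constructor
  · intro h
    refine σ.bil_nondegenerate hu fun w => ?_
    rw [σ.bil_isotropySum hu, h _ ((A.chart α).isotropySum_mem hu w)]
  · intro h w hw
    have h1 := σ.bil_isotropySum hu v w
    rw [h, map_zero, zero_apply, (A.chart α).isotropySum_of_mem hw,
      map_smul, smul_eq_mul, eq_comm] at h1
    exact (mul_eq_zero.1 h1).resolve_left ((A.chart α).card_stab_ne_zero hu)

/-- Divided by the order of the stabilizer, `isotropySum` is a projection with image the fixed space
and kernel the normal space. -/
theorem isCompl_fixedSpace_normalSpace {α : A.Index} {u : E} (hu : u ∈ (A.chart α).U) :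
    IsCompl ((A.chart α).fixedSpace u) (σ.normalSpace α u) := by
  have hc := (A.chart α).card_stab_ne_zero hu
  constructor
  · rw [Submodule.disjoint_def]
    intro v hv hv'
    rw [σ.mem_normalSpace_iff hu, (A.chart α).isotropySum_of_mem hv] at hv'
    exact (smul_eq_zero.1 hv').resolve_left hc
  · rw [codisjoint_iff_le_sup]
    intro v _
    have h1 := (A.chart α).isotropySum_mem hu v
    have : v = ((Set.toFinite {g : (A.chart α).G | (A.chart α).act g u = u}).toFinset.card : ℝ)⁻¹ •
        (A.chart α).isotropySum u v +
        (v - ((Set.toFinite {g : (A.chart α).G | (A.chart α).act g u = u}).toFinset.card : ℝ)⁻¹ •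
        (A.chart α).isotropySum u v) := by abel
    rw [this]
    refine Submodule.add_mem_sup (Submodule.smul_mem _ _ h1) ?_
    rw [σ.mem_normalSpace_iff hu, map_sub, map_smul, (A.chart α).isotropySum_of_mem h1,
      inv_smul_smul₀ hc, sub_self]

/-- The symplectic form is nondegenerate on the fixed space. -/
theorem nondegenerate_fixedSpace {α : A.Index} {u : E} (hu : u ∈ (A.chart α).U) {v : E}
    (hv : v ∈ (A.chart α).fixedSpace u)
    (h : ∀ w ∈ (A.chart α).fixedSpace u, σ.bil α u v w = 0) : v = 0 :=
  Submodule.disjoint_def.1 (σ.isCompl_fixedSpace_normalSpace hu).disjoint v hv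
    (σ.mem_normalSpace.2 h)

/-- The symplectic form is nondegenerate on the normal space. -/
theorem nondegenerate_normalSpace {α : A.Index} {u : E} (hu : u ∈ (A.chart α).U) {v : E}
    (hv : v ∈ σ.normalSpace α u)
    (h : ∀ w ∈ σ.normalSpace α u, σ.bil α u v w = 0) : v = 0 := by
  refine σ.bil_nondegenerate hu fun w => ?_
  have hw : w ∈ (A.chart α).fixedSpace u ⊔ σ.normalSpace α u := by
    rw [(σ.isCompl_fixedSpace_normalSpace hu).sup_eq_top]
    trivial
  obtain ⟨a, ha, b, hb, rfl⟩ := Submodule.mem_sup.1 hw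
  rw [map_add, σ.mem_normalSpace.1 hv a ha, h b hb, add_zero]

end OrbifoldAtlas.SymplecticForm

/-! ### Local frames of the normal bundle. -/

namespace OrbifoldAtlas

/-- A local frame of the normal bundle: `j` parametrizes the preimage of `D` in a chart, `L x` is a
linear isomorphism onto the normal space at `j x`, and `r`, `M` are smooth left inverses of `j`, `L`
on the open set `O`. The local group acts on the fibres by the finite set `Γ` of linear maps. -/
structure Frame {E : Type uE} [NormedAddCommGroup E] [NormedSpace ℝ E]
    {X : Type uX} [TopologicalSpace X] {A : OrbifoldAtlas.{uE, uX, uI, uG} E X}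
    (σ : A.SymplecticForm) (D : Set X) (d k : ℕ) where
  α : A.Index
  B : Set (CSpace d)
  O : Set E
  j : CSpace d → E
  r : E → CSpace d
  L : CSpace d → CSpace k →L[ℝ] E
  M : E → E →L[ℝ] CSpace k
  Γ : Set (CSpace k →L[ℝ] CSpace k)
  isOpen_B : IsOpen B
  isOpen_O : IsOpen O
  O_subset : O ⊆ (A.chart α).U
  j_smooth : ContDiffOn ℝ ∞ j B
  r_smooth : ContDiffOn ℝ ∞ r O
  L_smooth : ContDiffOn ℝ ∞ L B
  M_smooth : ContDiffOn ℝ ∞ M O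
  j_mem : ∀ x ∈ B, j x ∈ O
  j_mem_D : ∀ x ∈ B, (A.chart α).φ (j x) ∈ D
  r_j : ∀ x ∈ B, r (j x) = x
  j_r : ∀ w ∈ O, (A.chart α).φ w ∈ D → r w ∈ B ∧ j (r w) = w
  range_fderiv_j : ∀ x ∈ B, range (fderiv ℝ j x) = ((A.chart α).fixedSpace (j x) : Set E)
  M_L : ∀ x ∈ B, ∀ m, M (j x) (L x m) = m
  range_L : ∀ x ∈ B, range (L x) = (σ.normalSpace α (j x) : Set E)
  injOn : ∀ x ∈ B, ∀ y ∈ B, (A.chart α).φ (j x) = (A.chart α).φ (j y) → x = y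
  mem_Γ_iff : ∀ x ∈ B, ∀ γ, γ ∈ Γ ↔ ∃ g, (A.chart α).act g (j x) = j x ∧
    ∀ m, fderiv ℝ ((A.chart α).act g) (j x) (L x m) = L x (γ m)

section

variable {F : Type uE} [NormedAddCommGroup F] [InnerProductSpace ℝ F] [CompleteSpace F]
  {X : Type uX} [TopologicalSpace X] {A : OrbifoldAtlas.{uE, uX, uI, uG} F X}

/-- By faithfulness of the isotropy representation the order of the stabilizer can be read off from
the linear group. Constancy of this order along the isotropy subset is what forces the subset to be
a fixed set locally. -/
theorem card_stab {H : Subgroup (F ≃ₗᵢ[ℝ] F)} {α : A.Index} (u : (A.chart α).U)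
    (h : (A.chart α).φ u ∈ A.isotropySubset H) : Nat.card ((A.chart α).stab u) = Nat.card H := by
  obtain ⟨T, hT⟩ := (mem_isotropySubset_iff u.2).1 h
  rw [← Nat.card_range_of_injective ((A.chart α).isotropyRep_injective u)]
  have hinj : Function.Injective (fun h : H => (T.symm : F →L[ℝ] F).comp
      ((h.1.toContinuousLinearEquiv : F →L[ℝ] F).comp (T : F →L[ℝ] F))) := by
    intro h₁ h₂ he
    ext v
    have := congrArg (fun S : F →L[ℝ] F => S (T.symm v)) he
    simpa using this
  rw [← Nat.card_range_of_injective hinj]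
  congr 2
  ext L
  rw [mem_range, ← (A.chart α).mem_isotropy_iff, hT]
  constructor
  · rintro ⟨h, hh, hv⟩
    refine ⟨⟨h, hh⟩, ?_⟩
    ext v
    simp [← hv]
  · rintro ⟨h, rfl⟩
    exact ⟨h, h.2, fun v => by simp⟩

/-- Every point of `D` is covered by a frame. -/
theorem exists_frame (σ : A.SymplecticForm) {H : Subgroup (F ≃ₗᵢ[ℝ] F)} [Finite H] {d k : ℕ}
    {α : A.Index} {u : F} (hu : u ∈ (A.chart α).U) (huD : (A.chart α).φ u ∈ A.isotropySubset H)
    (ι : CSpace d →L[ℝ] F) (ι' : F →L[ℝ] CSpace d) (hι : ∀ x, ι' (ι x) = x)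
    (hιr : range ι = ((A.chart α).fixedSpace u : Set F))
    (κ : CSpace k →L[ℝ] F) (κ' : F →L[ℝ] CSpace k) (hκ : ∀ x, κ' (κ x) = x)
    (hκr : range κ = (σ.normalSpace α u : Set F)) :
    ∃ t : Frame σ (A.isotropySubset H) d k, ∃ x ∈ t.B,
      (A.chart t.α).φ (t.j x) = (A.chart α).φ u := by
  set c := A.chart α with hc
  obtain ⟨e, hue, hes, hesm, hesymm, heder, heq⟩ := c.exists_linearization hu
  have hmemι : ∀ w ∈ c.fixedSpace u, ι (ι' w) = w := by
    intro w hw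
    rw [← SetLike.mem_coe, ← hιr] at hw
    obtain ⟨x, rfl⟩ := hw
    rw [hι]
  -- a neighbourhood on which only the stabilizer of `u` matters
  have hN1 : ∀ᶠ w in 𝓝 u, ∀ g, c.act g u = u → c.act g w ∈ e.source := by
    refine eventually_all.2 fun g => ?_
    by_cases hg : c.act g u = u
    · filter_upwards [(c.continuousAt_act g hu).preimage_mem_nhds
        (by rw [hg]; exact e.open_source.mem_nhds hue)] with w hw _ using hw
    · exact Eventually.of_forall fun w h => absurd h hg
  have hN2 : ∀ᶠ p in 𝓝 u ×ˢ 𝓝 u, ∀ g, c.act g p.1 = p.2 → c.act g u = u := by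
    refine eventually_all.2 fun g => ?_
    by_cases hg : c.act g u = u
    · exact Eventually.of_forall fun p _ => hg
    · have h1 : Tendsto (fun p : F × F => c.act g p.1 - p.2) (𝓝 u ×ˢ 𝓝 u) (𝓝 (c.act g u - u)) :=
        ((c.continuousAt_act g hu).tendsto.comp tendsto_fst).sub tendsto_snd
      filter_upwards [h1.eventually_ne (sub_ne_zero.2 hg)] with p hp hp'
      exact absurd (sub_eq_zero.2 hp') hp
  obtain ⟨N, hN, hN2⟩ := (eventually_prod_self_iff
    (r := fun x y => ∀ g, c.act g x = y → c.act g u = u)).1 hN2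
  obtain ⟨O, hO, hOo, huO⟩ := mem_nhds_iff.1
    (inter_mem (inter_mem hN1 hN) (e.open_source.mem_nhds hue))
  have hOs : O ⊆ e.source := fun w hw => (hO hw).2
  have hO1 : ∀ w ∈ O, ∀ g, c.act g u = u → c.act g w ∈ e.source := fun w hw => (hO hw).1.1
  have hO2 : ∀ w ∈ O, ∀ w' ∈ O, ∀ g, c.act g w = w' → c.act g u = u :=
    fun w hw w' hw' => hN2 w (hO hw).1.2 w' (hO hw').1.2
  have hOU : O ⊆ c.U := hOs.trans hes
  -- fixed points in `O`
  have hfix : ∀ w ∈ O, e w ∈ c.fixedSpace u → ∀ g, c.act g u = u → c.act g w = w := by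
    intro w hw hew g hg
    refine e.injOn (hO1 w hw g hg) (hOs hw) ?_
    rw [heq g hg w (hOU hw), c.mem_fixedSpace.1 hew g hg]
  have hstab : ∀ w ∈ O, e w ∈ c.fixedSpace u → ∀ g, c.act g w = w ↔ c.act g u = u :=
    fun w hw hew g => ⟨hO2 w hw w hw g, hfix w hw hew g⟩
  -- At a fixed point `w` the differential of `e` intertwines the isotropy representation at `w`
  -- with the one at `u`; all data at `w` are obtained from those at `u` through it.
  have hT : ∀ w ∈ O, e w ∈ c.fixedSpace u → ∃ T : F ≃L[ℝ] F, HasFDerivAt e (T : F →L[ℝ] F) w ∧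
      HasFDerivAt e.symm (T.symm : F →L[ℝ] F) (e w) ∧
      ∀ g, c.act g u = u → ∀ v, T (fderiv ℝ (c.act g) w v) = fderiv ℝ (c.act g) u (T v) := by
    intro w hw hew
    obtain ⟨T, hT⟩ := heder w (hOs hw)
    refine ⟨T, hT, ?_, fun g hg v => ?_⟩
    · refine e.hasFDerivAt_symm (e.map_source (hOs hw)) ?_
      rwa [e.left_inv (hOs hw)]
    · have h1 : HasFDerivAt (e ∘ c.act g) ((T : F →L[ℝ] F).comp (fderiv ℝ (c.act g) w)) w := by
        refine HasFDerivAt.comp w ?_ (c.hasFDerivAt_act g (hOU hw))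
        rwa [hfix w hw hew g hg]
      have h2 : HasFDerivAt (fderiv ℝ (c.act g) u ∘ e)
          ((fderiv ℝ (c.act g) u).comp (T : F →L[ℝ] F)) w :=
        (fderiv ℝ (c.act g) u).hasFDerivAt.comp w hT
      have h3 := h1.unique (h2.congr_of_eventuallyEq (by
        filter_upwards [hOo.mem_nhds hw] with x hx using heq g hg x (hOU hx)))
      exact congrArg (fun S : F →L[ℝ] F => S v) h3
  -- Inside `O` stabilizers can only shrink, and on the isotropy subset they all have the same
  -- order. Hence a point of `O` lies there exactly when the whole stabilizer of `u` fixes it, that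
  -- is, when its linear coordinate lies in the fixed space.
  have hD : ∀ w ∈ O, c.φ w ∈ A.isotropySubset H ↔ e w ∈ c.fixedSpace u := by
    intro w hw
    constructor
    · intro hwD
      have hle : c.stab ⟨w, hOU hw⟩ ≤ c.stab ⟨u, hu⟩ := fun g hg => hO2 w hw w hw g hg
      have heqs : c.stab ⟨w, hOU hw⟩ = c.stab ⟨u, hu⟩ := by
        refine Subgroup.eq_of_le_of_card_ge hle ?_
        rw [card_stab ⟨w, hOU hw⟩ hwD, card_stab ⟨u, hu⟩ huD]
      rw [c.mem_fixedSpace]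
      intro g hg
      have hgw : c.act g w = w := by
        have : g ∈ c.stab ⟨w, hOU hw⟩ := heqs ▸ hg
        exact this
      rw [← heq g hg w (hOU hw), hgw]
    · intro hew
      obtain ⟨T, -, -, hT⟩ := hT w hw hew
      obtain ⟨S, hS⟩ := (mem_isotropySubset_iff hu).1 huD
      refine (mem_isotropySubset_iff (hOU hw)).2 ⟨T.trans S, fun L => ?_⟩
      constructor
      · rintro ⟨g, hg, rfl⟩
        have hg' := (hstab w hw hew g).1 hg
        obtain ⟨h, hh, hhS⟩ := (hS _).1 ⟨g, hg', rfl⟩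
        refine ⟨h, hh, fun v => ?_⟩
        simp only [ContinuousLinearEquiv.trans_apply]
        rw [hT g hg', hhS]
      · rintro ⟨h, hh, hv⟩
        obtain ⟨g, hg, hgL⟩ := (hS ((S.symm : F →L[ℝ] F).comp
          ((h.toContinuousLinearEquiv : F →L[ℝ] F).comp (S : F →L[ℝ] F)))).2
          ⟨h, hh, fun v => by simp⟩
        refine ⟨g, (hstab w hw hew g).2 hg, ?_⟩
        ext v
        apply T.injective
        rw [hT g hg, ← hgL]
        have := hv v
        simp only [ContinuousLinearEquiv.trans_apply] at this
        simp [← this]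
  -- The form at `w` need not correspond to the form at `u` under `T`. The normal spaces do
  -- correspond, because they are kernels of the averaging operators, which `T` intertwines.
  have hfixT : ∀ w ∈ O, e w ∈ c.fixedSpace u → ∀ T : F ≃L[ℝ] F,
      (∀ g, c.act g u = u → ∀ v, T (fderiv ℝ (c.act g) w v) = fderiv ℝ (c.act g) u (T v)) →
      ∀ v, (v ∈ c.fixedSpace w ↔ T v ∈ c.fixedSpace u) ∧
        (v ∈ σ.normalSpace α w ↔ T v ∈ σ.normalSpace α u) := by
    intro w hw hew T hT v
    constructor
    · rw [c.mem_fixedSpace, c.mem_fixedSpace]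
      refine forall_congr' fun g => ?_
      rw [hstab w hw hew g]
      refine forall_congr' fun hg => ?_
      rw [← hT g hg, T.injective.eq_iff]
    · rw [σ.mem_normalSpace_iff hu, σ.mem_normalSpace_iff (hOU hw),
        OrbifoldChart.isotropySum_apply, OrbifoldChart.isotropySum_apply,
        ← T.map_eq_zero_iff, map_sum]
      refine Eq.congr (Finset.sum_congr ?_ fun g hg => ?_) rfl
      · ext g
        simpa using hstab w hw hew g
      · exact hT g (by simpa using hg) v
  set B : Set (CSpace d) := ι ⁻¹' (e.target ∩ e.symm ⁻¹' O) with hB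
  have hBo : IsOpen B := (e.isOpen_inter_preimage_symm hOo).preimage ι.continuous
  have hιfix : ∀ x, ι x ∈ c.fixedSpace u := fun x => by
    rw [← SetLike.mem_coe, ← hιr]
    exact mem_range_self x
  have hej : ∀ x ∈ B, e (e.symm (ι x)) = ι x := fun x hx => e.right_inv hx.1
  have hjfix : ∀ x ∈ B, e (e.symm (ι x)) ∈ c.fixedSpace u := fun x hx => by
    rw [hej x hx]
    exact hιfix x
  have hBt : MapsTo ι B e.target := fun x hx => hx.1
  let t : Frame σ (A.isotropySubset H) d k :=
    { α := α
      B := B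
      O := O
      j := fun x => e.symm (ι x)
      r := fun w => ι' (e w)
      L := fun x => (fderiv ℝ e.symm (ι x)).comp κ
      M := fun w => κ'.comp (fderiv ℝ e w)
      -- The group is defined at `u` alone; the field `mem_Γ_iff` below checks that it is the local
      -- group at every point of the frame.
      Γ := {γ | ∃ g, c.act g u = u ∧ ∀ m, fderiv ℝ (c.act g) u (κ m) = κ (γ m)}
      isOpen_B := hBo
      isOpen_O := hOo
      O_subset := hOU
      j_smooth := hesymm.comp ι.contDiff.contDiffOn hBt
      r_smooth := ι'.contDiff.comp_contDiffOn (hesm.mono hOU)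
      L_smooth := by
        have h1 : ContDiffOn ℝ ∞ (fderiv ℝ e.symm) e.target :=
          hesymm.fderiv_of_isOpen e.open_target (by simp)
        exact (h1.comp ι.contDiff.contDiffOn hBt).clm_comp contDiffOn_const
      M_smooth := by
        have h1 : ContDiffOn ℝ ∞ (fderiv ℝ e) c.U :=
          hesm.fderiv_of_isOpen c.isOpen_U (by simp)
        exact contDiffOn_const.clm_comp (h1.mono hOU)
      j_mem := fun x hx => hx.2
      j_mem_D := fun x hx => (hD _ hx.2).2 (hjfix x hx)
      r_j := fun x hx => by
        rw [hej x hx, hι]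
      j_r := fun w hw hwD => by
        have h1 := hmemι _ ((hD w hw).1 hwD)
        have h2 : e.symm (ι (ι' (e w))) = w := by rw [h1, e.left_inv (hOs hw)]
        refine ⟨⟨?_, ?_⟩, h2⟩
        · rw [h1]
          exact e.map_source (hOs hw)
        · change e.symm _ ∈ O
          rwa [h2]
      range_fderiv_j := fun x hx => by
        obtain ⟨T, hT1, hT2, hT3⟩ := hT _ hx.2 (hjfix x hx)
        rw [hej x hx] at hT2
        have hd : HasFDerivAt (fun x => e.symm (ι x)) ((T.symm : F →L[ℝ] F).comp ι) x :=
          hT2.comp x ι.hasFDerivAt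
        rw [hd.fderiv]
        ext v
        rw [SetLike.mem_coe, ((hfixT _ hx.2 (hjfix x hx) T hT3 v).1), ← SetLike.mem_coe, ← hιr]
        simp [ContinuousLinearEquiv.symm_apply_eq]
      M_L := fun x hx m => by
        obtain ⟨T, hT1, hT2, hT3⟩ := hT _ hx.2 (hjfix x hx)
        rw [hej x hx] at hT2
        change κ' (fderiv ℝ e (e.symm (ι x)) (fderiv ℝ e.symm (ι x) (κ m))) = m
        rw [hT1.fderiv, hT2.fderiv]
        simp [hκ]
      range_L := fun x hx => by
        obtain ⟨T, hT1, hT2, hT3⟩ := hT _ hx.2 (hjfix x hx)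
        rw [hej x hx] at hT2
        rw [hT2.fderiv]
        ext v
        rw [SetLike.mem_coe, ((hfixT _ hx.2 (hjfix x hx) T hT3 v).2), ← SetLike.mem_coe, ← hκr]
        simp [ContinuousLinearEquiv.symm_apply_eq]
      injOn := fun x hx y hy hxy => by
        obtain ⟨g, hg⟩ := (c.φ_eq_iff _ (hOU hx.2) _ (hOU hy.2)).1 hxy
        rw [hfix _ hx.2 (hjfix x hx) g (hO2 _ hx.2 _ hy.2 g hg)] at hg
        rw [← hι x, ← hι y, ← hej x hx, ← hej y hy, hg]
      mem_Γ_iff := fun x hx γ => by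
        obtain ⟨T, hT1, hT2, hT3⟩ := hT _ hx.2 (hjfix x hx)
        rw [hej x hx] at hT2
        refine exists_congr fun g => ?_
        change _ ↔ c.act g (e.symm (ι x)) = _ ∧ _
        rw [hstab _ hx.2 (hjfix x hx)]
        refine and_congr_right fun hg => forall_congr' fun m => ?_
        change _ ↔ fderiv ℝ (c.act g) _ (fderiv ℝ e.symm (ι x) (κ m)) =
          fderiv ℝ e.symm (ι x) (κ (γ m))
        refine Iff.trans ?_ T.injective.eq_iff
        rw [hT3 g hg, hT2.fderiv]
        simp }
  have huf : e u ∈ c.fixedSpace u := (hD u huO).1 huD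
  refine ⟨t, ι' (e u), (t.j_r u huO huD).1, ?_⟩
  change c.φ (e.symm (ι (ι' (e u)))) = _
  rw [hmemι _ huf, e.left_inv hue]

end

end OrbifoldAtlas

theorem ContDiffOn.clm_flip {E F G H : Type*} [NormedAddCommGroup E] [NormedSpace ℝ E]
    [NormedAddCommGroup F] [NormedSpace ℝ F] [NormedAddCommGroup G] [NormedSpace ℝ G]
    [NormedAddCommGroup H] [NormedSpace ℝ H] {n : WithTop ℕ∞} {s : Set E}
    {f : E → F →L[ℝ] G →L[ℝ] H} (hf : ContDiffOn ℝ n f s) :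
    ContDiffOn ℝ n (fun x => (f x).flip) s := by
  have h := LinearIsometryEquiv.contDiff (𝕜 := ℝ) (n := n) (E := F →L[ℝ] G →L[ℝ] H)
    (F := G →L[ℝ] F →L[ℝ] H) (ContinuousLinearMap.flipₗᵢ ℝ F G H)
  exact h.comp_contDiffOn hf

/-! ### Frames as charts of the normal bundle, and their transition functions. -/

namespace OrbifoldAtlas

variable {E : Type uE} [NormedAddCommGroup E] [NormedSpace ℝ E] [CompleteSpace E]
  {X : Type uX} [TopologicalSpace X] {A : OrbifoldAtlas.{uE, uX, uI, uG} E X}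
  {σ : A.SymplecticForm} {D : Set X} {d k : ℕ}

/-- A local transition diffeomorphism between charts, with its action on normal vectors. -/
theorem SymplecticForm.exists_transition (σ : A.SymplecticForm) (D : Set X) {α β : A.Index}
    {u w : E} (hu : u ∈ (A.chart α).U) (hw : w ∈ (A.chart β).U)
    (h : (A.chart α).φ u = (A.chart β).φ w) :
    ∃ (W : Set E) (τ : E → E), IsOpen W ∧ w ∈ W ∧ W ⊆ (A.chart β).U ∧ ContDiffOn ℝ ∞ τ W ∧
      τ w = u ∧ ∀ x ∈ W, τ x ∈ (A.chart α).U ∧ (A.chart α).φ (τ x) = (A.chart β).φ x ∧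
        (∀ v v', σ.bil α (τ x) (fderiv ℝ τ x v) (fderiv ℝ τ x v') = σ.bil β x v v') ∧
        (∀ v, fderiv ℝ τ x v ∈ σ.normalSpace α (τ x) ↔ v ∈ σ.normalSpace β x) ∧
        ∀ v hp hq, (Quot.mk _ ⟨β, (x, v), hp⟩ : σ.NormalBundle D) =
          Quot.mk _ ⟨α, (τ x, fderiv ℝ τ x v), hq⟩ := by
  obtain ⟨δ, z, hz, f, g, hf, hg, rfl, rfl⟩ := exists_embeddings hw hu h.symm
  obtain ⟨f', hf', hff⟩ := hf.smooth_inverse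
  refine ⟨f '' (A.chart δ).U, g ∘ f', hf.isOpen_image, ⟨z, hz, rfl⟩,
    image_subset_iff.2 hf.mapsTo, hg.smooth.comp hf' ?_, by simp [hff z hz], ?_⟩
  · rintro _ ⟨y, hy, rfl⟩
    rwa [hff y hy]
  rintro _ ⟨y, hy, rfl⟩
  have hd' : HasFDerivAt f' (fderiv ℝ f' (f y)) (f y) :=
    ((hf'.contDiffAt (hf.isOpen_image.mem_nhds ⟨y, hy, rfl⟩)).differentiableAt
      (by simp)).hasFDerivAt
  have hd : fderiv ℝ (g ∘ f') (f y) = (fderiv ℝ g y).comp (fderiv ℝ f' (f y)) := by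
    have h3 : HasFDerivAt g (fderiv ℝ g y) (f' (f y)) := by
      rw [hff y hy]
      exact hg.hasFDerivAt hy
    exact (h3.comp (f y) hd').fderiv
  obtain ⟨T, hT⟩ := hf.exists_fderiv_equiv hy
  have hinv : ∀ v, fderiv ℝ f y (fderiv ℝ f' (f y) v) = v := by
    intro v
    have h1 : (fderiv ℝ f' (f y)).comp (fderiv ℝ f y) = ContinuousLinearMap.id ℝ E := by
      refine (hd'.comp y (hf.hasFDerivAt hy)).unique
        ((hasFDerivAt_id y).congr_of_eventuallyEq ?_)
      filter_upwards [(A.chart δ).isOpen_U.mem_nhds hy] with x hx using hff x hx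
    have h2 := congrArg (fun S : E →L[ℝ] E => S (T.symm v)) h1
    have h3 : fderiv ℝ f y (T.symm v) = v := by
      rw [← hT]
      exact T.apply_symm_apply v
    simp only [ContinuousLinearMap.comp_apply, h3, ContinuousLinearMap.id_apply] at h2
    rw [h2, h3]
  have hgf : (g ∘ f') (f y) = g y := by rw [Function.comp_apply, hff y hy]
  rw [hd]
  refine ⟨by rw [hgf]; exact hg.mapsTo hy, by rw [hgf, hg.comm y hy, hf.comm y hy], ?_, ?_, ?_⟩
  · intro v v'
    rw [hgf, ContinuousLinearMap.comp_apply, ContinuousLinearMap.comp_apply, σ.bil_fderiv hg hy,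
      ← σ.bil_fderiv hf hy, hinv, hinv]
  · intro v
    rw [hgf, ContinuousLinearMap.comp_apply, σ.fderiv_mem_normalSpace_iff hg hy,
      ← σ.fderiv_mem_normalSpace_iff hf hy, hinv]
  · intro v hp hq
    rw [SymplecticForm.mk_eq_mk_iff]
    exact ⟨δ, y, hy, f, g, hf, hg, rfl, hgf.symm, fderiv ℝ f' (f y) v, hinv v, rfl⟩

namespace Frame

variable (t s : Frame σ D d k)

/-- The parametrization of the open subset of `D` covered by the frame. -/
def b (x : CSpace d) : X := (A.chart t.α).φ (t.j x)

open Classical in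
/-- The chart `B × ℂ^k → ν_D` given by the frame. -/
noncomputable def Φ [Nonempty (σ.NormalBundle D)] (p : CSpace d × CSpace k) : σ.NormalBundle D :=
  -- Over `B` the condition holds by `valid`; elsewhere the value is arbitrary and plays no role.
  if h : t.j p.1 ∈ (A.chart t.α).U ∧ (A.chart t.α).φ (t.j p.1) ∈ D ∧
      t.L p.1 p.2 ∈ σ.normalSpace t.α (t.j p.1)
  then Quot.mk _ ⟨t.α, (t.j p.1, t.L p.1 p.2), h⟩ else Classical.arbitrary _

/-- The symplectic form in the frame. -/
noncomputable def form (x : CSpace d) : CSpace k →L[ℝ] CSpace k →L[ℝ] ℝ :=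
  ContinuousLinearMap.bilinearComp (σ.bil t.α (t.j x)) (t.L x) (t.L x)

theorem form_apply (x : CSpace d) (m m' : CSpace k) :
    t.form x m m' = σ.bil t.α (t.j x) (t.L x m) (t.L x m') := rfl

variable {t s} {x y : CSpace d}

theorem L_mem (hx : x ∈ t.B) (m : CSpace k) : t.L x m ∈ σ.normalSpace t.α (t.j x) := by
  rw [← SetLike.mem_coe, ← t.range_L x hx]
  exact mem_range_self m

theorem j_mem_U (hx : x ∈ t.B) : t.j x ∈ (A.chart t.α).U := t.O_subset (t.j_mem x hx)

theorem b_mem (hx : x ∈ t.B) : t.b x ∈ D := t.j_mem_D x hx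

theorem valid (hx : x ∈ t.B) (m : CSpace k) : t.j x ∈ (A.chart t.α).U ∧
    (A.chart t.α).φ (t.j x) ∈ D ∧ t.L x m ∈ σ.normalSpace t.α (t.j x) :=
  ⟨j_mem_U hx, b_mem hx, L_mem hx m⟩

theorem L_M (hx : x ∈ t.B) {v : E} (hv : v ∈ σ.normalSpace t.α (t.j x)) :
    t.L x (t.M (t.j x) v) = v := by
  rw [← SetLike.mem_coe, ← t.range_L x hx] at hv
  obtain ⟨m, rfl⟩ := hv
  rw [t.M_L x hx]

theorem L_injective (hx : x ∈ t.B) : Function.Injective (t.L x) :=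
  (show Function.LeftInverse (t.M (t.j x)) (t.L x) from t.M_L x hx).injective

theorem form_smooth : ContDiffOn ℝ ∞ t.form t.B := by
  have h1 : ContDiffOn ℝ ∞ (fun x => σ.bil t.α (t.j x)) t.B :=
    (σ.bil_smooth t.α).comp t.j_smooth fun x hx => j_mem_U hx
  have h2 : ContDiffOn ℝ ∞ (fun x => (σ.bil t.α (t.j x)).comp (t.L x)) t.B :=
    h1.clm_comp t.L_smooth
  have h3 : ContDiffOn ℝ ∞ (fun x => (((σ.bil t.α (t.j x)).comp (t.L x)).flip.comp (t.L x))) t.B :=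
    h2.clm_flip.clm_comp t.L_smooth
  exact h3.clm_flip

theorem form_nondegenerate (hx : x ∈ t.B) {m : CSpace k} (h : ∀ m', t.form x m m' = 0) : m = 0 := by
  refine L_injective hx ?_
  rw [map_zero]
  refine σ.nondegenerate_normalSpace (j_mem_U hx) (L_mem hx m) fun w hw => ?_
  rw [← L_M hx hw]
  exact h _

theorem continuousOn_b : ContinuousOn t.b t.B :=
  (A.chart t.α).φ_continuousOn.comp t.j_smooth.continuousOn fun _ hx => j_mem_U hx

/-- `b` maps neighbourhoods to neighbourhoods in `D`. -/
theorem exists_open_inter_subset {W : Set (CSpace d)} (hW : W ∈ 𝓝 x) (hx : x ∈ t.B) :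
    ∃ V, IsOpen V ∧ t.b x ∈ V ∧ V ∩ D ⊆ t.b '' (W ∩ t.B) := by
  obtain ⟨W', hW', hW'o, hxW'⟩ := mem_nhds_iff.1 hW
  refine ⟨(A.chart t.α).φ '' (t.O ∩ t.r ⁻¹' W'), (A.chart t.α).φ_open _
    (inter_subset_left.trans t.O_subset)
    (t.r_smooth.continuousOn.isOpen_inter_preimage t.isOpen_O hW'o),
    ⟨t.j x, ⟨t.j_mem x hx, by rwa [mem_preimage, t.r_j x hx]⟩, rfl⟩, ?_⟩
  rintro _ ⟨⟨w, ⟨hwO, hwr⟩, rfl⟩, hwD⟩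
  have := t.j_r w hwO hwD
  exact ⟨t.r w, ⟨hW' hwr, this.1⟩, by rw [b, this.2]⟩

theorem b_injOn : InjOn t.b t.B := fun x hx y hy h => t.injOn x hx y hy h

theorem inv_mem_Γ (hx : x ∈ t.B) {γ : CSpace k →L[ℝ] CSpace k} (hγ : γ ∈ t.Γ) :
    ∃ γ' ∈ t.Γ, (∀ m, γ' (γ m) = m) ∧ ∀ m, γ (γ' m) = m := by
  obtain ⟨g, hg, h⟩ := (t.mem_Γ_iff x hx γ).1 hγ
  have hU := j_mem_U hx
  have hg' := (A.chart t.α).act_inv_eq hU hg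
  have h1 := (A.chart t.α).fderiv_act_mul g⁻¹ g hU
  rw [inv_mul_cancel, (A.chart t.α).fderiv_act_one hU, hg] at h1
  have h2 := (A.chart t.α).fderiv_act_mul g g⁻¹ hU
  rw [mul_inv_cancel, (A.chart t.α).fderiv_act_one hU, hg'] at h2
  have e1 : ∀ v, fderiv ℝ ((A.chart t.α).act g⁻¹) (t.j x)
      (fderiv ℝ ((A.chart t.α).act g) (t.j x) v) = v :=
    fun v => (congrArg (fun S : E →L[ℝ] E => S v) h1).symm
  have e2 : ∀ v, fderiv ℝ ((A.chart t.α).act g) (t.j x)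
      (fderiv ℝ ((A.chart t.α).act g⁻¹) (t.j x) v) = v :=
    fun v => (congrArg (fun S : E →L[ℝ] E => S v) h2).symm
  have hn : ∀ m, fderiv ℝ ((A.chart t.α).act g⁻¹) (t.j x) (t.L x m) ∈
      σ.normalSpace t.α (t.j x) := by
    intro m
    have h3 := (σ.fderiv_mem_normalSpace_iff (OrbifoldChart.IsEmbedding.act _ g⁻¹) hU
      (v := t.L x m)).2 (L_mem hx m)
    rwa [hg'] at h3
  have hL : ∀ m, fderiv ℝ ((A.chart t.α).act g⁻¹) (t.j x) (t.L x m) = t.L x (((t.M (t.j x)).comp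
      ((fderiv ℝ ((A.chart t.α).act g⁻¹) (t.j x)).comp (t.L x))) m) := by
    intro m
    exact (L_M hx (hn m)).symm
  refine ⟨_, (t.mem_Γ_iff x hx _).2 ⟨g⁻¹, hg', hL⟩, fun m => L_injective hx ?_,
    fun m => L_injective hx ?_⟩
  · rw [← hL, ← h, e1]
  · rw [← h, ← hL, e2]

theorem one_mem_Γ (hx : x ∈ t.B) : ContinuousLinearMap.id ℝ (CSpace k) ∈ t.Γ := by
  refine (t.mem_Γ_iff x hx _).2 ⟨1, (A.chart t.α).act_one _ (j_mem_U hx), fun m => ?_⟩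
  rw [(A.chart t.α).fderiv_act_one (j_mem_U hx)]
  rfl

theorem mul_mem_Γ (hx : x ∈ t.B) {γ γ' : CSpace k →L[ℝ] CSpace k} (hγ : γ ∈ t.Γ)
    (hγ' : γ' ∈ t.Γ) : γ.comp γ' ∈ t.Γ := by
  obtain ⟨g, hg, h⟩ := (t.mem_Γ_iff x hx γ).1 hγ
  obtain ⟨g', hg', h'⟩ := (t.mem_Γ_iff x hx γ').1 hγ'
  refine (t.mem_Γ_iff x hx _).2 ⟨g * g', (A.chart t.α).act_mul_eq (j_mem_U hx) hg hg', fun m => ?_⟩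
  rw [(A.chart t.α).fderiv_act_mul _ _ (j_mem_U hx), hg', ContinuousLinearMap.comp_apply, h', h]
  rfl

theorem finite_Γ (hx : x ∈ t.B) : t.Γ.Finite := by
  refine (Set.finite_range fun g : (A.chart t.α).G => (t.M (t.j x)).comp
      ((fderiv ℝ ((A.chart t.α).act g) (t.j x)).comp (t.L x))).subset ?_
  intro γ hγ
  obtain ⟨g, hg, h⟩ := (t.mem_Γ_iff x hx γ).1 hγ
  refine ⟨g, ?_⟩
  ext1 m
  simp only [ContinuousLinearMap.comp_apply]
  rw [h, t.M_L x hx]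

/-- The symplectic form is invariant under the group of the frame. -/
theorem form_Γ (hx : x ∈ t.B) {γ : CSpace k →L[ℝ] CSpace k} (hγ : γ ∈ t.Γ) (m m' : CSpace k) :
    t.form x (γ m) (γ m') = t.form x m m' := by
  obtain ⟨g, hg, h⟩ := (t.mem_Γ_iff x hx γ).1 hγ
  rw [form_apply, ← h, ← h, σ.bil_act (j_mem_U hx) hg, form_apply]

variable [Nonempty (σ.NormalBundle D)]

theorem Φ_eq (hx : x ∈ t.B) (m : CSpace k) : t.Φ (x, m) =
    Quot.mk _ ⟨t.α, (t.j x, t.L x m), valid hx m⟩ :=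
  dif_pos (valid hx m)

theorem normalProj_Φ (hx : x ∈ t.B) (m : CSpace k) : σ.normalProj D (t.Φ (x, m)) = t.b x := by
  rw [Φ_eq hx]
  rfl

/-- The field `injOn` excludes identifications between different fibres. Within one fibre two
vectors of a chart are identified exactly by the stabilizer, which acts through `Γ`. -/
theorem Φ_eq_iff (hx : x ∈ t.B) (hy : y ∈ t.B) (m m' : CSpace k) :
    t.Φ (x, m) = t.Φ (y, m') ↔ x = y ∧ ∃ γ ∈ t.Γ, γ m = m' := by
  constructor
  · intro h
    have hxy : x = y := t.injOn x hx y hy (by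
      have := congrArg (σ.normalProj D) h
      rwa [normalProj_Φ hx, normalProj_Φ hy] at this)
    subst hxy
    refine ⟨rfl, ?_⟩
    rw [Φ_eq hx, Φ_eq hx] at h
    obtain ⟨g, hg, hgm⟩ := (SymplecticForm.mk_eq_mk_iff.1 h).exists_act
    simp only at hg hgm
    have hn : ∀ m, fderiv ℝ ((A.chart t.α).act g) (t.j x) (t.L x m) ∈
        σ.normalSpace t.α (t.j x) := by
      intro m
      have h3 := (σ.fderiv_mem_normalSpace_iff (OrbifoldChart.IsEmbedding.act _ g) (j_mem_U hx)
        (v := t.L x m)).2 (L_mem hx m)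
      rwa [hg] at h3
    refine ⟨(t.M (t.j x)).comp ((fderiv ℝ ((A.chart t.α).act g) (t.j x)).comp (t.L x)),
      (t.mem_Γ_iff x hx _).2 ⟨g, hg, fun m => (L_M hx (hn m)).symm⟩, ?_⟩
    simp only [ContinuousLinearMap.comp_apply]
    rw [hgm, t.M_L x hx]
  · rintro ⟨rfl, γ, hγ, rfl⟩
    obtain ⟨g, hg, h⟩ := (t.mem_Γ_iff x hx γ).1 hγ
    rw [Φ_eq hx, Φ_eq hx]
    refine Quot.sound ⟨(A.chart t.α).act g, .act _ g, Prod.ext hg.symm ?_⟩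
    exact (h m).symm

/-- A frame trivializes the normal bundle near every point over its domain. -/
theorem exists_lift {β : A.Index} {w : E} (hw : w ∈ (A.chart β).U) (hx : x ∈ t.B)
    (h : (A.chart β).φ w = t.b x) :
    ∃ (W : Set E) (ψ : E → CSpace d) (P : E → E →L[ℝ] CSpace k), IsOpen W ∧ w ∈ W ∧
      W ⊆ (A.chart β).U ∧ ContDiffOn ℝ ∞ ψ W ∧ ContDiffOn ℝ ∞ P W ∧ ψ w = x ∧
      ∀ z ∈ W, (A.chart β).φ z ∈ D → ψ z ∈ t.B ∧ t.b (ψ z) = (A.chart β).φ z ∧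
        (∀ v ∈ σ.normalSpace β z, ∀ v' ∈ σ.normalSpace β z,
          t.form (ψ z) (P z v) (P z v') = σ.bil β z v v') ∧
        ∀ v hp, (Quot.mk _ ⟨β, (z, v), hp⟩ : σ.NormalBundle D) = t.Φ (ψ z, P z v) := by
  obtain ⟨W, τ, hWo, hwW, hWU, hτ, hτw, hW⟩ := σ.exists_transition D (j_mem_U hx) hw h.symm
  have hτd : ContDiffOn ℝ ∞ (fderiv ℝ τ) W := hτ.fderiv_of_isOpen hWo (by simp)
  refine ⟨W ∩ τ ⁻¹' t.O, t.r ∘ τ, fun z => (t.M (τ z)).comp (fderiv ℝ τ z),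
    hτ.continuousOn.isOpen_inter_preimage hWo t.isOpen_O,
    ⟨hwW, by rw [mem_preimage, hτw]; exact t.j_mem x hx⟩, inter_subset_left.trans hWU,
    t.r_smooth.comp (hτ.mono inter_subset_left) fun z hz => hz.2,
    (t.M_smooth.comp (hτ.mono inter_subset_left) fun z hz => hz.2).clm_comp
      (hτd.mono inter_subset_left), by rw [Function.comp_apply, hτw, t.r_j x hx], ?_⟩
  rintro z ⟨hzW, hzO⟩ hzD
  obtain ⟨h1, h2, h3, h4, h5⟩ := hW z hzW
  obtain ⟨h6, h7⟩ := t.j_r (τ z) hzO (by rwa [h2])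
  have hLM : ∀ v ∈ σ.normalSpace β z, t.L (t.r (τ z)) (t.M (τ z) (fderiv ℝ τ z v)) =
      fderiv ℝ τ z v := by
    intro v hv
    have := L_M h6 (v := fderiv ℝ τ z v) (by rw [h7]; exact (h4 v).2 hv)
    rwa [h7] at this
  refine ⟨h6, by rw [b, Function.comp_apply, h7, h2], ?_, ?_⟩
  · intro v hv v' hv'
    rw [form_apply]
    simp only [Function.comp_apply, ContinuousLinearMap.comp_apply]
    rw [hLM v hv, hLM v' hv', h7, h3]
  · intro v hp
    rw [h5 v hp ⟨h1, h2 ▸ hzD, (h4 v).2 hp.2.2⟩]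
    simp only [Function.comp_apply, ContinuousLinearMap.comp_apply]
    rw [Φ_eq h6]
    congr 1
    refine Sigma.ext rfl (heq_of_eq (Subtype.ext ?_))
    exact Prod.ext h7.symm (hLM v hp.2.2).symm

theorem exists_Φ_eq {q : σ.NormalBundle D} (hx : x ∈ t.B) (h : σ.normalProj D q = t.b x) :
    ∃ m, t.Φ (x, m) = q := by
  obtain ⟨⟨β, ⟨w, v⟩, hp⟩, rfl⟩ := Quot.exists_rep q
  obtain ⟨W, ψ, P, -, hwW, -, -, -, hψ, hW⟩ := exists_lift hp.1 hx h
  obtain ⟨-, -, -, h4⟩ := hW w hwW hp.2.1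
  exact ⟨P w v, by rw [h4 v hp, hψ]⟩

/-- Transition functions between frames. -/
theorem exists_frame_transition (hx : x ∈ t.B) (hy : y ∈ s.B) (h : t.b x = s.b y) :
    ∃ (W : Set (CSpace d)) (ψ : CSpace d → CSpace d) (P : CSpace d → CSpace k →L[ℝ] CSpace k),
      IsOpen W ∧ x ∈ W ∧ W ⊆ t.B ∧ ContDiffOn ℝ ∞ ψ W ∧ ContDiffOn ℝ ∞ P W ∧ ψ x = y ∧
      ∀ z ∈ W, ψ z ∈ s.B ∧ s.b (ψ z) = t.b z ∧
        (∀ m m', s.form (ψ z) (P z m) (P z m') = t.form z m m') ∧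
        ∀ m, t.Φ (z, m) = s.Φ (ψ z, P z m) := by
  obtain ⟨W, ψ, P, hWo, hwW, hWU, hψs, hPs, hψ, hW⟩ := exists_lift (j_mem_U hx) hy h
  refine ⟨t.B ∩ t.j ⁻¹' W, ψ ∘ t.j, fun z => (P (t.j z)).comp (t.L z),
    t.j_smooth.continuousOn.isOpen_inter_preimage t.isOpen_B hWo, ⟨hx, hwW⟩, inter_subset_left,
    hψs.comp (t.j_smooth.mono inter_subset_left) fun z hz => hz.2,
    (hPs.comp (t.j_smooth.mono inter_subset_left) fun z hz => hz.2).clm_comp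
      (t.L_smooth.mono inter_subset_left), hψ, ?_⟩
  rintro z ⟨hz, hzW⟩
  obtain ⟨h1, h2, h3, h4⟩ := hW _ hzW (t.j_mem_D z hz)
  refine ⟨h1, h2, fun m m' => h3 _ (L_mem hz m) _ (L_mem hz m'), fun m => ?_⟩
  rw [Φ_eq hz, h4]
  rfl

theorem continuousOn_Φ : ContinuousOn t.Φ (t.B ×ˢ univ) := by
  rw [continuousOn_iff_continuous_domRestrict]
  have h : (t.B ×ˢ univ).domRestrict t.Φ = fun p : (t.B ×ˢ univ : Set (CSpace d × CSpace k)) =>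
      (Quot.mk _ ⟨t.α, (t.j p.1.1, t.L p.1.1 p.1.2), valid p.2.1 p.1.2⟩ : σ.NormalBundle D) := by
    funext p
    exact Φ_eq p.2.1 p.1.2
  rw [h]
  have h1 : Continuous fun p : (t.B ×ˢ univ : Set (CSpace d × CSpace k)) => t.j p.1.1 :=
    t.j_smooth.continuousOn.comp_continuous (by fun_prop) fun p => p.2.1
  have h2 : Continuous fun p : (t.B ×ˢ univ : Set (CSpace d × CSpace k)) => t.L p.1.1 :=
    t.L_smooth.continuousOn.comp_continuous (by fun_prop) fun p => p.2.1
  exact continuous_quot_mk.comp (continuous_sigmaMk.comp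
    ((h1.prodMk (h2.clm_apply (by fun_prop))).subtype_mk _))

/-- Openness is tested in each chart of the disjoint union. By `exists_lift` a nearby normal vector
is the value of `Φ` at a point depending continuously on it. At the given vector this point may
differ from the chosen preimage in `W` by some `γ`, so the lift is corrected by that `γ`. -/
theorem isOpen_image_Φ {W : Set (CSpace d × CSpace k)} (hW : IsOpen W) (hWB : W ⊆ t.B ×ˢ univ) :
    IsOpen (t.Φ '' W) := by
  change IsOpen (Quot.mk _ ⁻¹' (t.Φ '' W))
  rw [isOpen_sigma_iff]
  intro β
  rw [isOpen_iff_mem_nhds]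
  rintro ⟨⟨w, v⟩, hp⟩ ⟨⟨x, m⟩, hxm, hΦ⟩
  have hx := (hWB hxm).1
  have hφ : (A.chart β).φ w = t.b x := by
    rw [← normalProj_Φ hx m, hΦ]
    rfl
  obtain ⟨V, ψ, P, hVo, hwV, hVU, hψs, hPs, hψ, hV⟩ := exists_lift hp.1 hx hφ
  obtain ⟨-, -, -, h4⟩ := hV w hwV hp.2.1
  rw [h4 v hp, hψ] at hΦ
  obtain ⟨-, γ, hγ, hγm⟩ := (Φ_eq_iff hx hx _ _).1 hΦ.symm
  have hc : ContinuousAt (fun p : {p : E × E // p.1 ∈ (A.chart β).U ∧ (A.chart β).φ p.1 ∈ D ∧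
      p.2 ∈ σ.normalSpace β p.1} => (ψ p.1.1, γ (P p.1.1 p.1.2))) ⟨(w, v), hp⟩ := by
    have c1 : ContinuousAt (fun p : {p : E × E // p.1 ∈ (A.chart β).U ∧ (A.chart β).φ p.1 ∈ D ∧
      p.2 ∈ σ.normalSpace β p.1} => p.1.1) ⟨(w, v), hp⟩ := by fun_prop
    have c2 : ContinuousAt ψ w := hψs.continuousOn.continuousAt (hVo.mem_nhds hwV)
    have c3 : ContinuousAt P w := hPs.continuousOn.continuousAt (hVo.mem_nhds hwV)
    refine ContinuousAt.prodMk (ContinuousAt.comp (g := ψ) c2 c1) (γ.continuous.continuousAt.comp ?_)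
    exact (ContinuousAt.comp (g := P) c3 c1).clm_apply (by fun_prop)
  have hV' : ∀ᶠ p in 𝓝 (⟨(w, v), hp⟩ : {p : E × E // p.1 ∈ (A.chart β).U ∧ (A.chart β).φ p.1 ∈ D ∧
      p.2 ∈ σ.normalSpace β p.1}), p.1.1 ∈ V := by
    have c1 : Continuous (fun p : {p : E × E // p.1 ∈ (A.chart β).U ∧
      (A.chart β).φ p.1 ∈ D ∧ p.2 ∈ σ.normalSpace β p.1} => p.1.1) := by fun_prop
    exact c1.continuousAt.eventually (hVo.eventually_mem hwV)
  filter_upwards [hc.eventually (hW.eventually_mem (by simpa [hψ, hγm] using hxm)), hV'] with p hpW hpV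
  obtain ⟨h5, -, -, h8⟩ := hV _ hpV p.2.2.1
  refine ⟨_, hpW, ?_⟩
  exact ((Φ_eq_iff h5 h5 _ _).2 ⟨rfl, γ, hγ, rfl⟩).symm.trans (h8 p.1.2 p.2).symm

end Frame

end OrbifoldAtlas

/-! ### Linear algebra of the polar decomposition of a symplectic form. -/

section LinearAlgebra

variable {V : Type*} [AddCommGroup V] [Module ℝ V]

/-- The inner product given by a positive definite form. -/
@[reducible] def LinearMap.innerProductCore (g : V →ₗ[ℝ] V →ₗ[ℝ] ℝ) (hs : ∀ u v, g u v = g v u)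
    (hp : ∀ v, v ≠ 0 → 0 < g v v) : InnerProductSpace.Core ℝ V where
  inner u v := g u v
  conj_inner_symm u v := by simpa using hs v u
  re_inner_nonneg v := by
    by_cases h : v = 0
    · simp [h]
    · simpa using (hp v h).le
  add_left u v w := by simp
  smul_left u v r := by simp
  definite v h := by
    by_contra hv
    exact (hp v hv).ne' h

variable [FiniteDimensional ℝ V]

/-- The Sylvester operator of two positive operators is injective. -/
theorem sylvester_eq_zero {g : V →ₗ[ℝ] V →ₗ[ℝ] ℝ} (hs : ∀ u v, g u v = g v u)
    (hp : ∀ v, v ≠ 0 → 0 < g v v) {S₁ S₂ X : V →ₗ[ℝ] V} (h₁ : ∀ v, v ≠ 0 → 0 < g (S₁ v) v)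
    (h₂ : ∀ u v, g (S₂ u) v = g u (S₂ v)) (h₂' : ∀ v, v ≠ 0 → 0 < g (S₂ v) v)
    (hX : ∀ v, S₁ (X v) = - X (S₂ v)) : X = 0 := by
  let core := LinearMap.innerProductCore g hs hp
  let : NormedAddCommGroup V := core.toNormedAddCommGroup
  let : InnerProductSpace ℝ V := InnerProductSpace.ofCore core.toCore
  have hS : S₂.IsSymmetric := h₂
  -- On an eigenvector `v` of `S₂` with eigenvalue μ > 0 the equation says that `S₁` sends `X v` to
  -- -μ times itself, which positivity of `S₁` excludes unless `X v` vanishes.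
  refine (hS.eigenvectorBasis rfl).toBasis.ext fun i => ?_
  have he := hS.apply_eigenvectorBasis rfl i
  rw [OrthonormalBasis.coe_toBasis, LinearMap.zero_apply]
  set v := hS.eigenvectorBasis rfl i with hv
  set μ : ℝ := hS.eigenvalues rfl i with hμ
  have hv0 : v ≠ 0 := (hS.eigenvectorBasis rfl).orthonormal.ne_zero i
  have he' : S₂ v = μ • v := he
  have hμ0 : 0 < μ := by
    have := h₂' v hv0
    rw [he', map_smul, LinearMap.smul_apply, smul_eq_mul] at this
    exact pos_of_mul_pos_left this (hp v hv0).le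
  by_contra hXv
  have h3 := h₁ _ hXv
  rw [hX, he', map_smul, map_neg, map_smul, LinearMap.neg_apply, LinearMap.smul_apply,
    smul_eq_mul] at h3
  have := mul_pos hμ0 (hp _ hXv)
  linarith

/-- Existence of the positive square root, commuting with the commutant. -/
theorem exists_positive_sqrt {g : V →ₗ[ℝ] V →ₗ[ℝ] ℝ} (hs : ∀ u v, g u v = g v u)
    (hp : ∀ v, v ≠ 0 → 0 < g v v) {N : V →ₗ[ℝ] V} (hN : ∀ u v, g (N u) v = g u (N v))
    (hN' : ∀ v, v ≠ 0 → 0 < g (N v) v) :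
    ∃ S : V →ₗ[ℝ] V, (∀ v, S (S v) = N v) ∧ (∀ u v, g (S u) v = g u (S v)) ∧
      (∀ v, v ≠ 0 → 0 < g (S v) v) ∧
      ∀ T : V →ₗ[ℝ] V, (∀ v, T (N v) = N (T v)) → ∀ v, T (S v) = S (T v) := by
  let core := LinearMap.innerProductCore g hs hp
  let : NormedAddCommGroup V := core.toNormedAddCommGroup
  let : InnerProductSpace ℝ V := InnerProductSpace.ofCore core.toCore
  have hS : N.IsSymmetric := hN
  set b := hS.eigenvectorBasis rfl with hb
  set μ : Fin (Module.finrank ℝ V) → ℝ := hS.eigenvalues rfl with hμ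
  have he : ∀ i, N (b i) = μ i • b i := fun i => hS.apply_eigenvectorBasis rfl i
  have hμ0 : ∀ i, 0 < μ i := by
    intro i
    have := hN' (b i) (b.orthonormal.ne_zero i)
    rw [he, map_smul, LinearMap.smul_apply, smul_eq_mul] at this
    exact pos_of_mul_pos_left this (hp _ (b.orthonormal.ne_zero i)).le
  have hexp : ∀ v, ∑ i, g (b i) v • b i = v := fun v => b.sum_repr' v
  have hcoef : ∀ w (c : ℝ), N w = c • w → ∀ i, √(μ i) * g (b i) w = √c * g (b i) w := by
    intro w c hw i
    have h1 : g (N (b i)) w = g (b i) (N w) := hN _ _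
    rw [he, hw, map_smul, map_smul, LinearMap.smul_apply, smul_eq_mul, smul_eq_mul] at h1
    by_cases h0 : g (b i) w = 0
    · rw [h0, mul_zero, mul_zero]
    · rw [mul_right_cancel₀ h0 h1]
  set S : V →ₗ[ℝ] V := ∑ i, (√(μ i) • g (b i)).smulRight (b i) with hSdef
  have hSv : ∀ v, S v = ∑ i, (√(μ i) * g (b i) v) • b i := by
    intro v
    simp [hSdef, LinearMap.sum_apply]
  -- The formula is needed for all eigenvectors of `N`, not only those of the basis: a map commuting
  -- with `N` preserves its eigenspaces, and therefore commutes with `S`.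
  have hSe : ∀ w (c : ℝ), N w = c • w → S w = √c • w := by
    intro w c hw
    rw [hSv]
    conv_rhs => rw [← hexp w, Finset.smul_sum]
    refine Finset.sum_congr rfl fun i _ => ?_
    rw [hcoef w c hw i, mul_smul]
  refine ⟨S, ?_, ?_, ?_, ?_⟩
  · intro v
    have : S ∘ₗ S = N := by
      refine b.toBasis.ext fun i => ?_
      rw [OrthonormalBasis.coe_toBasis, LinearMap.comp_apply, hSe _ _ (he i), map_smul,
        hSe _ _ (he i), smul_smul, Real.mul_self_sqrt (hμ0 i).le, he]
    exact congrArg (fun T : V →ₗ[ℝ] V => T v) this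
  · intro u v
    rw [hSv, hSv, map_sum, map_sum, LinearMap.sum_apply]
    refine Finset.sum_congr rfl fun i _ => ?_
    simp only [map_smul, LinearMap.smul_apply, smul_eq_mul]
    rw [hs u (b i)]
    ring
  · intro v hv
    have h1 : g (S v) v = ∑ i, √(μ i) * (g (b i) v * g (b i) v) := by
      rw [hSv, map_sum, LinearMap.sum_apply]
      refine Finset.sum_congr rfl fun i _ => ?_
      simp only [map_smul, LinearMap.smul_apply, smul_eq_mul]
      ring
    rw [h1]
    refine Finset.sum_pos' (fun i _ => mul_nonneg (Real.sqrt_nonneg _) (mul_self_nonneg _)) ?_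
    by_contra! hcon
    refine hv ?_
    rw [← hexp v]
    refine Finset.sum_eq_zero fun i hi => ?_
    have h2 := hcon i hi
    have h3 : g (b i) v * g (b i) v ≤ 0 :=
      nonpos_of_mul_nonpos_right h2 (Real.sqrt_pos.2 (hμ0 i))
    rw [mul_self_eq_zero.1 (le_antisymm h3 (mul_self_nonneg _)), zero_smul]
  · intro T hT v
    have : T ∘ₗ S = S ∘ₗ T := by
      refine b.toBasis.ext fun i => ?_
      rw [OrthonormalBasis.coe_toBasis, LinearMap.comp_apply, LinearMap.comp_apply,
        hSe _ _ (he i), map_smul]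
      refine (hSe _ _ ?_).symm
      rw [← hT, he, map_smul]
    exact congrArg (fun T : V →ₗ[ℝ] V => T v) this

theorem exists_of_posDef {g : V →ₗ[ℝ] V →ₗ[ℝ] ℝ} (hp : ∀ v, v ≠ 0 → 0 < g v v)
    (ω' : V →ₗ[ℝ] V →ₗ[ℝ] ℝ) : ∃ A : V →ₗ[ℝ] V, ∀ u v, g (A u) v = ω' u v := by
  have hinj : Function.Injective g := by
    rw [injective_iff_map_eq_zero]
    intro v hv
    by_contra h
    have := hp v h
    rw [hv] at this
    exact lt_irrefl _ this
  have hfr : Module.finrank ℝ V = Module.finrank ℝ (V →ₗ[ℝ] ℝ) :=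
    (Subspace.dual_finrank_eq (K := ℝ) (V := V)).symm
  let G := LinearEquiv.ofInjectiveOfFinrankEq g hinj hfr
  refine ⟨G.symm.toLinearMap ∘ₗ ω', fun u v => ?_⟩
  have : g (G.symm (ω' u)) = ω' u := G.apply_symm_apply _
  exact congrArg (fun l : V →ₗ[ℝ] ℝ => l v) this

/-- `J` is the complex structure in the polar decomposition of the form `ω'` with respect to the
inner product `g`. -/
structure IsPolar (g ω' : V →ₗ[ℝ] V →ₗ[ℝ] ℝ) (J : V →ₗ[ℝ] V) : Prop where
  sq : ∀ v, J (J v) = -v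
  inner_map : ∀ u v, g (J u) (J v) = g u v
  form_map : ∀ u v, ω' (J u) (J v) = ω' u v
  pos : ∀ v, v ≠ 0 → 0 < ω' v (J v)

variable {g ω' : V →ₗ[ℝ] V →ₗ[ℝ] ℝ} {J J' A : V →ₗ[ℝ] V}

theorem IsPolar.form_symm (hJ : IsPolar g ω' J) (ha : ∀ u v, ω' u v = - ω' v u) (u v : V) :
    ω' u (J v) = ω' v (J u) := by
  rw [← hJ.form_map u (J v), hJ.sq, map_neg, ha v (J u)]

/-- `J` preserves both forms, hence commutes with the operator that expresses one through the other.
-/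
theorem IsPolar.commute (hJ : IsPolar g ω' J) (hp : ∀ v, v ≠ 0 → 0 < g v v)
    (hA : ∀ u v, g (A u) v = ω' u v) (u : V) : A (J u) = J (A u) := by
  have h : ∀ v, g (A (J u) - J (A u)) v = 0 := by
    intro v
    rw [map_sub, LinearMap.sub_apply, hA, ← hJ.form_map (J u) v, hJ.sq, map_neg,
      LinearMap.neg_apply, ← hA, ← hJ.inner_map (J (A u)) v, hJ.sq, map_neg, LinearMap.neg_apply]
    ring
  by_contra hne
  have := hp _ (sub_ne_zero.2 hne)
  rw [h] at this
  exact lt_irrefl _ this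

/-- Both -JA and -J'A are positive square roots of -A². For roots S₁, S₂ of the same operator the
difference X = S₁ - S₂ satisfies S₁X + XS₂ = S₁² - S₂² = 0, so X = 0 by `sylvester_eq_zero`. As A is
invertible, J = J'. -/
theorem IsPolar.unique (hs : ∀ u v, g u v = g v u) (hp : ∀ v, v ≠ 0 → 0 < g v v)
    (ha : ∀ u v, ω' u v = - ω' v u) (hn : ∀ u, (∀ v, ω' u v = 0) → u = 0)
    (hJ : IsPolar g ω' J) (hJ' : IsPolar g ω' J') : J = J' := by
  obtain ⟨A, hA⟩ := exists_of_posDef hp ω'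
  have key : ∀ {J : V →ₗ[ℝ] V}, IsPolar g ω' J → ∀ u v, g (-J (A u)) v = ω' u (J v) := by
    intro J hJ u v
    rw [← hA, map_neg, LinearMap.neg_apply, ← hJ.inner_map (J (A u)) v, hJ.sq, map_neg,
      LinearMap.neg_apply, neg_neg]
  have hsq : ∀ {J : V →ₗ[ℝ] V}, IsPolar g ω' J → ∀ u, J (A (J (A u))) = - A (A u) := by
    intro J hJ u
    rw [hJ.commute hp hA, hJ.sq]
  have hz : -(J ∘ₗ A) - -(J' ∘ₗ A) = 0 := by
    refine sylvester_eq_zero hs hp (S₁ := -(J ∘ₗ A)) (S₂ := -(J' ∘ₗ A)) ?_ ?_ ?_ ?_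
    · intro v hv
      have := hJ.pos v hv
      rw [← key hJ] at this
      exact this
    · intro u v
      exact (key hJ' u v).trans ((hJ'.form_symm ha u v).trans ((key hJ' v u).symm.trans (hs _ _)))
    · intro v hv
      have := hJ'.pos v hv
      rw [← key hJ'] at this
      exact this
    · intro v
      simp only [LinearMap.neg_apply, LinearMap.sub_apply, LinearMap.comp_apply, map_neg, map_sub,
        hsq hJ, hsq hJ']
      abel
  have hAi : Function.Injective A := by
    rw [injective_iff_map_eq_zero]
    intro u hu
    refine hn u fun v => ?_
    rw [← hA, hu, map_zero, LinearMap.zero_apply]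
  have hAs : Function.Surjective A := LinearMap.injective_iff_surjective.1 hAi
  ext v
  obtain ⟨u, rfl⟩ := hAs v
  have := congrArg (fun T : V →ₗ[ℝ] V => T u) hz
  simp only [LinearMap.sub_apply, LinearMap.comp_apply, LinearMap.zero_apply,
    sub_neg_eq_add, neg_add_eq_sub, sub_eq_zero] at this
  exact this.symm

/-- The complex structure obtained from a square root of `-A²`. -/
theorem isPolar_of_sqrt {S S' : V →ₗ[ℝ] V} (hs : ∀ u v, g u v = g v u)
    (ha : ∀ u v, ω' u v = - ω' v u) (hA : ∀ u v, g (A u) v = ω' u v)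
    (hSS : ∀ v, S (S v) = - A (A v)) (hSg : ∀ u v, g (S u) v = g u (S v))
    (hSp : ∀ v, v ≠ 0 → 0 < g (S v) v) (hSA : ∀ v, A (S v) = S (A v))
    (hS' : ∀ v, S (S' v) = v) (hS'' : ∀ v, S' (S v) = v) : IsPolar g ω' (A ∘ₗ S') := by
  have hAg : ∀ u v, g (A u) v = - g u (A v) := by
    intro u v
    rw [hA, ha, ← hA, hs]
  have hS'A : ∀ v, A (S' v) = S' (A v) := by
    intro v
    rw [← hS'' (A (S' v)), ← hSA, hS']
  have hA2 : ∀ v, A (A v) = - S (S v) := fun v => by rw [hSS, neg_neg]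
  refine ⟨fun v => ?_, fun u v => ?_, fun u v => ?_, fun v hv => ?_⟩
  · simp only [LinearMap.comp_apply]
    rw [← hS'A, hA2, hS', hS']
  · simp only [LinearMap.comp_apply]
    rw [hAg, hA2, hS', map_neg, neg_neg, ← hSg, hS']
  · simp only [LinearMap.comp_apply]
    rw [← hA, ← hA, hAg, hA2, hS', map_neg, neg_neg, hS'A, ← hSg, hS']
  · simp only [LinearMap.comp_apply]
    rw [← hA, hAg, hA2, hS', map_neg, neg_neg, hs]
    exact hSp v hv

/-- The operator A is skew for g and injective, so -A² is positive and has a positive root S, which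
commutes with A. With S' the inverse of S these are the inputs of `isPolar_of_sqrt`. -/
theorem exists_polar (hs : ∀ u v, g u v = g v u) (hp : ∀ v, v ≠ 0 → 0 < g v v)
    (ha : ∀ u v, ω' u v = - ω' v u) (hn : ∀ u, (∀ v, ω' u v = 0) → u = 0) :
    ∃ A S S' : V →ₗ[ℝ] V, (∀ u v, g (A u) v = ω' u v) ∧ (∀ v, S (S v) = - A (A v)) ∧
      (∀ u v, g (S u) v = g u (S v)) ∧ (∀ v, v ≠ 0 → 0 < g (S v) v) ∧
      (∀ v, A (S v) = S (A v)) ∧ (∀ v, S (S' v) = v) ∧ (∀ v, S' (S v) = v) := by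
  obtain ⟨A, hA⟩ := exists_of_posDef hp ω'
  have hAg : ∀ u v, g (A u) v = - g u (A v) := by
    intro u v
    rw [hA, ha, ← hA, hs]
  have hA0 : ∀ v, v ≠ 0 → A v ≠ 0 := by
    intro v hv h
    refine hv (hn v fun w => ?_)
    rw [← hA, h, map_zero, LinearMap.zero_apply]
  obtain ⟨S, h1, h2, h3, h4⟩ := exists_positive_sqrt hs hp (N := -(A ∘ₗ A)) (by
    intro u v
    simp only [LinearMap.neg_apply, LinearMap.comp_apply, map_neg]
    rw [hAg, hAg, neg_neg]) (by
    intro v hv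
    simp only [LinearMap.neg_apply, LinearMap.comp_apply, map_neg]
    rw [hAg, neg_neg]
    exact hp _ (hA0 v hv))
  have hSi : Function.Injective S := by
    rw [injective_iff_map_eq_zero]
    intro v hv
    by_contra h
    have := h3 v h
    rw [hv, map_zero, LinearMap.zero_apply] at this
    exact lt_irrefl _ this
  let e := LinearEquiv.ofInjectiveEndo S hSi
  exact ⟨A, S, e.symm.toLinearMap, hA, h1, h2, h3, h4 A (by simp), e.apply_symm_apply,
    e.symm_apply_apply⟩

end LinearAlgebra

/-! ### Smooth dependence of the polar complex structure. -/

section SmoothPolar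

open ContinuousLinearMap

variable {F : Type*} [NormedAddCommGroup F] [NormedSpace ℝ F]
  {V : Type*} [NormedAddCommGroup V] [NormedSpace ℝ V] [FiniteDimensional ℝ V]

theorem isInvertible_of_injective {V' : Type*} [NormedAddCommGroup V'] [NormedSpace ℝ V']
    [FiniteDimensional ℝ V'] (h : Module.finrank ℝ V = Module.finrank ℝ V') {T : V →L[ℝ] V'}
    (hT : Function.Injective T) : T.IsInvertible :=
  ⟨(LinearEquiv.ofInjectiveOfFinrankEq (T : V →ₗ[ℝ] V') hT h).toContinuousLinearEquiv, by
    ext; rfl⟩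

theorem ContDiffOn.clm_inverse {V' : Type*} [NormedAddCommGroup V'] [NormedSpace ℝ V']
    {T : F → V →L[ℝ] V'} {W : Set F} (hT : ContDiffOn ℝ ∞ T W)
    (hi : ∀ x ∈ W, (T x).IsInvertible) : ContDiffOn ℝ ∞ (fun x => (T x).inverse) W := by
  have : CompleteSpace V := FiniteDimensional.complete ℝ V
  intro x hx
  obtain ⟨e, he⟩ := hi x hx
  have h := contDiffAt_map_inverse (𝕜 := ℝ) (n := ∞) e
  rw [he] at h
  exact h.comp_contDiffWithinAt x (hT x hx)

theorem isInvertible_of_posDef {G : V →L[ℝ] V →L[ℝ] ℝ} (hp : ∀ v, v ≠ 0 → 0 < G v v) :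
    G.IsInvertible := by
  refine isInvertible_of_injective ?_ ?_
  · rw [← (LinearMap.toContinuousLinearMap (𝕜 := ℝ) (E := V) (F' := ℝ)).finrank_eq]
    exact (Subspace.dual_finrank_eq (K := ℝ) (V := V)).symm
  · rw [injective_iff_map_eq_zero]
    intro v hv
    by_contra h
    have := hp v h
    rw [hv] at this
    exact lt_irrefl _ this

/-- The operator representing a bilinear form with respect to an inner product. -/
noncomputable def representing (G ω' : V →L[ℝ] V →L[ℝ] ℝ) : V →L[ℝ] V := G.inverse.comp ω'

theorem representing_apply {G : V →L[ℝ] V →L[ℝ] ℝ} (hp : ∀ v, v ≠ 0 → 0 < G v v)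
    (ω' : V →L[ℝ] V →L[ℝ] ℝ) (u v : V) : G (representing G ω' u) v = ω' u v := by
  rw [representing, ContinuousLinearMap.comp_apply, (isInvertible_of_posDef hp).self_apply_inverse]

theorem representing_smooth {G ω' : F → V →L[ℝ] V →L[ℝ] ℝ} {W : Set F} (hG : ContDiffOn ℝ ∞ G W)
    (hω : ContDiffOn ℝ ∞ ω' W) (hp : ∀ x ∈ W, ∀ v, v ≠ 0 → 0 < G x v v) :
    ContDiffOn ℝ ∞ (fun x => representing (G x) (ω' x)) W :=
  (hG.clm_inverse fun x hx => isInvertible_of_posDef (hp x hx)).clm_comp hω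

theorem eq_of_posDef {G : V →L[ℝ] V →L[ℝ] ℝ} (hp : ∀ v, v ≠ 0 → 0 < G v v) {u v : V}
    (h : ∀ w, G u w = G v w) : u = v := by
  by_contra hne
  have := hp _ (sub_ne_zero.2 hne)
  simp only [map_sub, sub_apply, h, sub_self] at this
  exact lt_irrefl _ this

/-- Smooth square roots near an operator with injective Sylvester operator. -/
theorem exists_smooth_sqrt (S₀ : V →L[ℝ] V) (h : ∀ X : V →L[ℝ] V, S₀.comp X + X.comp S₀ = 0 → X = 0) :
    ∃ (O N : Set (V →L[ℝ] V)) (r : (V →L[ℝ] V) → (V →L[ℝ] V)), IsOpen O ∧ S₀ ∈ O ∧ IsOpen N ∧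
      ContDiffOn ℝ ∞ r N ∧ (∀ T ∈ N, r T ∈ O ∧ (r T).comp (r T) = T) ∧
      ∀ S ∈ O, S.comp S ∈ N ∧ r (S.comp S) = S := by
  have : CompleteSpace V := FiniteDimensional.complete ℝ V
  let C := ContinuousLinearMap.compL ℝ V V V
  have hsm : ContDiff ℝ ∞ (fun S : V →L[ℝ] V => S.comp S) := contDiff_id.clm_comp contDiff_id
  -- This is X ↦ S₀X + XS₀, the derivative of squaring at `S₀`; injectivity is the hypothesis, so
  -- the inverse function theorem applies.
  let f' : (V →L[ℝ] V) →L[ℝ] (V →L[ℝ] V) := C S₀ + C.flip S₀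
  have hd : HasFDerivAt (fun S : V →L[ℝ] V => S.comp S) f' S₀ := by
    have := (hasFDerivAt_id (𝕜 := ℝ) S₀).clm_comp (hasFDerivAt_id (𝕜 := ℝ) S₀)
    exact this
  have hinj : Function.Injective f' := by
    rw [injective_iff_map_eq_zero]
    exact fun X hX => h X hX
  obtain ⟨e', he'⟩ := isInvertible_of_injective rfl hinj
  obtain ⟨e, h1, -, h3, h4, -⟩ := exists_smooth_openPartialHomeomorph isOpen_univ
    hsm.contDiffOn (mem_univ S₀) e' (by rwa [he'])
  refine ⟨e.source, e.target, e.symm, e.open_source, h1, e.open_target, h4, fun T hT =>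
    ⟨e.map_target hT, ?_⟩, fun S hS => ⟨?_, ?_⟩⟩
  · rw [← h3, e.right_inv hT]
  · rw [← h3]
    exact e.map_source hS
  · rw [← h3, e.left_inv hS]

/-- Positive definiteness is an open condition. -/
theorem eventually_posDef {Q : F → V →L[ℝ] V →L[ℝ] ℝ} {x₀ : F} (hQ : ContinuousAt Q x₀)
    (hp : ∀ v, v ≠ 0 → 0 < Q x₀ v v) : ∀ᶠ x in 𝓝 x₀, ∀ v, v ≠ 0 → 0 < Q x v v := by
  have hK : IsCompact (Metric.sphere (0 : V) 1) := by
    have := FiniteDimensional.proper_real V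
    exact isCompact_sphere 0 1
  have h1 : ∀ᶠ x in 𝓝 x₀, ∀ v ∈ Metric.sphere (0 : V) 1, 0 < Q x v v := by
    refine hK.eventually_forall_of_forall_eventually fun v hv => ?_
    have hv0 : v ≠ 0 := by
      rintro rfl
      simp at hv
    have hc : ContinuousAt (fun z : F × V => Q z.1 z.2 z.2) (x₀, v) := by
      have c1 : ContinuousAt (fun z : F × V => Q z.1) (x₀, v) :=
        ContinuousAt.comp (f := fun z : F × V => z.1) hQ continuousAt_fst
      exact (c1.clm_apply continuousAt_snd).clm_apply continuousAt_snd
    exact hc.eventually (lt_mem_nhds (hp v hv0))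
  filter_upwards [h1] with x hx v hv
  have hn : 0 < ‖v‖ := norm_pos_iff.2 hv
  have h2 := hx (‖v‖⁻¹ • v) (by
    rw [mem_sphere_zero_iff_norm, norm_smul, norm_inv, norm_norm, inv_mul_cancel₀ hn.ne'])
  rw [map_smul, map_smul, smul_apply, smul_eq_mul, smul_eq_mul] at h2
  have hi : 0 < ‖v‖⁻¹ := inv_pos.2 hn
  exact pos_of_mul_pos_right (pos_of_mul_pos_right h2 hi.le) hi.le

/-- The polar complex structure depends smoothly on the inner product and the form. -/
theorem exists_smooth_polar {G ω' : F → V →L[ℝ] V →L[ℝ] ℝ} {W : Set F} (hW : IsOpen W) {x₀ : F}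
    (hx₀ : x₀ ∈ W) (hG : ContDiffOn ℝ ∞ G W) (hω : ContDiffOn ℝ ∞ ω' W)
    (hs : ∀ x ∈ W, ∀ u v, G x u v = G x v u) (hp : ∀ x ∈ W, ∀ v, v ≠ 0 → 0 < G x v v)
    (ha : ∀ x ∈ W, ∀ u v, ω' x u v = - ω' x v u)
    (hn : ∀ x ∈ W, ∀ u, (∀ v, ω' x u v = 0) → u = 0) :
    ∃ (W' : Set F) (J : F → V →L[ℝ] V), IsOpen W' ∧ x₀ ∈ W' ∧ W' ⊆ W ∧ ContDiffOn ℝ ∞ J W' ∧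
      ∀ x ∈ W', IsPolar (G x).toLinearMap₁₂ (ω' x).toLinearMap₁₂ (J x : V →ₗ[ℝ] V) := by
  set A : F → V →L[ℝ] V := fun x => representing (G x) (ω' x) with hAdef
  have hAs : ContDiffOn ℝ ∞ A W := representing_smooth hG hω hp
  have hA : ∀ x ∈ W, ∀ u v, G x (A x u) v = ω' x u v := fun x hx =>
    representing_apply (hp x hx) (ω' x)
  have hAg : ∀ x ∈ W, ∀ u v, G x (A x u) v = - G x u (A x v) := by
    intro x hx u v
    rw [hA x hx, ha x hx, ← hA x hx, hs x hx]
  have hAinj : ∀ x ∈ W, Function.Injective (A x) := by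
    intro x hx
    rw [injective_iff_map_eq_zero]
    intro u hu
    refine hn x hx u fun v => ?_
    rw [← hA x hx, hu, map_zero, zero_apply]
  have hAi : ∀ x ∈ W, (A x).IsInvertible := fun x hx => isInvertible_of_injective rfl (hAinj x hx)
  obtain ⟨A₀, S₀, -, e1, e2, e3, e4, e5, -, -⟩ := exists_polar (g := (G x₀).toLinearMap₁₂)
    (ω' := (ω' x₀).toLinearMap₁₂) (hs x₀ hx₀) (hp x₀ hx₀) (ha x₀ hx₀) (hn x₀ hx₀)
  have hA₀ : ∀ v, A₀ v = A x₀ v := fun v => eq_of_posDef (hp x₀ hx₀) fun w => by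
    rw [hA x₀ hx₀]
    exact e1 v w
  set T₀ : V →L[ℝ] V := S₀.toContinuousLinearMap with hT₀
  obtain ⟨O, N, r, hO, hSO, hN, hr, hr1, hr2⟩ := exists_smooth_sqrt T₀ (by
    intro X hX
    have h1 : (X : V →ₗ[ℝ] V) = 0 := by
      refine sylvester_eq_zero (g := (G x₀).toLinearMap₁₂) (S₁ := S₀) (S₂ := S₀)
        (hs x₀ hx₀) (hp x₀ hx₀) e4 e3 e4 fun v => ?_
      have h2 := congrArg (fun T : V →L[ℝ] V => T v) hX
      exact eq_neg_of_add_eq_zero_left h2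
    ext v
    exact congrArg (fun T : V →ₗ[ℝ] V => T v) h1)
  set M : F → V →L[ℝ] V := fun x => -((A x).comp (A x)) with hM
  have hMs : ContDiffOn ℝ ∞ M W := (hAs.clm_comp hAs).neg
  have hM₀ : M x₀ = T₀.comp T₀ := by
    ext v
    rw [hM]
    simp only [neg_apply, ContinuousLinearMap.comp_apply]
    rw [← hA₀, ← hA₀]
    exact (e2 v).symm
  set W₁ := W ∩ M ⁻¹' N with hW₁
  have hW₁o : IsOpen W₁ := hMs.continuousOn.isOpen_inter_preimage hW hN
  have hx₁ : x₀ ∈ W₁ := ⟨hx₀, by rw [mem_preimage, hM₀]; exact (hr2 T₀ hSO).1⟩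
  set S : F → V →L[ℝ] V := fun x => r (M x) with hS
  have hSs : ContDiffOn ℝ ∞ S W₁ := hr.comp (hMs.mono inter_subset_left) fun x hx => hx.2
  have hS₀ : S x₀ = T₀ := by
    rw [hS]
    simp only
    rw [hM₀, (hr2 T₀ hSO).2]
  have hSS : ∀ x ∈ W₁, (S x).comp (S x) = M x := fun x hx => (hr1 _ hx.2).2
  have hSS' : ∀ x ∈ W₁, ∀ v, S x (S x v) = M x v := fun x hx v =>
    congrArg (fun T : V →L[ℝ] V => T v) (hSS x hx)
  have hcont : ∀ {H : Type _} [NormedAddCommGroup H] [NormedSpace ℝ H] {f : F → H},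
      ContDiffOn ℝ ∞ f W₁ → ContinuousAt f x₀ := fun hf =>
    hf.continuousOn.continuousAt (hW₁o.mem_nhds hx₁)
  have hW₁W : W₁ ⊆ W := inter_subset_left
  -- A continuous family of square roots of `M` through `T₀` stays in `O`, where roots are unique,
  -- and so agrees with `S` near `x₀`. Applied to the conjugate of `S` by `A` and to the adjoint of
  -- `S`, this gives commutation and symmetry, which the inverse function theorem alone does not
  -- provide.
  have huniq : ∀ C : F → V →L[ℝ] V, ContinuousAt C x₀ → C x₀ = T₀ →
      (∀ x ∈ W₁, (C x).comp (C x) = M x) → ∀ᶠ x in 𝓝 x₀, C x = S x := by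
    intro C hC hC₀ hCC
    filter_upwards [hC.eventually (hO.eventually_mem (by rwa [hC₀])), hW₁o.mem_nhds hx₁]
      with x hx hx'
    rw [hS]
    simp only
    rw [← hCC x hx', (hr2 _ hx).2]
  -- commutation with `A`
  have hAinv : ContDiffOn ℝ ∞ (fun x => (A x).inverse) W₁ :=
    (hAs.mono hW₁W).clm_inverse fun x hx => hAi x hx.1
  have hcomm := huniq (fun x => (A x).comp ((S x).comp (A x).inverse))
    (hcont ((hAs.mono hW₁W).clm_comp (hSs.clm_comp hAinv)))
    (by
      ext v
      simp only [ContinuousLinearMap.comp_apply]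
      rw [hS₀, ← hA₀]
      refine (e5 _).trans ?_
      rw [hA₀, (hAi x₀ hx₀).self_apply_inverse]
      rfl)
    (by
      intro x hx
      ext v
      simp only [ContinuousLinearMap.comp_apply]
      rw [(hAi x hx.1).inverse_apply_self, hSS' x hx, hM]
      simp only [neg_apply, ContinuousLinearMap.comp_apply, map_neg]
      rw [(hAi x hx.1).self_apply_inverse])
  -- symmetry
  have hGinv : ContDiffOn ℝ ∞ (fun x => (G x).inverse) W₁ :=
    (hG.mono hW₁W).clm_inverse fun x hx => isInvertible_of_posDef (hp x hx.1)
  set Sd : F → V →L[ℝ] V := fun x => representing (G x) ((G x).flip.comp (S x)).flip with hSd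
  have hSdapp : ∀ x ∈ W₁, ∀ u v, G x (Sd x u) v = G x u (S x v) := fun x hx u v =>
    representing_apply (hp x hx.1) _ u v
  have hSds : ContDiffOn ℝ ∞ Sd W₁ :=
    representing_smooth (hG.mono hW₁W) ((hG.mono hW₁W).clm_flip.clm_comp hSs).clm_flip
      fun x hx => hp x hx.1
  have hsym := huniq Sd (hcont hSds)
    (by
      ext v
      refine eq_of_posDef (hp x₀ hx₀) fun w => ?_
      rw [hSdapp x₀ hx₁, hS₀]
      exact (e3 v w).symm)
    (by
      intro x hx
      ext u
      refine eq_of_posDef (hp x hx.1) fun v => ?_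
      rw [ContinuousLinearMap.comp_apply, hSdapp x hx, hSdapp x hx, hSS' x hx, hM]
      simp only [neg_apply, ContinuousLinearMap.comp_apply, map_neg]
      rw [hAg x hx.1, hAg x hx.1, neg_neg])
  -- positivity
  have hpos := eventually_posDef (Q := fun x => (G x).comp (S x))
    (hcont ((hG.mono hW₁W).clm_comp hSs)) (by
      intro v hv
      rw [hS₀]
      exact e4 v hv)
  obtain ⟨W', hW'sub, hW', hxW'⟩ := mem_nhds_iff.1
    (inter_mem (inter_mem (inter_mem hcomm hsym) hpos) (hW₁o.mem_nhds hx₁))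
  have hSinj : ∀ x ∈ W', (S x).IsInvertible := by
    intro x hx
    refine isInvertible_of_injective rfl ?_
    rw [injective_iff_map_eq_zero]
    intro v hv
    by_contra h
    have h1 : 0 < G x (S x v) v := (hW'sub hx).1.2 v h
    rw [hv, map_zero, zero_apply] at h1
    exact lt_irrefl _ h1
  have hW'1 : W' ⊆ W₁ := fun x hx => (hW'sub hx).2
  refine ⟨W', fun x => (A x).comp (S x).inverse, hW', hxW', hW'1.trans hW₁W,
    (hAs.mono (hW'1.trans hW₁W)).clm_comp ((hSs.mono hW'1).clm_inverse hSinj), fun x hx => ?_⟩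
  obtain ⟨⟨⟨hc, hsy⟩, hpo⟩, hx1⟩ := hW'sub hx
  have hc' : ∀ v, A x (S x v) = S x (A x v) := by
    intro v
    have h1 := congrArg (fun T : V →L[ℝ] V => T (A x v)) hc
    simp only [ContinuousLinearMap.comp_apply] at h1
    rwa [(hAi x hx1.1).inverse_apply_self] at h1
  have hsy' : ∀ u v, G x (S x u) v = G x u (S x v) := by
    intro u v
    have hsy2 : Sd x = S x := hsy
    rw [← hSdapp x hx1, hsy2]
  refine isPolar_of_sqrt (A := (A x : V →ₗ[ℝ] V)) (S := (S x : V →ₗ[ℝ] V))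
    (S' := ((S x).inverse : V →ₗ[ℝ] V)) (hs x hx1.1) (ha x hx1.1) (hA x hx1.1) ?_ hsy' hpo hc'
    (hSinj x hx).self_apply_inverse (hSinj x hx).inverse_apply_self
  intro v
  exact hSS' x hx1 v

end SmoothPolar

/-! ### Complex structures and complex frames. -/

section ComplexFrame

variable {V : Type*} [AddCommGroup V] [Module ℝ V]

/-- A complex structure on a real vector space as a module structure over `ℂ`. -/
@[reducible] def LinearMap.complexModule (J : V →ₗ[ℝ] V) (hJ : ∀ v, J (J v) = -v) :
    Module ℂ V where
  smul z v := z.re • v + z.im • J v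
  one_smul v := by
    change (1 : ℂ).re • v + (1 : ℂ).im • J v = v
    simp
  mul_smul z w v := by
    change (z * w).re • v + (z * w).im • J v =
      z.re • (w.re • v + w.im • J v) + z.im • J (w.re • v + w.im • J v)
    simp only [Complex.mul_re, Complex.mul_im, map_add, map_smul, hJ]
    module
  smul_zero z := by
    change z.re • (0 : V) + z.im • J 0 = 0
    simp
  smul_add z v w := by
    change z.re • (v + w) + z.im • J (v + w) = (z.re • v + z.im • J v) + (z.re • w + z.im • J w)
    rw [map_add]
    module
  add_smul z w v := by
    change (z + w).re • v + (z + w).im • J v = (z.re • v + z.im • J v) + (w.re • v + w.im • J v)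
    simp only [Complex.add_re, Complex.add_im]
    module
  zero_smul v := by
    change (0 : ℂ).re • v + (0 : ℂ).im • J v = 0
    simp

/-- A real vector space with an inner product and an orthogonal complex structure is isomorphic to
standard complex space. -/
theorem exists_complex_frame [FiniteDimensional ℝ V] {h : V →ₗ[ℝ] V →ₗ[ℝ] ℝ}
    (hs : ∀ u v, h u v = h v u) (hp : ∀ v, v ≠ 0 → 0 < h v v) {J : V →ₗ[ℝ] V}
    (hJ : ∀ v, J (J v) = -v) (hJh : ∀ u v, h (J u) (J v) = h u v) :
    ∃ (k : ℕ) (T : CSpace k ≃ₗ[ℝ] V), (∀ m, T (Complex.I • m) = J (T m)) ∧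
      ∀ m m', h (T m) (T m') = (inner ℂ m m').re := by
  let mod : Module ℂ V := J.complexModule hJ
  have hsmul : ∀ (z : ℂ) (v : V), z • v = z.re • v + z.im • J v := fun _ _ => rfl
  have hJ' : ∀ u v, h (J u) v = - h u (J v) := by
    intro u v
    rw [← hJh u (J v), hJ, map_neg, neg_neg]
  -- The imaginary part h(Ju, v) is the choice that makes the form conjugate linear in its first
  -- argument.
  let core : InnerProductSpace.Core ℂ V :=
    { inner := fun u v => ⟨h u v, h (J u) v⟩
      conj_inner_symm := fun u v => by
        apply Complex.ext
        · simpa using hs v u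
        · have : -h (J v) u = h (J u) v := by rw [hJ', neg_neg, hs]
          simpa using this
      re_inner_nonneg := fun v => by
        by_cases hv : v = 0
        · simp [hv]
        · simpa using (hp v hv).le
      add_left := fun u v w => by
        apply Complex.ext <;> simp
      smul_left := fun u v z => by
        rw [hsmul]
        apply Complex.ext
        · simp
        · simp [hJ]
      definite := fun v hv => by
        by_contra hne
        have h1 := congrArg Complex.re hv
        exact (hp v hne).ne' h1 }
  have : IsScalarTower ℝ ℂ V := ⟨fun r z v => by
    rw [hsmul, hsmul]
    simp only [Complex.real_smul, Complex.mul_re, Complex.ofReal_re, Complex.ofReal_im, zero_mul,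
      sub_zero, Complex.mul_im, add_zero]
    module⟩
  have : FiniteDimensional ℂ V := Module.Finite.of_restrictScalars_finite ℝ ℂ V
  let inst1 : NormedAddCommGroup V := core.toNormedAddCommGroup
  let inst2 : InnerProductSpace ℂ V := InnerProductSpace.ofCore core.toCore
  let b := (stdOrthonormalBasis ℂ V).repr.symm
  have hb : ∀ (z : ℂ) m, b (z • m) = z.re • b m + z.im • J (b m) := fun z m => b.map_smul z m
  refine ⟨Module.finrank ℂ V,
    { toFun := b
      map_add' := b.map_add
      map_smul' := fun r m => by
        have := hb (r : ℂ) m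
        simp only [Complex.ofReal_re, Complex.ofReal_im, zero_smul, add_zero] at this
        rw [RingHom.id_apply, ← this]
        congr 1
      invFun := b.symm
      left_inv := b.symm_apply_apply
      right_inv := b.apply_symm_apply }, fun m => ?_, fun m m' => ?_⟩
  · have := hb Complex.I m
    simp only [Complex.I_re, Complex.I_im, zero_smul, zero_add, one_smul] at this
    exact this
  · have h1 := b.inner_map_map m m'
    rw [← h1]
    rfl

/-- A symplectic vector space has even dimension. -/
theorem exists_finrank_eq_two_mul [FiniteDimensional ℝ V] {g ω' : V →ₗ[ℝ] V →ₗ[ℝ] ℝ}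
    (hs : ∀ u v, g u v = g v u) (hp : ∀ v, v ≠ 0 → 0 < g v v)
    (ha : ∀ u v, ω' u v = - ω' v u) (hn : ∀ u, (∀ v, ω' u v = 0) → u = 0) :
    ∃ k, Module.finrank ℝ V = 2 * k := by
  obtain ⟨A, S, S', h1, h2, h3, h4, h5, h6, h7⟩ := exists_polar hs hp ha hn
  have hJ := isPolar_of_sqrt hs ha h1 h2 h3 h4 h5 h6 h7
  obtain ⟨k, T, -, -⟩ := exists_complex_frame hs hp hJ.sq hJ.inner_map
  refine ⟨k, ?_⟩
  rw [← T.finrank_eq, finrank_real_of_complex, finrank_euclideanSpace_fin]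

end ComplexFrame

/-! ### Unitary gauges for smooth families of metrics and symplectic forms. -/

section Gauge

open ContinuousLinearMap

variable {F : Type*} [NormedAddCommGroup F] [NormedSpace ℝ F] {k : ℕ}

/-- The real part of the standard Hermitian form. -/
noncomputable def reForm (k : ℕ) : CSpace k →L[ℝ] CSpace k →L[ℝ] ℝ := innerSL ℝ

theorem reForm_apply (m m' : CSpace k) : reForm k m m' = (inner ℂ m m').re := by
  rw [reForm, innerSL_apply_apply, PiLp.inner_apply, PiLp.inner_apply, Complex.re_sum]
  rfl

theorem reForm_symm (m m' : CSpace k) : reForm k m m' = reForm k m' m := by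
  rw [reForm_apply, reForm_apply, ← inner_conj_symm, Complex.conj_re]

theorem reForm_self (m : CSpace k) : reForm k m m = ‖m‖ ^ 2 := by
  rw [reForm_apply]
  exact inner_self_eq_norm_sq (𝕜 := ℂ) m

theorem reForm_pos (m : CSpace k) (hm : m ≠ 0) : 0 < reForm k m m := by
  rw [reForm_self]
  exact pow_pos (norm_pos_iff.2 hm) 2

theorem reForm_smul_I (m m' : CSpace k) : reForm k m (Complex.I • m') = -(inner ℂ m m').im := by
  rw [reForm_apply, inner_smul_right, Complex.I_mul_re]

/-- Multiplication by `i`. -/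
noncomputable def mulI (k : ℕ) : CSpace k →L[ℝ] CSpace k :=
  LinearMap.toContinuousLinearMap
    { toFun := fun m => Complex.I • m
      map_add' := fun _ _ => smul_add _ _ _
      map_smul' := fun _ _ => smul_comm _ _ _ }

theorem mulI_apply (m : CSpace k) : mulI k m = Complex.I • m := rfl

theorem mulI_mulI (m : CSpace k) : mulI k (mulI k m) = -m := by
  rw [mulI_apply, mulI_apply, smul_smul, Complex.I_mul_I, neg_one_smul]

end Gauge

section Gauge

open ContinuousLinearMap

variable {F : Type*} [NormedAddCommGroup F] [NormedSpace ℝ F] {k : ℕ}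

/-- A smooth family of inner products which is standard at a point has a smooth family of square
roots, commuting with all the isometries `C` of the family in a given finite set. -/
theorem exists_smooth_positive_sqrt {Q : F → CSpace k →L[ℝ] CSpace k →L[ℝ] ℝ} {W : Set F}
    (hW : IsOpen W) {x₀ : F} (hx₀ : x₀ ∈ W) (hQ : ContDiffOn ℝ ∞ Q W)
    (hs : ∀ x ∈ W, ∀ u v, Q x u v = Q x v u) (hp : ∀ x ∈ W, ∀ v, v ≠ 0 → 0 < Q x v v)
    (hQ₀ : Q x₀ = reForm k) {Γ : Set (CSpace k →L[ℝ] CSpace k)} (hΓ : Γ.Finite)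
    (hΓi : ∀ C ∈ Γ, C.IsInvertible) (hΓQ : ∀ C ∈ Γ, ∀ x ∈ W, ∀ u v, Q x (C u) (C v) = Q x u v) :
    ∃ (W' : Set F) (R : F → CSpace k →L[ℝ] CSpace k), IsOpen W' ∧ x₀ ∈ W' ∧ W' ⊆ W ∧
      ContDiffOn ℝ ∞ R W' ∧ ∀ x ∈ W', (R x).IsInvertible ∧
        (∀ u v, Q x u v = reForm k (R x u) (R x v)) ∧
        ∀ C ∈ Γ, ∀ v, R x (C v) = C (R x v) := by
  -- `H x` expresses `Q x` through the standard inner product and is the identity at `x₀`. If `R x`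
  -- is a self-adjoint root of it, then Q(u, v) = ⟨Hu, v⟩ = ⟨Ru, Rv⟩.
  set H : F → CSpace k →L[ℝ] CSpace k := fun x => representing (reForm k) (Q x) with hH
  have hHs : ContDiffOn ℝ ∞ H W := representing_smooth contDiffOn_const hQ fun _ _ => reForm_pos
  have hHQ : ∀ x u v, reForm k (H x u) v = Q x u v := fun x => representing_apply reForm_pos _
  have hsC : ∀ C ∈ Γ, ∀ u v, reForm k (C u) (C v) = reForm k u v := by
    intro C hC u v
    rw [← hQ₀, hΓQ C hC x₀ hx₀]
  have hHC : ∀ C ∈ Γ, ∀ x ∈ W, ∀ v, H x (C v) = C (H x v) := by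
    intro C hC x hx v
    refine eq_of_posDef reForm_pos fun w => ?_
    obtain ⟨w, rfl⟩ := (hΓi C hC).surjective w
    rw [hHQ, hsC C hC, hHQ, hΓQ C hC x hx]
  have hH₀ : H x₀ = ContinuousLinearMap.id ℝ _ := by
    ext1 v
    refine eq_of_posDef reForm_pos fun w => ?_
    rw [hHQ, hQ₀]
    rfl
  obtain ⟨O, N, r, hO, hSO, hN, hr, hr1, hr2⟩ := exists_smooth_sqrt
    (ContinuousLinearMap.id ℝ (CSpace k)) (by
      intro X hX
      rw [ContinuousLinearMap.id_comp, ContinuousLinearMap.comp_id, ← two_smul ℝ] at hX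
      exact (smul_eq_zero.1 hX).resolve_left two_ne_zero)
  have hid := hr2 _ hSO
  rw [ContinuousLinearMap.id_comp] at hid
  set W₁ := W ∩ H ⁻¹' N with hW₁
  have hW₁o : IsOpen W₁ := hHs.continuousOn.isOpen_inter_preimage hW hN
  have hx₁ : x₀ ∈ W₁ := ⟨hx₀, by rw [mem_preimage, hH₀]; exact hid.1⟩
  have hW₁W : W₁ ⊆ W := inter_subset_left
  set R : F → CSpace k →L[ℝ] CSpace k := fun x => r (H x) with hR
  have hRs : ContDiffOn ℝ ∞ R W₁ := hr.comp (hHs.mono inter_subset_left) fun x hx => hx.2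
  have hR₀ : R x₀ = ContinuousLinearMap.id ℝ _ := by
    rw [hR]
    simp only
    rw [hH₀, hid.2]
  have hRR : ∀ x ∈ W₁, ∀ v, R x (R x v) = H x v := fun x hx v =>
    congrArg (fun T : CSpace k →L[ℝ] CSpace k => T v) (hr1 _ hx.2).2
  have hcont : ∀ {H : Type _} [NormedAddCommGroup H] [NormedSpace ℝ H] {f : F → H},
      ContDiffOn ℝ ∞ f W₁ → ContinuousAt f x₀ := fun hf =>
    hf.continuousOn.continuousAt (hW₁o.mem_nhds hx₁)
  -- Roots near the identity are unique. Hence the conjugates of `R` by elements of `Γ` and the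
  -- adjoint of `R`, being roots as well, coincide with `R` near `x₀`; finiteness of `Γ` gives a
  -- common neighbourhood.
  have huniq : ∀ C : F → CSpace k →L[ℝ] CSpace k, ContinuousAt C x₀ →
      C x₀ = ContinuousLinearMap.id ℝ _ →
      (∀ x ∈ W₁, (C x).comp (C x) = H x) → ∀ᶠ x in 𝓝 x₀, C x = R x := by
    intro C hC hC₀ hCC
    filter_upwards [hC.eventually (hO.eventually_mem (by rwa [hC₀])), hW₁o.mem_nhds hx₁]
      with x hx hx'
    rw [hR]
    simp only
    rw [← hCC x hx', (hr2 _ hx).2]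
  have hcomm : ∀ᶠ x in 𝓝 x₀, ∀ C ∈ Γ, C.comp ((R x).comp C.inverse) = R x := by
    refine (eventually_all_finite hΓ).2 fun C hC => ?_
    have hCi := hΓi C hC
    refine huniq (fun x => C.comp ((R x).comp C.inverse))
      (hcont (contDiffOn_const.clm_comp (hRs.clm_comp contDiffOn_const))) ?_ fun x hx => ?_
    · simp only [hR₀]
      rw [ContinuousLinearMap.id_comp, hCi.self_comp_inverse]
    · ext1 v
      simp only [ContinuousLinearMap.comp_apply]
      rw [hCi.inverse_apply_self, hRR x hx, ← hHC C hC x hx.1, hCi.self_apply_inverse]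
  set Sd : F → CSpace k →L[ℝ] CSpace k := fun x =>
    representing (reForm k) ((reForm k).flip.comp (R x)).flip with hSd
  have hSdapp : ∀ x u v, reForm k (Sd x u) v = reForm k u (R x v) := fun x u v =>
    representing_apply reForm_pos _ u v
  have hSds : ContDiffOn ℝ ∞ Sd W₁ :=
    representing_smooth contDiffOn_const (contDiffOn_const.clm_comp hRs).clm_flip
      fun _ _ => reForm_pos
  have hsym := huniq Sd (hcont hSds)
    (by
      ext1 v
      refine eq_of_posDef reForm_pos fun w => ?_
      rw [hSdapp x₀, hR₀]
      rfl)
    (by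
      intro x hx
      ext1 u
      refine eq_of_posDef reForm_pos fun v => ?_
      rw [ContinuousLinearMap.comp_apply, hSdapp, hSdapp, hRR x hx, hHQ, reForm_symm, hHQ,
        hs x hx.1])
  obtain ⟨W', hW'sub, hW', hxW'⟩ := mem_nhds_iff.1
    (inter_mem (inter_mem hcomm hsym) (hW₁o.mem_nhds hx₁))
  have hW'1 : W' ⊆ W₁ := fun x hx => (hW'sub hx).2
  refine ⟨W', R, hW', hxW', hW'1.trans hW₁W, hRs.mono hW'1, fun x hx => ?_⟩
  obtain ⟨⟨hc, hsy⟩, hx1⟩ := hW'sub hx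
  have hsy2 : Sd x = R x := hsy
  have hQR : ∀ u v, Q x u v = reForm k (R x u) (R x v) := by
    intro u v
    rw [← hSdapp, hsy2, hRR x hx1, hHQ]
  refine ⟨isInvertible_of_injective rfl ?_, hQR, fun C hC v => ?_⟩
  · rw [injective_iff_map_eq_zero]
    intro v hv
    by_contra h
    have h1 := hp x hx1.1 v h
    rw [hQR, hv, map_zero] at h1
    exact lt_irrefl _ h1
  · have h1 := congrArg (fun T : CSpace k →L[ℝ] CSpace k => T (C v)) (hc C hC)
    simp only [ContinuousLinearMap.comp_apply] at h1
    rw [(hΓi C hC).inverse_apply_self] at h1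
    exact h1.symm

/-- Near a point, a smooth family of inner products `G` and symplectic forms `ω'` admits a smooth
change of frame after which `ω'` is standard and `G` is invariant under multiplication by `i`.
The change of frame makes a finite group of automorphisms of the family constant again. -/
theorem exists_unitary_gauge {G ω' : F → CSpace k →L[ℝ] CSpace k →L[ℝ] ℝ} {W : Set F}
    (hW : IsOpen W) {x₀ : F}
    (hx₀ : x₀ ∈ W) (hG : ContDiffOn ℝ ∞ G W) (hω : ContDiffOn ℝ ∞ ω' W)
    (hs : ∀ x ∈ W, ∀ u v, G x u v = G x v u) (hp : ∀ x ∈ W, ∀ v, v ≠ 0 → 0 < G x v v)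
    (ha : ∀ x ∈ W, ∀ u v, ω' x u v = - ω' x v u)
    (hn : ∀ x ∈ W, ∀ u, (∀ v, ω' x u v = 0) → u = 0)
    {Γ : Set (CSpace k →L[ℝ] CSpace k)} (hΓ : Γ.Finite)
    (hΓi : ∀ γ ∈ Γ, γ.IsInvertible) (hΓG : ∀ γ ∈ Γ, ∀ x ∈ W, ∀ u v, G x (γ u) (γ v) = G x u v)
    (hΓω : ∀ γ ∈ Γ, ∀ x ∈ W, ∀ u v, ω' x (γ u) (γ v) = ω' x u v) :
    ∃ (W' : Set F) (A : F → CSpace k →L[ℝ] CSpace k), IsOpen W' ∧ x₀ ∈ W' ∧ W' ⊆ W ∧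
      ContDiffOn ℝ ∞ A W' ∧ ∀ x ∈ W', (A x).IsInvertible ∧
        (∀ m m', ω' x (A x m) (A x m') = (inner ℂ m m').im) ∧
        (∀ m, G x (A x (Complex.I • m)) (A x (Complex.I • m)) = G x (A x m) (A x m)) ∧
        ∀ γ ∈ Γ, ∀ m, (A x).inverse (γ (A x m)) = (A x₀).inverse (γ (A x₀ m)) := by
  obtain ⟨W₁, J, hW₁, hx₁, hW₁W, hJs, hJ⟩ := exists_smooth_polar hW hx₀ hG hω hs hp ha hn
  have hJJ : ∀ x ∈ W₁, ∀ v, J x (J x v) = -v := fun x hx => (hJ x hx).sq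
  have hJω : ∀ x ∈ W₁, ∀ u v, ω' x (J x u) (J x v) = ω' x u v := fun x hx => (hJ x hx).form_map
  have hJG : ∀ x ∈ W₁, ∀ u v, G x (J x u) (J x v) = G x u v := fun x hx => (hJ x hx).inner_map
  -- `J` commutes with the group
  have hJΓ : ∀ γ ∈ Γ, ∀ x ∈ W₁, ∀ v, J x (γ v) = γ (J x v) := by
    intro γ hγ x hx v
    have hγi := hΓi γ hγ
    -- The conjugate γ⁻¹Jγ is polar for the same pair of forms, since γ preserves both; by
    -- uniqueness it equals J.
    have h1 : IsPolar (G x).toLinearMap₁₂ (ω' x).toLinearMap₁₂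
        ((γ.inverse.comp ((J x).comp γ) : CSpace k →L[ℝ] CSpace k) : CSpace k →ₗ[ℝ] CSpace k) := by
      refine ⟨fun v => ?_, fun u v => ?_, fun u v => ?_, fun v hv => ?_⟩
      · change γ.inverse (J x (γ (γ.inverse (J x (γ v))))) = -v
        rw [hγi.self_apply_inverse, hJJ x hx, map_neg, hγi.inverse_apply_self]
      · change G x (γ.inverse (J x (γ u))) (γ.inverse (J x (γ v))) = G x u v
        rw [← hΓG γ hγ x (hW₁W hx), hγi.self_apply_inverse, hγi.self_apply_inverse,
          hJG x hx, hΓG γ hγ x (hW₁W hx)]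
      · change ω' x (γ.inverse (J x (γ u))) (γ.inverse (J x (γ v))) = ω' x u v
        rw [← hΓω γ hγ x (hW₁W hx), hγi.self_apply_inverse, hγi.self_apply_inverse,
          hJω x hx, hΓω γ hγ x (hW₁W hx)]
      · change 0 < ω' x v (γ.inverse (J x (γ v)))
        rw [← hΓω γ hγ x (hW₁W hx), hγi.self_apply_inverse]
        exact (hJ x hx).pos _ fun h => hv (hγi.injective (h.trans (map_zero γ).symm))
    have h2 := IsPolar.unique (hs x (hW₁W hx)) (hp x (hW₁W hx)) (ha x (hW₁W hx))
      (hn x (hW₁W hx)) (hJ x hx) h1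
    have h3 : J x v = γ.inverse (J x (γ v)) :=
      congrArg (fun T : CSpace k →ₗ[ℝ] CSpace k => T v) h2
    rw [h3, hγi.self_apply_inverse]
  -- the Hermitian metric
  set h : F → CSpace k →L[ℝ] CSpace k →L[ℝ] ℝ := fun x => ((ω' x).flip.comp (J x)).flip with hh
  have happ : ∀ x u v, h x u v = ω' x u (J x v) := fun _ _ _ => rfl
  have hhs : ContDiffOn ℝ ∞ h W₁ := ((hω.mono hW₁W).clm_flip.clm_comp hJs).clm_flip
  have hsymm : ∀ x ∈ W₁, ∀ u v, h x u v = h x v u := fun x hx u v =>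
    (hJ x hx).form_symm (ha x (hW₁W hx)) u v
  have hJh : ∀ x ∈ W₁, ∀ u v, h x (J x u) (J x v) = h x u v := fun x hx u v => by
    rw [happ, happ, hJω x hx]
  have hhpos : ∀ x ∈ W₁, ∀ v, v ≠ 0 → 0 < h x v v := fun x hx => (hJ x hx).pos
  -- a complex frame at the point
  obtain ⟨k', T', hT'I, hT'h⟩ := exists_complex_frame (h := (h x₀).toLinearMap₁₂)
    (J := (J x₀ : CSpace k →ₗ[ℝ] CSpace k)) (hsymm x₀ hx₁) (hhpos x₀ hx₁) (hJJ x₀ hx₁) (hJh x₀ hx₁)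
  have hk : k' = k := by
    have h1 := T'.finrank_eq
    rw [finrank_real_of_complex, finrank_real_of_complex, finrank_euclideanSpace_fin,
      finrank_euclideanSpace_fin] at h1
    omega
  subst hk
  set T : CSpace k' →L[ℝ] CSpace k' := (T' : CSpace k' →ₗ[ℝ] CSpace k').toContinuousLinearMap
  have hTi : T.IsInvertible := ⟨T'.toContinuousLinearEquiv, rfl⟩
  have hTI : ∀ m, T (Complex.I • m) = J x₀ (T m) := hT'I
  have hTh : ∀ m m', h x₀ (T m) (T m') = reForm k' m m' := fun m m' =>
    (hT'h m m').trans (reForm_apply m m').symm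
  -- a complex linear frame near the point
  set B : F → CSpace k' →L[ℝ] CSpace k' := fun x =>
    (2⁻¹ : ℝ) • (T - (J x).comp (T.comp (mulI k'))) with hB
  have hBs : ContDiffOn ℝ ∞ B W₁ :=
    (contDiffOn_const.sub (hJs.clm_comp contDiffOn_const)).const_smul (2⁻¹ : ℝ)
  have hBapp : ∀ x m, B x m = (2⁻¹ : ℝ) • (T m - J x (T (Complex.I • m))) := fun _ _ => rfl
  have hII : ∀ m : CSpace k', Complex.I • Complex.I • m = -m := fun m => mulI_mulI m
  have hB₀ : B x₀ = T := by
    ext1 m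
    rw [hBapp, ← hTI, hII, map_neg, sub_neg_eq_add, ← two_smul ℝ, smul_smul]
    norm_num
  -- `B x` is the part of `T` that is complex linear from i to `J x`. It equals `T` at `x₀` and
  -- therefore stays invertible nearby.
  have hBI : ∀ x ∈ W₁, ∀ m, B x (Complex.I • m) = J x (B x m) := by
    intro x hx m
    rw [hBapp, hBapp, (J x).map_smul_of_tower, map_sub, hJJ x hx, hII, map_neg, map_neg]
    congr 1
    abel
  set W₂ := W₁ ∩ B ⁻¹' {S | S.IsInvertible} with hW₂
  have hinvo : IsOpen {S : CSpace k' →L[ℝ] CSpace k' | S.IsInvertible} :=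
    ContinuousLinearEquiv.isOpen
  have hW₂o : IsOpen W₂ := hBs.continuousOn.isOpen_inter_preimage hW₁ hinvo
  have hx₂ : x₀ ∈ W₂ := ⟨hx₁, by rw [mem_preimage, hB₀]; exact hTi⟩
  have hW₂₁ : W₂ ⊆ W₁ := inter_subset_left
  -- conjugated group
  set con : (CSpace k' →L[ℝ] CSpace k') → (CSpace k' →L[ℝ] CSpace k') := fun γ =>
    T.inverse.comp (γ.comp T) with hcon
  have hTcon : ∀ γ m, T (con γ m) = γ (T m) := fun γ m => hTi.self_apply_inverse _
  have hconi : ∀ γ ∈ Γ, (con γ).IsInvertible := fun γ hγ =>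
    hTi.inverse.comp ((hΓi γ hγ).comp hTi)
  have hconI : ∀ γ ∈ Γ, ∀ m, con γ (Complex.I • m) = Complex.I • con γ m := by
    intro γ hγ m
    apply hTi.injective
    rw [hTcon, hTI, hTI, hTcon, hJΓ γ hγ x₀ hx₁]
  have hBcon : ∀ γ ∈ Γ, ∀ x ∈ W₁, ∀ m, B x (con γ m) = γ (B x m) := by
    intro γ hγ x hx m
    rw [hBapp, hBapp, ← hconI γ hγ, hTcon, hTcon, hJΓ γ hγ x hx, γ.map_smul_of_tower, map_sub]
  have hQs : ContDiffOn ℝ ∞ (fun x => (((h x).comp (B x)).flip.comp (B x)).flip) W₂ :=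
    ((((hhs.mono hW₂₁).clm_comp (hBs.mono hW₂₁)).clm_flip).clm_comp (hBs.mono hW₂₁)).clm_flip
  have hQapp : ∀ x u v, (((h x).comp (B x)).flip.comp (B x)).flip u v = h x (B x u) (B x v) :=
    fun _ _ _ => rfl
  -- Multiplication by i is put among the isometries, so that `R` is complex linear. Then `B`
  -- followed after the inverse of `R` is still complex linear, and it carries the standard inner
  -- product to `h`.
  obtain ⟨W₃, R, hW₃, hx₃, hW₃₂, hRs, hR⟩ := exists_smooth_positive_sqrt hW₂o hx₂ hQs
    (fun x hx u v => by rw [hQapp, hQapp, hsymm x hx.1])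
    (fun x hx v hv => by
      rw [hQapp]
      exact hhpos x hx.1 _ fun h0 => hv ((show (B x).IsInvertible from hx.2).injective
        (h0.trans (map_zero _).symm)))
    (by
      ext m m'
      rw [hQapp, hB₀, hTh])
    (Γ := insert (mulI k') (con '' Γ)) ((hΓ.image _).insert _)
    (by
      rintro C (rfl | ⟨γ, hγ, rfl⟩)
      · refine isInvertible_of_injective rfl fun m m' hmm => ?_
        have := congrArg (mulI k') hmm
        rwa [mulI_mulI, mulI_mulI, neg_inj] at this
      · exact hconi γ hγ)
    (by
      rintro C (rfl | ⟨γ, hγ, rfl⟩) x hx u v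
      · rw [hQapp, hQapp, mulI_apply, mulI_apply, hBI x hx.1, hBI x hx.1, hJh x hx.1]
      · rw [hQapp, hQapp, hBcon γ hγ x hx.1, hBcon γ hγ x hx.1, happ, happ, hJΓ γ hγ x hx.1,
          hΓω γ hγ x (hW₁W hx.1)])
  have hRi : ∀ x ∈ W₃, (R x).IsInvertible := fun x hx => (hR x hx).1
  have hRI : ∀ x ∈ W₃, ∀ C ∈ insert (mulI k') (con '' Γ), ∀ m,
      (R x).inverse (C m) = C ((R x).inverse m) := by
    intro x hx C hC m
    apply (hRi x hx).injective
    rw [(hRi x hx).self_apply_inverse, (hR x hx).2.2 C hC, (hRi x hx).self_apply_inverse]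
  have hBi : ∀ x ∈ W₃, (B x).IsInvertible := fun x hx => (hW₃₂ hx).2
  set A : F → CSpace k' →L[ℝ] CSpace k' := fun x => (B x).comp (R x).inverse with hA
  have hAapp : ∀ x m, A x m = B x ((R x).inverse m) := fun _ _ => rfl
  have hAi : ∀ x ∈ W₃, (A x).IsInvertible := fun x hx => (hBi x hx).comp (hRi x hx).inverse
  have hAI : ∀ x ∈ W₃, ∀ m, A x (Complex.I • m) = J x (A x m) := by
    intro x hx m
    have h1 := hRI x hx (mulI k') (mem_insert _ _) m
    rw [mulI_apply, mulI_apply] at h1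
    rw [hAapp, h1, hBI x (hW₃₂ hx).1, hAapp]
  -- Both `B x` and `R x` respect the group as conjugated at `x₀`, so the action seen in the new
  -- gauge does not depend on `x`.
  have hAγ : ∀ x ∈ W₃, ∀ γ ∈ Γ, ∀ m, (A x).inverse (γ (A x m)) = con γ m := by
    intro x hx γ hγ m
    apply (hAi x hx).injective
    rw [(hAi x hx).self_apply_inverse, hAapp, hAapp,
      hRI x hx _ (mem_insert_of_mem _ (mem_image_of_mem _ hγ)), hBcon γ hγ x (hW₃₂ hx).1]
  refine ⟨W₃, A, hW₃, hx₃, hW₃₂.trans (hW₂₁.trans hW₁W),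
    (hBs.mono (hW₃₂.trans hW₂₁)).clm_comp (hRs.clm_inverse hRi), fun x hx =>
    ⟨hAi x hx, fun m m' => ?_, fun m => ?_, fun γ hγ m => ?_⟩⟩
  · have hx1 := (hW₃₂ hx).1
    have h1 : ω' x (A x m) (A x m') = - h x (A x m) (A x (Complex.I • m')) := by
      rw [happ, hAI x hx, hJJ x hx1, map_neg, neg_neg]
    have h2 : ∀ u v, h x (A x u) (A x v) = reForm k' u v := by
      intro u v
      rw [hAapp, hAapp, ← hQapp, (hR x hx).2.1, (hRi x hx).self_apply_inverse,
        (hRi x hx).self_apply_inverse]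
    rw [h1, h2, reForm_smul_I, neg_neg]
  · rw [hAI x hx, hJG x (hW₃₂ hx).1]
  · rw [hAγ x hx γ hγ, hAγ x₀ hx₃ γ hγ]

end Gauge

/-! ### Change of gauge of a frame, and the dimensions of tangent and normal spaces. -/

namespace OrbifoldAtlas

section

variable {E : Type uE} [NormedAddCommGroup E] [NormedSpace ℝ E] [CompleteSpace E]
  {X : Type uX} [TopologicalSpace X] {A : OrbifoldAtlas.{uE, uX, uI, uG} E X}
  {σ : A.SymplecticForm} {D : Set X} {d k : ℕ}

namespace Frame

/-- A frame restricted to a smaller domain and composed with a change of gauge `T` of the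
fibres. -/
noncomputable def modify (t : Frame σ D d k) (B' : Set (CSpace d)) (hB : IsOpen B')
    (hBt : B' ⊆ t.B) (T : CSpace d → CSpace k →L[ℝ] CSpace k) (hT : ContDiffOn ℝ ∞ T B')
    (hTi : ∀ x ∈ B', (T x).IsInvertible) (Γ' : Set (CSpace k →L[ℝ] CSpace k))
    (hΓ : ∀ x ∈ B', ∀ γ', γ' ∈ Γ' ↔ ∃ γ ∈ t.Γ, ∀ m, γ (T x m) = T x (γ' m)) :
    Frame σ D d k where
  α := t.α
  B := B'
  O := t.O ∩ t.r ⁻¹' B'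
  j := t.j
  r := t.r
  L := fun x => (t.L x).comp (T x)
  M := fun w => (T (t.r w)).inverse.comp (t.M w)
  Γ := Γ'
  isOpen_B := hB
  isOpen_O := t.r_smooth.continuousOn.isOpen_inter_preimage t.isOpen_O hB
  O_subset := inter_subset_left.trans t.O_subset
  j_smooth := t.j_smooth.mono hBt
  r_smooth := t.r_smooth.mono inter_subset_left
  L_smooth := (t.L_smooth.mono hBt).clm_comp hT
  M_smooth := ((hT.clm_inverse hTi).comp (t.r_smooth.mono inter_subset_left)
    fun w hw => hw.2).clm_comp (t.M_smooth.mono inter_subset_left)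
  j_mem := fun x hx => ⟨t.j_mem x (hBt hx), by rwa [mem_preimage, t.r_j x (hBt hx)]⟩
  j_mem_D := fun x hx => t.j_mem_D x (hBt hx)
  r_j := fun x hx => t.r_j x (hBt hx)
  j_r := fun w hw hwD => ⟨hw.2, (t.j_r w hw.1 hwD).2⟩
  range_fderiv_j := fun x hx => t.range_fderiv_j x (hBt hx)
  M_L := fun x hx m => by
    simp only [ContinuousLinearMap.comp_apply]
    rw [t.r_j x (hBt hx), t.M_L x (hBt hx), (hTi x hx).inverse_apply_self]
  range_L := fun x hx => by
    rw [← t.range_L x (hBt hx), ContinuousLinearMap.coe_comp, range_comp,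
      (hTi x hx).surjective.range_eq, image_univ]
  injOn := fun x hx y hy => t.injOn x (hBt hx) y (hBt hy)
  mem_Γ_iff := fun x hx γ' => by
    rw [hΓ x hx]
    constructor
    · rintro ⟨γ, hγ, h⟩
      obtain ⟨g, hg, hgL⟩ := (t.mem_Γ_iff x (hBt hx) γ).1 hγ
      refine ⟨g, hg, fun m => ?_⟩
      simp only [ContinuousLinearMap.comp_apply]
      rw [hgL, h]
    · rintro ⟨g, hg, h⟩
      refine ⟨(T x).comp (γ'.comp (T x).inverse), (t.mem_Γ_iff x (hBt hx) _).2 ⟨g, hg, fun m => ?_⟩,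
        fun m => ?_⟩
      · have := h ((T x).inverse m)
        simp only [ContinuousLinearMap.comp_apply] at this
        rw [(hTi x hx).self_apply_inverse] at this
        exact this
      · simp only [ContinuousLinearMap.comp_apply]
        rw [(hTi x hx).inverse_apply_self]

section

variable {t : Frame σ D d k} {B' : Set (CSpace d)} {hB : IsOpen B'}
    {hBt : B' ⊆ t.B} {T : CSpace d → CSpace k →L[ℝ] CSpace k} {hT : ContDiffOn ℝ ∞ T B'}
    {hTi : ∀ x ∈ B', (T x).IsInvertible} {Γ' : Set (CSpace k →L[ℝ] CSpace k)}
    {hΓ : ∀ x ∈ B', ∀ γ', γ' ∈ Γ' ↔ ∃ γ ∈ t.Γ, ∀ m, γ (T x m) = T x (γ' m)}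

theorem modify_form (x : CSpace d) (m m' : CSpace k) :
    (t.modify B' hB hBt T hT hTi Γ' hΓ).form x m m' = t.form x (T x m) (T x m') := rfl

theorem modify_Φ [Nonempty (σ.NormalBundle D)] (x : CSpace d) (m : CSpace k) :
    (t.modify B' hB hBt T hT hTi Γ' hΓ).Φ (x, m) = t.Φ (x, T x m) := rfl

end

end Frame

end

section

variable {F : Type uE} [NormedAddCommGroup F] [InnerProductSpace ℝ F] [FiniteDimensional ℝ F]
  {X : Type uX} [TopologicalSpace X] {A : OrbifoldAtlas.{uE, uX, uI, uG} F X}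

theorem SymplecticForm.exists_finrank_submodule (σ : A.SymplecticForm) (α : A.Index) (u : F)
    (S : Submodule ℝ F) (h : ∀ v ∈ S, (∀ w ∈ S, σ.bil α u v w = 0) → v = 0) :
    ∃ k, Module.finrank ℝ S = 2 * k := by
  refine exists_finrank_eq_two_mul (g := innerₗ S)
    (ω' := (σ.bil α u).toLinearMap₁₂.domRestrict₁₂ S S) ?_ ?_ ?_ ?_
  · exact fun u v => real_inner_comm _ _
  · exact fun v hv => real_inner_self_pos.2 fun h0 => hv (Subtype.ext h0)
  · exact fun v w => σ.bil_swap _ _ _ _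
  · exact fun v hv => Subtype.ext (h v v.2 fun w hw => hv ⟨w, hw⟩)

/-- The dimensions of the tangent and normal spaces of `D`. -/
theorem SymplecticForm.exists_dimensions (σ : A.SymplecticForm) {n : ℕ}
    (hn : Module.finrank ℝ F = 2 * n) (H : Subgroup (F ≃ₗᵢ[ℝ] F))
    (hne : (A.isotropySubset H).Nonempty) :
    ∃ d k, d + k = n ∧ ∀ α, ∀ u ∈ (A.chart α).U, (A.chart α).φ u ∈ A.isotropySubset H →
      Module.finrank ℝ ((A.chart α).fixedSpace u) = 2 * d ∧
      Module.finrank ℝ (σ.normalSpace α u) = 2 * k := by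
  have : CompleteSpace F := FiniteDimensional.complete ℝ F
  let fix : Submodule ℝ F :=
    { carrier := {v | ∀ h ∈ H, h v = v}
      zero_mem' := fun h _ => map_zero h
      add_mem' := fun {v w} hv hw h hh => by rw [map_add, hv h hh, hw h hh]
      smul_mem' := fun r v hv h hh => by rw [map_smul, hv h hh] }
  -- Every fixed space over `D` is isomorphic to that of `H`; thus the dimensions agree over all
  -- components of `D`.
  have key : ∀ α, ∀ u ∈ (A.chart α).U, (A.chart α).φ u ∈ A.isotropySubset H →
      Module.finrank ℝ ((A.chart α).fixedSpace u) = Module.finrank ℝ fix := by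
    intro α u hu huD
    obtain ⟨T, hT⟩ := (mem_isotropySubset_iff hu).1 huD
    have hm : ((A.chart α).fixedSpace u).map (T.toLinearEquiv : F →ₗ[ℝ] F) = fix := by
      ext w
      constructor
      · rintro ⟨v, hv, rfl⟩ h hh
        have hv' := hv _ ((hT ((T.symm : F →L[ℝ] F).comp
          ((h.toContinuousLinearEquiv : F →L[ℝ] F).comp (T : F →L[ℝ] F)))).2
          ⟨h, hh, fun v => by simp⟩)
        exact T.symm_apply_eq.1 hv'
      · intro hw
        refine ⟨T.symm w, fun L hL => ?_, T.apply_symm_apply w⟩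
        obtain ⟨h, hh, hv⟩ := (hT L).1 hL
        apply T.injective
        rw [hv, T.apply_symm_apply, hw h hh]
    rw [← hm, LinearEquiv.finrank_map_eq]
  have hsum : ∀ α, ∀ u ∈ (A.chart α).U, Module.finrank ℝ ((A.chart α).fixedSpace u) +
      Module.finrank ℝ (σ.normalSpace α u) = 2 * n := fun α u hu => by
    rw [← hn, Submodule.finrank_add_eq_of_isCompl (σ.isCompl_fixedSpace_normalSpace hu)]
  obtain ⟨x, α, u, hu, rfl, hT⟩ := hne
  have huD : (A.chart α).φ u ∈ A.isotropySubset H := ⟨α, u, hu, rfl, hT⟩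
  obtain ⟨d, hd⟩ := σ.exists_finrank_submodule α u ((A.chart α).fixedSpace u)
    fun v => σ.nondegenerate_fixedSpace hu
  obtain ⟨k, hk⟩ := σ.exists_finrank_submodule α u (σ.normalSpace α u)
    fun v => σ.nondegenerate_normalSpace hu
  have h0 := hsum α u hu
  refine ⟨d, k, by omega, fun β w hw hwD => ?_⟩
  have h1 := hsum β w hw
  have h2 := key β w hw hwD
  have h3 := key α u hu huD
  omega

theorem exists_parametrization (S : Submodule ℝ F) {d : ℕ} (h : Module.finrank ℝ S = 2 * d) :
    ∃ (ι : CSpace d →L[ℝ] F) (ι' : F →L[ℝ] CSpace d), (∀ x, ι' (ι x) = x) ∧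
      range ι = (S : Set F) := by
  have h1 : Module.finrank ℝ (CSpace d) = Module.finrank ℝ S := by
    rw [h, finrank_real_of_complex, finrank_euclideanSpace_fin]
  let e : CSpace d ≃L[ℝ] S := (LinearEquiv.ofFinrankEq _ _ h1).toContinuousLinearEquiv
  refine ⟨S.subtypeL.comp (e : CSpace d →L[ℝ] S),
    (e.symm : S →L[ℝ] CSpace d).comp S.orthogonalProjectionOnto, fun x => ?_, ?_⟩
  · simp
  · rw [ContinuousLinearMap.coe_comp, range_comp]
    simp

/-- `D` is covered by frames. -/
theorem exists_frame_of_finrank (σ : A.SymplecticForm) {H : Subgroup (F ≃ₗᵢ[ℝ] F)} [Finite H]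
    {d k : ℕ} (h : ∀ α, ∀ u ∈ (A.chart α).U, (A.chart α).φ u ∈ A.isotropySubset H →
      Module.finrank ℝ ((A.chart α).fixedSpace u) = 2 * d ∧
      Module.finrank ℝ (σ.normalSpace α u) = 2 * k) (p : X) (hp : p ∈ A.isotropySubset H) :
    ∃ t : Frame σ (A.isotropySubset H) d k, ∃ x ∈ t.B, t.b x = p := by
  have : CompleteSpace F := FiniteDimensional.complete ℝ F
  obtain ⟨α, u, hu, rfl⟩ := A.cover p
  obtain ⟨h1, h2⟩ := h α u hu hp
  obtain ⟨ι, ι', hι, hιr⟩ := exists_parametrization _ h1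
  obtain ⟨κ, κ', hκ, hκr⟩ := exists_parametrization _ h2
  exact exists_frame σ hu hp ι ι' hι hιr κ κ' hκ hκr

end

end OrbifoldAtlas

/-! ### Hausdorffness and second countability of the normal bundle. -/

namespace OrbifoldAtlas

variable {E : Type uE} [NormedAddCommGroup E] [NormedSpace ℝ E] [CompleteSpace E]
  {X : Type uX} [TopologicalSpace X] {A : OrbifoldAtlas.{uE, uX, uI, uG} E X}
  {σ : A.SymplecticForm} {D : Set X} {d k : ℕ}

theorem SymplecticForm.continuous_normalProj (σ : A.SymplecticForm) (D : Set X) :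
    Continuous (σ.normalProj D) := by
  refine continuous_quot_lift _ ?_
  refine continuous_sigma fun α => ?_
  exact (A.chart α).φ_continuousOn.comp_continuous (by fun_prop) fun p => p.2.1

theorem SymplecticForm.normalProj_mem (q : σ.NormalBundle D) : σ.normalProj D q ∈ D := by
  obtain ⟨p, rfl⟩ := Quot.exists_rep q
  exact p.2.2.2.1

theorem nonempty_normalBundle (σ : A.SymplecticForm) (hne : D.Nonempty) :
    Nonempty (σ.NormalBundle D) := by
  obtain ⟨p, hp⟩ := hne
  obtain ⟨α, u, hu, rfl⟩ := A.cover p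
  exact ⟨Quot.mk _ ⟨α, (u, 0), hu, hp, (σ.normalSpace α u).zero_mem⟩⟩

namespace Frame

theorem image_b_mem_nhdsWithin (t : Frame σ D d k) {x : CSpace d} (hx : x ∈ t.B)
    {W : Set (CSpace d)} (hW : W ∈ 𝓝 x) : t.b '' (W ∩ t.B) ∈ 𝓝[D] (t.b x) := by
  obtain ⟨V, hV, hxV, hVD⟩ := exists_open_inter_subset hW hx
  exact mem_nhdsWithin.2 ⟨V, hV, hxV, hVD⟩

/-- Vectors over different points are separated by the projection to `X`. For two vectors m, m' over
one point the finitely many conditions γ m ≠ m' persist on neighbourhoods in the fibre. Since `Γ` is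
the same over all of `B`, products of `B` with these neighbourhoods have disjoint images. -/
theorem t2Space_normalBundle [T2Space X] [Nonempty (σ.NormalBundle D)]
    (hcov : ∀ p ∈ D, ∃ t : Frame σ D d k, ∃ x ∈ t.B, t.b x = p) :
    T2Space (σ.NormalBundle D) := by
  refine ⟨fun p q hpq => ?_⟩
  by_cases hproj : σ.normalProj D p = σ.normalProj D q
  · obtain ⟨t, x, hx, htx⟩ := hcov _ (SymplecticForm.normalProj_mem p)
    obtain ⟨m, rfl⟩ := exists_Φ_eq hx htx.symm
    obtain ⟨m', rfl⟩ := exists_Φ_eq (q := q) hx (by rw [← hproj, htx])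
    have hev : ∀ᶠ r : CSpace k × CSpace k in 𝓝 m ×ˢ 𝓝 m', ∀ γ ∈ t.Γ, γ r.1 ≠ r.2 := by
      rw [eventually_all_finite (finite_Γ hx), ← nhds_prod_eq]
      intro γ hγ
      have hc : ContinuousAt (fun r : CSpace k × CSpace k => γ r.1 - r.2) (m, m') := by fun_prop
      have := hc.eventually_ne (y := 0)
        (sub_ne_zero.2 fun h => hpq ((Φ_eq_iff hx hx m m').2 ⟨rfl, γ, hγ, h⟩))
      filter_upwards [this] with r hr using sub_ne_zero.1 hr
    rw [← nhds_prod_eq, eventually_nhds_iff] at hev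
    obtain ⟨S, hS, hSo, hmS⟩ := hev
    obtain ⟨N, N', hN, hN', hmN, hmN', hNS⟩ := isOpen_prod_iff.1 hSo m m' hmS
    refine ⟨t.Φ '' (t.B ×ˢ N), t.Φ '' (t.B ×ˢ N'),
      isOpen_image_Φ (t.isOpen_B.prod hN) (prod_mono_right (subset_univ _)),
      isOpen_image_Φ (t.isOpen_B.prod hN') (prod_mono_right (subset_univ _)),
      ⟨_, ⟨hx, hmN⟩, rfl⟩, ⟨_, ⟨hx, hmN'⟩, rfl⟩, ?_⟩
    rw [Set.disjoint_left]
    rintro _ ⟨⟨y, a⟩, ⟨hy, ha⟩, rfl⟩ ⟨⟨z, b⟩, ⟨hz, hb⟩, h⟩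
    obtain ⟨-, γ, hγ, hab⟩ := (Φ_eq_iff hy hz a b).1 h.symm
    exact hS (a, b) (hNS ⟨ha, hb⟩) γ hγ hab
  · obtain ⟨V, V', hV, hV', hp, hq, hd⟩ := t2_separation hproj
    exact ⟨_, _, hV.preimage (σ.continuous_normalProj D), hV'.preimage (σ.continuous_normalProj D),
      hp, hq, hd.preimage _⟩

/-- Countably many frames cover `D`, and each `Φ` is continuous and open on its domain, so the
images of a countable basis form a basis. -/
theorem secondCountableTopology_normalBundle [SecondCountableTopology X]
    [Nonempty (σ.NormalBundle D)]
    (hcov : ∀ p ∈ D, ∃ t : Frame σ D d k, ∃ x ∈ t.B, t.b x = p) :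
    SecondCountableTopology (σ.NormalBundle D) := by
  have : Nonempty (Frame σ D d k) := by
    obtain ⟨t, -⟩ := hcov _ (SymplecticForm.normalProj_mem (Classical.arbitrary (σ.NormalBundle D)))
    exact ⟨t⟩
  choose! T hT using hcov
  obtain ⟨C, hCD, hC, hDC⟩ := TopologicalSpace.countable_cover_nhdsWithin
    (f := fun p => (T p).b '' (T p).B) (s := D) (by
      intro p hp
      obtain ⟨x, hx, hxp⟩ := hT p hp
      have := (T p).image_b_mem_nhdsWithin hx univ_mem
      rwa [univ_inter, hxp] at this)
  set bs := TopologicalSpace.countableBasis (CSpace d × CSpace k)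
  have hbs := TopologicalSpace.isBasis_countableBasis (CSpace d × CSpace k)
  refine TopologicalSpace.IsTopologicalBasis.secondCountableTopology
    (b := ⋃ p ∈ C, (fun W => (T p).Φ '' W) '' {W ∈ bs | W ⊆ (T p).B ×ˢ univ}) ?_ ?_
  · refine TopologicalSpace.isTopologicalBasis_of_isOpen_of_nhds ?_ ?_
    · intro S hS
      obtain ⟨p, hp, W, ⟨hW, hWB⟩, rfl⟩ := mem_iUnion₂.1 hS
      exact isOpen_image_Φ (hbs.isOpen hW) hWB
    · intro q S hq hS
      obtain ⟨p, hpC, x, hx, hxq⟩ := mem_iUnion₂.1 (hDC (SymplecticForm.normalProj_mem q))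
      obtain ⟨m, rfl⟩ := exists_Φ_eq hx hxq.symm
      obtain ⟨W, hW, hxW, hWS⟩ := hbs.exists_subset_of_mem_open
        (a := (x, m)) (u := ((T p).B ×ˢ univ) ∩ (T p).Φ ⁻¹' S) ⟨⟨hx, trivial⟩, hq⟩
        ((continuousOn_Φ).isOpen_inter_preimage ((T p).isOpen_B.prod isOpen_univ) hS)
      refine ⟨_, mem_iUnion₂.2 ⟨p, hpC, W, ⟨hW, fun z hz => (hWS hz).1⟩, rfl⟩, ⟨_, hxW, rfl⟩, ?_⟩
      rintro _ ⟨z, hz, rfl⟩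
      exact (hWS hz).2
  · exact hC.biUnion fun p hp =>
      ((TopologicalSpace.countable_countableBasis _).mono (sep_subset _ _)).image _

end Frame

end OrbifoldAtlas

/-! ### A smooth fibre metric on the normal bundle. -/

theorem ContDiffOn.smul_bilinear {E F G H : Type*} [NormedAddCommGroup E] [NormedSpace ℝ E]
    [NormedAddCommGroup F] [NormedSpace ℝ F] [NormedAddCommGroup G] [NormedSpace ℝ G]
    [NormedAddCommGroup H] [NormedSpace ℝ H] {n : WithTop ℕ∞} {s : Set E} {f : E → ℝ}
    {g : E → F →L[ℝ] G →L[ℝ] H} (hf : ContDiffOn ℝ n f s) (hg : ContDiffOn ℝ n g s) :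
    ContDiffOn ℝ n (fun x => f x • g x) s := by
  have h1 : ContDiffOn ℝ n (fun x => ContinuousLinearMap.lsmul ℝ ℝ (E := F) (f x)) s :=
    (ContinuousLinearMap.lsmul ℝ ℝ (E := F)).contDiff.comp_contDiffOn hf
  convert hg.clm_comp h1 using 2 with x
  ext u v
  simp

namespace OrbifoldAtlas

variable {E : Type uE} [NormedAddCommGroup E] [NormedSpace ℝ E] [CompleteSpace E]
  {X : Type uX} [TopologicalSpace X] {A : OrbifoldAtlas.{uE, uX, uI, uG} E X}
  {σ : A.SymplecticForm} {D : Set X} {d k : ℕ}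

namespace Frame

/-- A function on the normal bundle is, in the frame `t` and near `x`, a smooth family of quadratic
forms. -/
def QuadraticAt [Nonempty (σ.NormalBundle D)] (q : σ.NormalBundle D → ℝ) (t : Frame σ D d k)
    (x : CSpace d) : Prop :=
  ∃ (W : Set (CSpace d)) (G : CSpace d → CSpace k →L[ℝ] CSpace k →L[ℝ] ℝ), IsOpen W ∧ x ∈ W ∧
    W ⊆ t.B ∧ ContDiffOn ℝ ∞ G W ∧ ∀ z ∈ W, (∀ m m', G z m m' = G z m' m) ∧
      ∀ m, q (t.Φ (z, m)) = G z m m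

section

variable [Nonempty (σ.NormalBundle D)] {q q' : σ.NormalBundle D → ℝ} {t s : Frame σ D d k}
  {x : CSpace d}

theorem QuadraticAt.zero (hx : x ∈ t.B) {W : Set (CSpace d)} (hW : W ∈ 𝓝 x)
    (h : ∀ z ∈ W, z ∈ t.B → ∀ m, q (t.Φ (z, m)) = 0) : QuadraticAt q t x := by
  refine ⟨interior W ∩ t.B, fun _ => 0, isOpen_interior.inter t.isOpen_B,
    ⟨mem_interior_iff_mem_nhds.2 hW, hx⟩, inter_subset_right, contDiffOn_const,
    fun z hz => ⟨fun _ _ => rfl, fun m => ?_⟩⟩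
  rw [h z (interior_subset hz.1) hz.2]
  rfl

theorem QuadraticAt.sum {ι : Type*} {f : ι → σ.NormalBundle D → ℝ} (hx : x ∈ t.B) (I : Finset ι)
    (h : ∀ i ∈ I, QuadraticAt (f i) t x) : QuadraticAt (fun p => ∑ i ∈ I, f i p) t x := by
  classical
  induction I using Finset.induction_on with
  | empty => exact .zero hx univ_mem (by simp)
  | insert i I hi ih =>
    obtain ⟨W, G, hW, hxW, hWt, hGs, hG⟩ := h i (Finset.mem_insert_self _ _)
    obtain ⟨W', G', hW', hxW', -, hGs', hG'⟩ := ih fun j hj => h j (Finset.mem_insert_of_mem hj)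
    refine ⟨W ∩ W', fun z => G z + G' z, hW.inter hW', ⟨hxW, hxW'⟩, inter_subset_left.trans hWt,
      (hGs.mono inter_subset_left).add (hGs'.mono inter_subset_right), fun z hz =>
      ⟨fun m m' => ?_, fun m => ?_⟩⟩
    · simp only [add_apply, (hG z hz.1).1 m, (hG' z hz.2).1 m]
    · simp only [add_apply, Finset.sum_insert hi, (hG z hz.1).2, ← (hG' z hz.2).2]

theorem QuadraticAt.congr (h : QuadraticAt q t x) {W : Set (CSpace d)} (hW : W ∈ 𝓝 x)
    (hq : ∀ z ∈ W, z ∈ t.B → ∀ m, q' (t.Φ (z, m)) = q (t.Φ (z, m))) : QuadraticAt q' t x := by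
  obtain ⟨W', G, hW', hxW, hWt, hGs, hG⟩ := h
  refine ⟨W' ∩ interior W, G, hW'.inter isOpen_interior, ⟨hxW, mem_interior_iff_mem_nhds.2 hW⟩,
    inter_subset_left.trans hWt, hGs.mono inter_subset_left, fun z hz => ⟨(hG z hz.1).1,
    fun m => ?_⟩⟩
  rw [hq z (interior_subset hz.2) (hWt hz.1), (hG z hz.1).2]

/-- The standard inner product of the fibre is averaged over `Γ` and multiplied by a bump function
on the base. Two preimages of a point of the normal bundle under `Φ` differ by an element of `Γ`, so
invariance makes the product well defined; it is extended by zero. -/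
theorem exists_quadratic_local [T2Space X] (s : Frame σ D d k) {c : CSpace d} {r : ℝ} (hr : 0 < r)
    (hc : Metric.closedBall c r ⊆ s.B) :
    ∃ q : σ.NormalBundle D → ℝ, (∀ p, 0 ≤ q p) ∧
      (∀ (t : Frame σ D d k), ∀ x ∈ t.B, QuadraticAt q t x) ∧
      (∀ p, σ.normalProj D p ∉ s.b '' Metric.ball c r → q p = 0) ∧
      ∀ z ∈ Metric.ball c r, ∀ m, m ≠ 0 → 0 < q (s.Φ (z, m)) := by
  have hcB : c ∈ s.B := hc (Metric.mem_closedBall_self hr.le)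
  have hbB : Metric.ball c r ⊆ s.B := Metric.ball_subset_closedBall.trans hc
  have hfin := finite_Γ hcB
  set N : CSpace k →L[ℝ] CSpace k →L[ℝ] ℝ :=
    ∑ γ ∈ hfin.toFinset, (reForm k).bilinearComp γ γ with hN
  have hNapp : ∀ m m', N m m' = ∑ γ ∈ hfin.toFinset, reForm k (γ m) (γ m') := by
    intro m m'
    simp only [hN, sum_apply, ContinuousLinearMap.bilinearComp_apply]
  have hNs : ∀ m m', N m m' = N m' m := by
    intro m m'
    rw [hNapp, hNapp]
    exact Finset.sum_congr rfl fun γ _ => reForm_symm _ _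
  have hNΓ : ∀ γ ∈ s.Γ, ∀ m, N (γ m) (γ m) = N m m := by
    intro γ hγ m
    obtain ⟨γ', hγ', h1, h2⟩ := inv_mem_Γ hcB hγ
    rw [hNapp, hNapp]
    refine Finset.sum_nbij' (fun a => a.comp γ) (fun a => a.comp γ') ?_ ?_ ?_ ?_ ?_
    · exact fun a ha => hfin.mem_toFinset.2 (mul_mem_Γ hcB (hfin.mem_toFinset.1 ha) hγ)
    · exact fun a ha => hfin.mem_toFinset.2 (mul_mem_Γ hcB (hfin.mem_toFinset.1 ha) hγ')
    · intro a _
      ext1 m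
      simp only [ContinuousLinearMap.comp_apply, h2]
    · intro a _
      ext1 m
      simp only [ContinuousLinearMap.comp_apply, h1]
    · exact fun a _ => rfl
  have hN0 : ∀ m, 0 ≤ N m m := by
    intro m
    rw [hNapp]
    exact Finset.sum_nonneg fun γ _ => by
      rw [reForm_self]
      positivity
  have hNpos : ∀ m, m ≠ 0 → 0 < N m m := by
    intro m hm
    rw [hNapp]
    refine Finset.sum_pos' (fun γ _ => ?_) ⟨_, hfin.mem_toFinset.2 (one_mem_Γ hcB), ?_⟩
    · rw [reForm_self]
      positivity
    · exact reForm_pos m hm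
  let β : ContDiffBump c := ⟨r / 2, r, half_pos hr, half_lt_self hr⟩
  classical
  let q : σ.NormalBundle D → ℝ := fun p =>
    if h : ∃ y : CSpace d × CSpace k, y.1 ∈ s.B ∧ s.Φ y = p then
      β h.choose.1 * N h.choose.2 h.choose.2 else 0
  have hq : ∀ z ∈ s.B, ∀ m, q (s.Φ (z, m)) = β z * N m m := by
    intro z hz m
    have h : ∃ y : CSpace d × CSpace k, y.1 ∈ s.B ∧ s.Φ y = s.Φ (z, m) := ⟨(z, m), hz, rfl⟩
    obtain ⟨h1, γ, hγ, h2⟩ := (Φ_eq_iff hz h.choose_spec.1 m h.choose.2).1 h.choose_spec.2.symm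
    simp only [q, dif_pos h]
    rw [← h2, hNΓ γ hγ, ← h1]
  have hq0 : ∀ p, σ.normalProj D p ∉ s.b '' Metric.ball c r → q p = 0 := by
    intro p hp
    by_cases h : ∃ y : CSpace d × CSpace k, y.1 ∈ s.B ∧ s.Φ y = p
    · obtain ⟨⟨z, m⟩, hz, rfl⟩ := h
      rw [hq z hz, β.zero_of_le_dist, zero_mul]
      by_contra hlt
      exact hp ⟨z, not_le.1 hlt, (normalProj_Φ hz m).symm⟩
    · exact dif_neg h
  refine ⟨q, fun p => ?_, fun t x hx => ?_, hq0, fun z hz m hm => ?_⟩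
  · by_cases h : ∃ y : CSpace d × CSpace k, y.1 ∈ s.B ∧ s.Φ y = p
    · obtain ⟨⟨z, m⟩, hz, rfl⟩ := h
      rw [hq z hz]
      exact mul_nonneg β.nonneg (hN0 m)
    · have h0 : q p = 0 := dif_neg h
      rw [h0]
  · by_cases h : t.b x ∈ s.b '' Metric.closedBall c r
    · obtain ⟨y, hy, hyx⟩ := h
      obtain ⟨W, ψ, P, hW, hxW, hWt, hψ, hP, -, h⟩ := exists_frame_transition hx (hc hy) hyx.symm
      refine ⟨W, fun z => β (ψ z) • ((N.comp (P z)).flip.comp (P z)).flip, hW, hxW, hWt, ?_,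
        fun z hz => ⟨fun m m' => ?_, fun m => ?_⟩⟩
      · have hβ : ContDiffOn ℝ ∞ (fun z => β (ψ z)) W :=
          (β.contDiff (n := ⊤)).comp_contDiffOn hψ
        have hN : ContDiffOn ℝ ∞ (fun z => ((N.comp (P z)).flip.comp (P z)).flip) W :=
          ((contDiffOn_const.clm_comp hP).clm_flip.clm_comp hP).clm_flip
        exact hβ.smul_bilinear hN
      · change β (ψ z) * N (P z m) (P z m') = β (ψ z) * N (P z m') (P z m)
        rw [hNs]
      · obtain ⟨h1, -, -, h2⟩ := h z hz
        rw [h2, hq _ h1]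
        rfl
    · have hcl : IsClosed (s.b '' Metric.closedBall c r) :=
        ((isCompact_closedBall c r).image_of_continuousOn (continuousOn_b.mono hc)).isClosed
      refine .zero hx (W := t.b ⁻¹' (s.b '' Metric.closedBall c r)ᶜ) ?_ fun z hz hzB m => ?_
      · exact ((continuousOn_b).continuousAt (t.isOpen_B.mem_nhds hx)).preimage_mem_nhds
          (hcl.isOpen_compl.mem_nhds h)
      · refine hq0 _ fun hz' => hz ?_
        rw [normalProj_Φ hzB] at hz'
        exact image_mono Metric.ball_subset_closedBall hz'
  · rw [hq z (hbB hz)]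
    exact mul_pos (β.pos_of_mem_ball hz) (hNpos m hm)

theorem map_nhds_b (hx : x ∈ t.B) : map t.b (𝓝 x) = 𝓝[D] (t.b x) := by
  refine le_antisymm ?_ fun S hS => ?_
  · refine tendsto_nhdsWithin_iff.2 ⟨(continuousOn_b.continuousAt (t.isOpen_B.mem_nhds hx)).tendsto,
      ?_⟩
    filter_upwards [t.isOpen_B.mem_nhds hx] with z hz using b_mem hz
  · filter_upwards [t.image_b_mem_nhdsWithin hx (mem_map.1 hS)]
    rintro _ ⟨z, hz, rfl⟩
    exact hz.1

/-- There is a smooth fibre metric on the normal bundle. -/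
theorem exists_quadratic [T2Space X] [SecondCountableTopology X]
    (hcov : ∀ p ∈ D, ∃ t : Frame σ D d k, ∃ x ∈ t.B, t.b x = p) :
    ∃ q : σ.NormalBundle D → ℝ, (∀ (t : Frame σ D d k), ∀ x ∈ t.B, QuadraticAt q t x) ∧
      ∀ (t : Frame σ D d k), ∀ x ∈ t.B, ∀ m, m ≠ 0 → 0 < q (t.Φ (x, m)) := by
  have : Nonempty (Frame σ D d k) := by
    obtain ⟨t, -⟩ := hcov _ (SymplecticForm.normalProj_mem (Classical.arbitrary (σ.NormalBundle D)))
    exact ⟨t⟩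
  choose! T x hx hxT using hcov
  have hbasis : ∀ p : D, (𝓝 p).HasBasis
      (fun r : ℝ => 0 < r ∧ Metric.closedBall (x p) r ⊆ (T p).B)
      fun r => Subtype.val ⁻¹' ((T p).b '' Metric.ball (x p) r) := by
    intro p
    have hp := map_nhds_b (t := T p) (hx p p.2)
    rw [hxT p p.2] at hp
    rw [nhds_subtype_eq_comap_nhdsWithin, ← hp]
    refine HasBasis.comap _ (HasBasis.map _ ?_)
    refine Metric.nhds_basis_ball.restrict fun r hr => ?_
    obtain ⟨ε, hε, hεB⟩ := Metric.nhds_basis_closedBall.mem_iff.1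
      ((T p).isOpen_B.mem_nhds (hx p p.2))
    exact ⟨min r ε, lt_min hr hε, (Metric.closedBall_subset_closedBall (min_le_right _ _)).trans hεB,
      Metric.ball_subset_ball (min_le_left _ _)⟩
  have : WeaklyLocallyCompactSpace D := by
    refine ⟨fun p => ?_⟩
    obtain ⟨ε, hε, hεB⟩ := Metric.nhds_basis_closedBall.mem_iff.1
      ((T p).isOpen_B.mem_nhds (hx p p.2))
    refine ⟨Subtype.val ⁻¹' ((T p).b '' Metric.closedBall (x p) ε), ?_, ?_⟩
    · rw [Subtype.isCompact_iff, Subtype.image_preimage_coe, inter_eq_right.2]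
      · exact (isCompact_closedBall _ _).image_of_continuousOn (continuousOn_b.mono hεB)
      · rintro _ ⟨z, hz, rfl⟩
        exact b_mem (hεB hz)
    · exact mem_of_superset ((hbasis p).mem_of_mem ⟨hε, hεB⟩)
        (preimage_mono (image_mono Metric.ball_subset_closedBall))
  -- `D` is locally compact and second countable, so balls in frames give a locally finite cover.
  -- The sum of the local forms needs no normalization: it is positive as soon as one of its terms
  -- is.
  obtain ⟨I, c, r, hr, hcover, hfin⟩ := refinement_of_locallyCompact_sigmaCompact_of_nhds_basis hbasis
  choose q hq0 hqs hqz hqp using fun i => exists_quadratic_local (T (c i)) (hr i).1 (hr i).2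
  refine ⟨fun p => ∑ᶠ i, q i p, fun t z hz => ?_, fun t z hz m hm => ?_⟩
  · obtain ⟨V, hV, hVfin⟩ := hfin ⟨t.b z, b_mem hz⟩
    refine (QuadraticAt.sum hz hVfin.toFinset fun i _ => hqs i t z hz).congr
      (W := {y | ∀ h : t.b y ∈ D, (⟨t.b y, h⟩ : D) ∈ V}) ?_ fun y hy hyB m => ?_
    · rw [mem_nhds_subtype_iff_nhdsWithin, ← map_nhds_b hz] at hV
      filter_upwards [hV] with y hy h
      obtain ⟨y', hy', hyy⟩ := hy
      convert hy'
      exact hyy.symm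
    · refine finsum_eq_sum_of_support_subset _ fun i hi => ?_
      rw [Function.mem_support] at hi
      have := not_imp_comm.1 (hqz i (t.Φ (y, m))) hi
      rw [normalProj_Φ hyB] at this
      rw [Finite.coe_toFinset]
      exact ⟨⟨t.b y, b_mem hyB⟩, this, hy _⟩
  · have hmem : (⟨t.b z, b_mem hz⟩ : D) ∈ ⋃ i, Subtype.val ⁻¹' ((T (c i)).b ''
        Metric.ball (x (c i)) (r i)) := by
      rw [hcover]
      trivial
    obtain ⟨i, y, hy, hyz⟩ := mem_iUnion.1 hmem
    have hsupp : (Function.support fun i => q i (t.Φ (z, m))).Finite := by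
      refine (hfin.point_finite ⟨t.b z, b_mem hz⟩).subset fun j hj => ?_
      have := not_imp_comm.1 (hqz j (t.Φ (z, m))) hj
      rwa [normalProj_Φ hz] at this
    refine lt_of_lt_of_le ?_ (single_le_finsum i hsupp fun j => hq0 j _)
    obtain ⟨W, ψ, P, -, hzW, -, -, -, hψ, h⟩ := exists_frame_transition hz
      ((hr i).2 (Metric.ball_subset_closedBall hy)) hyz.symm
    obtain ⟨-, -, h1, h2⟩ := h z hzW
    rw [h2, hψ]
    refine hqp i y hy _ fun h0 => hm (form_nondegenerate hz fun m' => ?_)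
    rw [← h1, h0, map_zero]
    rfl

end

end Frame

end OrbifoldAtlas

/-! ### Unitary matrices and conjugacy classes of subgroups. -/

namespace UGroup

variable {k : ℕ}

/-- The action of a unitary matrix as a real linear map. -/
noncomputable def clm (g : UGroup k) : CSpace k →L[ℝ] CSpace k :=
  (Matrix.toEuclideanCLM (𝕜 := ℂ) (g : Matrix (Fin k) (Fin k) ℂ)).restrictScalars ℝ

theorem clm_apply (g : UGroup k) (m : CSpace k) : clm g m = g.apply m := rfl

theorem one_apply (m : CSpace k) : (1 : UGroup k).apply m = m := by
  simp [UGroup.apply]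

theorem mul_apply (g h : UGroup k) (m : CSpace k) : (g * h).apply m = g.apply (h.apply m) := by
  simp [UGroup.apply, Matrix.mulVec_mulVec]

theorem inv_apply_apply (g : UGroup k) (m : CSpace k) : (g⁻¹).apply (g.apply m) = m := by
  rw [← mul_apply, inv_mul_cancel, one_apply]

theorem apply_inv_apply (g : UGroup k) (m : CSpace k) : g.apply ((g⁻¹).apply m) = m := by
  rw [← mul_apply, mul_inv_cancel, one_apply]

theorem ext_apply {g h : UGroup k} (H : ∀ m, g.apply m = h.apply m) : g = h := by
  refine Subtype.ext ((Matrix.toEuclideanCLM (𝕜 := ℂ)).injective ?_)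
  ext1 m
  exact H m

theorem apply_smul (g : UGroup k) (c : ℂ) (m : CSpace k) : g.apply (c • m) = c • g.apply m :=
  map_smul (Matrix.toEuclideanCLM (𝕜 := ℂ) (g : Matrix (Fin k) (Fin k) ℂ)) c m

theorem inner_apply_apply (g : UGroup k) (m m' : CSpace k) :
    (inner ℂ (g.apply m) (g.apply m') : ℂ) = inner ℂ m m' := by
  have h : star (Matrix.toEuclideanCLM (𝕜 := ℂ) (g : Matrix (Fin k) (Fin k) ℂ)) *
      Matrix.toEuclideanCLM (𝕜 := ℂ) (g : Matrix (Fin k) (Fin k) ℂ) = 1 := by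
    rw [← map_star, ← map_mul, Matrix.mem_unitaryGroup_iff'.1 g.2, map_one]
  have h1 := ContinuousLinearMap.adjoint_inner_right
    (Matrix.toEuclideanCLM (𝕜 := ℂ) (g : Matrix (Fin k) (Fin k) ℂ)) m (g.apply m')
  refine h1.symm.trans ?_
  have h2 := congrArg (fun S : CSpace k →L[ℂ] CSpace k => S m') h
  exact congrArg (inner ℂ m) h2

theorem clm_mul (g h : UGroup k) : clm (g * h) = (clm g).comp (clm h) := by
  ext1 m
  exact mul_apply g h m

theorem clm_injective : Function.Injective (clm (k := k)) := fun _ _ hgh =>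
  ext_apply fun m => congrArg (fun S : CSpace k →L[ℝ] CSpace k => S m) hgh

/-- Complex linear isometries are given by unitary matrices. -/
theorem exists_eq_clm {P : CSpace k →L[ℝ] CSpace k} (hI : ∀ m, P (Complex.I • m) = Complex.I • P m)
    (hn : ∀ m, ‖P m‖ = ‖m‖) : ∃ g : UGroup k, P = clm g := by
  let P' : CSpace k →L[ℂ] CSpace k :=
    { toFun := P
      map_add' := fun _ _ => map_add _ _ _
      map_smul' := fun c m => by
        have h : ∀ m : CSpace k, c • m = c.re • m + c.im • (Complex.I • m) := by
          intro m
          conv_lhs => rw [← Complex.re_add_im c]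
          rw [add_smul, mul_smul, ← Complex.coe_smul, ← Complex.coe_smul]
        rw [RingHom.id_apply, h, h, map_add, P.map_smul_of_tower, P.map_smul_of_tower, hI]
      cont := P.continuous }
  have h1 : star P' * P' = 1 := (ContinuousLinearMap.norm_map_iff_adjoint_comp_self P').1 hn
  refine ⟨⟨(Matrix.toEuclideanCLM (𝕜 := ℂ)).symm P', ?_⟩, ?_⟩
  · rw [Matrix.mem_unitaryGroup_iff']
    apply EquivLike.injective (Matrix.toEuclideanCLM (n := Fin k) (𝕜 := ℂ))
    rw [map_mul, map_star, StarAlgEquiv.apply_symm_apply, h1, map_one]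
  · ext1 m
    change P' m = Matrix.toEuclideanCLM (𝕜 := ℂ) ((Matrix.toEuclideanCLM (𝕜 := ℂ)).symm P') m
    rw [StarAlgEquiv.apply_symm_apply]

end UGroup

/-- A choice of representatives for conjugacy classes of subgroups. -/
theorem exists_conjugacy_representative (G : Type*) [Group G] :
    ∃ rep : Subgroup G → Subgroup G,
      (∀ S, ∃ c : G, rep S = S.map (MulAut.conj c).toMonoidHom) ∧
      ∀ S c, rep (S.map (MulAut.conj c).toMonoidHom) = rep S := by
  let s : Setoid (Subgroup G) :=
    { r := fun S S' => ∃ c : G, S' = S.map (MulAut.conj c).toMonoidHom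
      iseqv :=
        { refl := fun S => ⟨1, by
            ext g
            simp [Subgroup.mem_map]⟩
          symm := by
            rintro S _ ⟨c, rfl⟩
            refine ⟨c⁻¹, ?_⟩
            ext g
            simp [Subgroup.mem_map, mul_assoc]
          trans := by
            rintro S _ _ ⟨c, rfl⟩ ⟨c', rfl⟩
            refine ⟨c' * c, ?_⟩
            ext g
            simp [Subgroup.mem_map, mul_assoc] } }
  refine ⟨fun S => (Quotient.mk s S).out, fun S => ?_, fun S c => ?_⟩
  · exact s.symm (Quotient.exact (Quotient.out_eq (Quotient.mk s S)))
  · exact congrArg Quotient.out (Quotient.sound (s := s) (s.symm ⟨c, rfl⟩))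

/-- Polarization: the metric `q` is known by its values on single vectors, whereas `IsPolar` asks
for invariance of the bilinear form. -/
theorem LinearMap.map_map_of_forall_self {V : Type*} [AddCommGroup V] [Module ℝ V]
    {g : V →ₗ[ℝ] V →ₗ[ℝ] ℝ} (hs : ∀ u v, g u v = g v u) {T : V →ₗ[ℝ] V}
    (h : ∀ v, g (T v) (T v) = g v v) (u v : V) : g (T u) (T v) = g u v := by
  have h1 := h (u + v)
  simp only [map_add, LinearMap.add_apply] at h1
  have h2 := h u
  have h3 := h v
  rw [hs (T v), hs v] at h1
  linarith

/-! ### Unitary frames and their transition maps. -/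

namespace OrbifoldAtlas

variable {E : Type uE} [NormedAddCommGroup E] [NormedSpace ℝ E] [CompleteSpace E]
  {X : Type uX} [TopologicalSpace X] {A : OrbifoldAtlas.{uE, uX, uI, uG} E X}
  {σ : A.SymplecticForm} {D : Set X} {d k : ℕ}

namespace Frame

variable [Nonempty (σ.NormalBundle D)]

/-- `q` is the square of a smooth fibre norm on the normal bundle. -/
structure IsMetric (d k : ℕ) (q : σ.NormalBundle D → ℝ) : Prop where
  quadraticAt : ∀ (t : Frame σ D d k), ∀ x ∈ t.B, QuadraticAt q t x
  pos : ∀ (t : Frame σ D d k), ∀ x ∈ t.B, ∀ m, m ≠ 0 → 0 < q (t.Φ (x, m))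

/-- The frame is symplectic, and multiplication by `i` preserves the metric. -/
def IsUnitary (q : σ.NormalBundle D → ℝ) (t : Frame σ D d k) : Prop :=
  ∀ x ∈ t.B, (∀ m m', t.form x m m' = (inner ℂ m m' : ℂ).im) ∧
    ∀ m, q (t.Φ (x, Complex.I • m)) = q (t.Φ (x, m))

variable {q : σ.NormalBundle D → ℝ} {t s : Frame σ D d k} {x y : CSpace d}

theorem IsMetric.exists_form (hq : IsMetric d k q) (hx : x ∈ t.B) :
    ∃ g : CSpace k →ₗ[ℝ] CSpace k →ₗ[ℝ] ℝ, (∀ u v, g u v = g v u) ∧ (∀ v, v ≠ 0 → 0 < g v v) ∧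
      ∀ v, g v v = q (t.Φ (x, v)) := by
  obtain ⟨W, G, -, hxW, -, -, hG⟩ := hq.quadraticAt t x hx
  refine ⟨(G x).toLinearMap₁₂, (hG x hxW).1, fun v hv => ?_, fun v => ((hG x hxW).2 v).symm⟩
  have := hq.pos t x hx v hv
  rwa [(hG x hxW).2] at this

theorem isInvertible_of_form {P : CSpace k →L[ℝ] CSpace k} (hx : x ∈ t.B)
    (h : ∀ m m', s.form y (P m) (P m') = t.form x m m') : P.IsInvertible := by
  refine isInvertible_of_injective rfl ((injective_iff_map_eq_zero P).2 fun m hm => ?_)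
  refine form_nondegenerate hx fun m' => ?_
  rw [← h, hm, map_zero]
  rfl

theorem isInvertible_Γ (hx : x ∈ t.B) {γ : CSpace k →L[ℝ] CSpace k} (hγ : γ ∈ t.Γ) :
    γ.IsInvertible :=
  isInvertible_of_form hx (form_Γ hx hγ)

theorem im_inner_I (m : CSpace k) : (inner ℂ m (Complex.I • m) : ℂ).im = ‖m‖ ^ 2 := by
  rw [inner_smul_right, Complex.I_mul_im]
  exact inner_self_eq_norm_sq (𝕜 := ℂ) m

/-- Transition maps between unitary frames are unitary. -/
theorem IsUnitary.exists_eq_clm (hq : IsMetric d k q) (ht : IsUnitary q t) (hs : IsUnitary q s)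
    (hx : x ∈ t.B) (hy : y ∈ s.B) {P : CSpace k →L[ℝ] CSpace k}
    (hP : ∀ m m', s.form y (P m) (P m') = t.form x m m')
    (hΦ : ∀ m, t.Φ (x, m) = s.Φ (y, P m)) : ∃ g : UGroup k, P = UGroup.clm g := by
  have hPi := isInvertible_of_form hx hP
  obtain ⟨g, hgs, hgp, hg⟩ := hq.exists_form hx
  let ω' : CSpace k →ₗ[ℝ] CSpace k →ₗ[ℝ] ℝ := (t.form x).toLinearMap₁₂
  have hω : ∀ u v, ω' u v = (inner ℂ u v : ℂ).im := (ht x hx).1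
  have hPim : ∀ u v, (inner ℂ (P u) (P v) : ℂ).im = (inner ℂ u v : ℂ).im := by
    intro u v
    rw [← (hs y hy).1, hP, (ht x hx).1]
  have im_I_I : ∀ u v : CSpace k, (inner ℂ (Complex.I • u) (Complex.I • v) : ℂ).im =
      (inner ℂ u v : ℂ).im := by
    intro u v
    rw [inner_smul_left, inner_smul_right, ← mul_assoc]
    simp
  have h1 : IsPolar g ω' (mulI k : CSpace k →ₗ[ℝ] CSpace k) :=
    { sq := mulI_mulI
      inner_map := LinearMap.map_map_of_forall_self hgs fun v => by
        rw [hg, hg]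
        exact (ht x hx).2 v
      form_map := fun u v => by
        rw [hω, hω]
        exact im_I_I u v
      pos := fun v hv => by
        rw [hω]
        refine (pow_pos (norm_pos_iff.2 hv) 2).trans_eq (im_inner_I v).symm }
  -- `P` carries the metric and the form of one frame to those of the other, and i is polar in both
  -- frames. So P⁻¹ i P is polar in the first one and equals i by uniqueness. A complex linear `P`
  -- that preserves the imaginary part of the Hermitian form preserves norms, as the imaginary part
  -- of ⟨m, im⟩ is the square of the norm of m.
  have h2 : IsPolar g ω' (P.inverse.comp ((mulI k).comp P) : CSpace k →L[ℝ] CSpace k) :=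
    { sq := fun v => by
        simp only [ContinuousLinearMap.coe_coe, ContinuousLinearMap.comp_apply]
        rw [hPi.self_apply_inverse, mulI_mulI, map_neg, hPi.inverse_apply_self]
      inner_map := LinearMap.map_map_of_forall_self hgs fun v => by
        rw [hg, hg, hΦ, hΦ]
        simp only [ContinuousLinearMap.coe_coe, ContinuousLinearMap.comp_apply]
        rw [hPi.self_apply_inverse]
        exact (hs y hy).2 _
      form_map := fun u v => by
        simp only [ContinuousLinearMap.coe_coe, ContinuousLinearMap.comp_apply]
        rw [hω, hω, ← hPim, hPi.self_apply_inverse, hPi.self_apply_inverse, ← hPim u]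
        exact im_I_I _ _
      pos := fun v hv => by
        simp only [ContinuousLinearMap.coe_coe, ContinuousLinearMap.comp_apply]
        rw [hω, ← hPim, hPi.self_apply_inverse]
        refine (pow_pos (norm_pos_iff.2 fun h0 => hv ?_) 2).trans_eq (im_inner_I _).symm
        exact hPi.injective (h0.trans (map_zero P).symm) }
  have hJ := h1.unique hgs hgp (fun _ _ => σ.bil_swap _ _ _ _)
    (fun u hu => form_nondegenerate hx hu) h2
  have hI : ∀ m, P (Complex.I • m) = Complex.I • P m := by
    intro m
    have h3 : Complex.I • m = P.inverse (Complex.I • P m) :=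
      congrArg (fun S : CSpace k →ₗ[ℝ] CSpace k => S m) hJ
    rw [h3, hPi.self_apply_inverse]
  refine UGroup.exists_eq_clm hI fun m => ?_
  have h4 : ‖P m‖ ^ 2 = ‖m‖ ^ 2 := by
    rw [← im_inner_I, ← hI, hPim, im_inner_I]
  exact (sq_eq_sq₀ (norm_nonneg _) (norm_nonneg _)).1 h4

theorem IsUnitary.exists_eq_clm_of_mem_Γ (hq : IsMetric d k q) (ht : IsUnitary q t) (hx : x ∈ t.B)
    {γ : CSpace k →L[ℝ] CSpace k} (hγ : γ ∈ t.Γ) : ∃ g : UGroup k, γ = UGroup.clm g :=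
  ht.exists_eq_clm hq ht hx hx (form_Γ hx hγ) fun m =>
    (Φ_eq_iff hx hx m (γ m)).2 ⟨rfl, γ, hγ, rfl⟩

/-- The group of a unitary frame is a subgroup of `U(k)`. -/
theorem IsUnitary.exists_subgroup (hq : IsMetric d k q) (ht : IsUnitary q t) (hx : x ∈ t.B) :
    ∃ S : Subgroup (UGroup k), ∀ γ, γ ∈ t.Γ ↔ ∃ g ∈ S, γ = UGroup.clm g := by
  refine ⟨{ carrier := {g | UGroup.clm g ∈ t.Γ}
            mul_mem' := fun {g h} hg hh => ?_
            one_mem' := ?_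
            inv_mem' := fun {g} hg => ?_ }, fun γ => ⟨fun hγ => ?_, ?_⟩⟩
  · change UGroup.clm (g * h) ∈ t.Γ
    rw [UGroup.clm_mul]
    exact mul_mem_Γ hx hg hh
  · have h1 : UGroup.clm (1 : UGroup k) = ContinuousLinearMap.id ℝ (CSpace k) := by
      ext1 m
      exact UGroup.one_apply m
    change UGroup.clm 1 ∈ t.Γ
    rw [h1]
    exact one_mem_Γ hx
  · obtain ⟨γ', hγ', h1, h2⟩ := inv_mem_Γ hx hg
    have h3 : UGroup.clm g⁻¹ = γ' := by
      ext1 m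
      have := congrArg (g⁻¹).apply (h2 m)
      rw [UGroup.clm_apply, UGroup.inv_apply_apply] at this
      exact this.symm
    change UGroup.clm g⁻¹ ∈ t.Γ
    rwa [h3]
  · obtain ⟨g, rfl⟩ := ht.exists_eq_clm_of_mem_Γ hq hx hγ
    exact ⟨g, hγ, rfl⟩
  · rintro ⟨g, hg, rfl⟩
    exact hg

/-- Unitary frames exist. -/
theorem exists_isUnitary (hq : IsMetric d k q) (hx : x ∈ t.B) :
    ∃ s : Frame σ D d k, IsUnitary q s ∧ x ∈ s.B ∧ s.b x = t.b x := by
  obtain ⟨W, G, hW, hxW, hWt, hGs, hG⟩ := hq.quadraticAt t x hx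
  obtain ⟨W', T, hW', hxW', hWW', hTs, hT⟩ := exists_unitary_gauge hW hxW hGs
    ((form_smooth).mono hWt) (fun z hz => (hG z hz).1)
    (fun z hz m hm => by
      rw [← (hG z hz).2]
      exact hq.pos t z (hWt hz) m hm)
    (fun z hz u v => σ.bil_swap _ _ _ _)
    (fun z hz u hu => form_nondegenerate (hWt hz) hu) (finite_Γ hx)
    (fun γ hγ => isInvertible_Γ hx hγ)
    (fun γ hγ z hz => LinearMap.map_map_of_forall_self (g := (G z).toLinearMap₁₂)
      (T := (γ : CSpace k →ₗ[ℝ] CSpace k)) (hG z hz).1 fun m => by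
        change G z (γ m) (γ m) = G z m m
        rw [← (hG z hz).2, ← (hG z hz).2]
        exact congrArg q ((Φ_eq_iff (hWt hz) (hWt hz) m (γ m)).2 ⟨rfl, γ, hγ, rfl⟩).symm)
    (fun γ hγ z hz => form_Γ (hWt hz) hγ)
  have hTi : ∀ z ∈ W', (T z).IsInvertible := fun z hz => (hT z hz).1
  -- The new group is defined by the gauge at `x`. The last clause of `exists_unitary_gauge` says
  -- that the gauge at any other point `z` conjugates the old group to the same set.
  refine ⟨t.modify W' hW' (hWW'.trans hWt) T hTs hTi
    {γ' | ∃ γ ∈ t.Γ, ∀ m, γ (T x m) = T x (γ' m)} fun z hz γ' => ?_, fun z hz => ⟨?_, fun m => ?_⟩,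
    hxW', rfl⟩
  · refine exists_congr fun γ => and_congr_right fun hγ => forall_congr' fun m => ?_
    have h1 := (hT z hz).2.2.2 γ hγ m
    constructor
    · intro h
      rw [h, (hTi x hxW').inverse_apply_self] at h1
      rw [← h1, (hTi z hz).self_apply_inverse]
    · intro h
      rw [h, (hTi z hz).inverse_apply_self] at h1
      rw [h1, (hTi x hxW').self_apply_inverse]
  · exact (hT z hz).2.1
  · rw [modify_Φ, modify_Φ, (hG z (hWW' hz)).2, (hG z (hWW' hz)).2]
    exact (hT z hz).2.2.1 m

end Frame

end OrbifoldAtlas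

/-- A pointwise choice from a finite set of linear maps can be made uniformly. -/
theorem Set.Finite.exists_forall_apply_eq {V V' V'' : Type*} [NormedAddCommGroup V]
    [NormedSpace ℝ V] [NormedAddCommGroup V'] [NormedSpace ℝ V'] [NormedAddCommGroup V'']
    [NormedSpace ℝ V''] {Γ : Set (V' →L[ℝ] V'')} (hΓ : Γ.Finite) {Q : V →L[ℝ] V''}
    {R : V →L[ℝ] V'} (h : ∀ m, ∃ γ ∈ Γ, Q m = γ (R m)) : ∃ γ ∈ Γ, ∀ m, Q m = γ (R m) := by
  have := hΓ.to_subtype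
  obtain ⟨γ, hγ⟩ := Subspace.exists_eq_top_of_iUnion_eq_univ
    (p := fun γ : Γ => LinearMap.ker ((Q - γ.1.comp R : V →L[ℝ] V'') : V →ₗ[ℝ] V'')) (by
      refine eq_univ_of_forall fun m => mem_iUnion.2 ?_
      obtain ⟨γ, hγ, hm⟩ := h m
      exact ⟨⟨γ, hγ⟩, sub_eq_zero.2 hm⟩)
  refine ⟨γ, γ.2, fun m => sub_eq_zero.1 ?_⟩
  have : m ∈ LinearMap.ker ((Q - γ.1.comp R : V →L[ℝ] V'') : V →ₗ[ℝ] V'') := by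
    rw [hγ]
    trivial
  exact this

/-! ### How transition maps conjugate the groups of frames. -/

namespace OrbifoldAtlas

variable {E : Type uE} [NormedAddCommGroup E] [NormedSpace ℝ E] [CompleteSpace E]
  {X : Type uX} [TopologicalSpace X] {A : OrbifoldAtlas.{uE, uX, uI, uG} E X}
  {σ : A.SymplecticForm} {D : Set X} {d k : ℕ}

namespace Frame

variable [Nonempty (σ.NormalBundle D)] {q : σ.NormalBundle D → ℝ} {t s : Frame σ D d k}
  {x y : CSpace d}

/-- Transition maps conjugate the groups of the frames. -/
theorem exists_conj_mem_Γ (hx : x ∈ t.B) (hy : y ∈ s.B) {P : CSpace k →L[ℝ] CSpace k}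
    (hΦ : ∀ m, t.Φ (x, m) = s.Φ (y, P m)) {γ : CSpace k →L[ℝ] CSpace k} (hγ : γ ∈ t.Γ) :
    ∃ γ' ∈ s.Γ, ∀ m, P (γ m) = γ' (P m) := by
  -- Equality in the normal bundle yields an element of the second group for each vector separately;
  -- finiteness makes the choice uniform.
  refine (finite_Γ hy).exists_forall_apply_eq (Q := P.comp γ) (R := P) fun m => ?_
  have h := (Φ_eq_iff hx hx m (γ m)).2 ⟨rfl, γ, hγ, rfl⟩
  rw [hΦ, hΦ] at h
  obtain ⟨-, γ', hγ', h'⟩ := (Φ_eq_iff hy hy _ _).1 h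
  exact ⟨γ', hγ', h'.symm⟩

theorem exists_conj_mem_Γ' (hx : x ∈ t.B) (hy : y ∈ s.B) {P : CSpace k →L[ℝ] CSpace k}
    (hPi : P.IsInvertible) (hΦ : ∀ m, t.Φ (x, m) = s.Φ (y, P m))
    {γ' : CSpace k →L[ℝ] CSpace k} (hγ' : γ' ∈ s.Γ) :
    ∃ γ ∈ t.Γ, ∀ m, P (γ m) = γ' (P m) := by
  obtain ⟨γ, hγ, h⟩ := exists_conj_mem_Γ hy hx (P := P.inverse)
    (fun m => by rw [hΦ, hPi.self_apply_inverse]) hγ'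
  refine ⟨γ, hγ, fun m => ?_⟩
  have := h (P m)
  rw [hPi.inverse_apply_self] at this
  rw [← this, hPi.self_apply_inverse]

theorem map_conj_eq {S S' : Subgroup (UGroup k)} (hS : ∀ γ, γ ∈ t.Γ ↔ ∃ g ∈ S, γ = UGroup.clm g)
    (hS' : ∀ γ, γ ∈ s.Γ ↔ ∃ g ∈ S', γ = UGroup.clm g) (hx : x ∈ t.B) (hy : y ∈ s.B)
    {p : UGroup k} (hΦ : ∀ m, t.Φ (x, m) = s.Φ (y, p.apply m)) :
    S' = S.map (MulAut.conj p).toMonoidHom := by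
  have hpi : (UGroup.clm p).IsInvertible := by
    refine isInvertible_of_injective rfl fun m m' h => ?_
    have := congrArg (p⁻¹).apply h
    rwa [UGroup.clm_apply, UGroup.clm_apply, UGroup.inv_apply_apply,
      UGroup.inv_apply_apply] at this
  ext g'
  rw [Subgroup.mem_map]
  constructor
  · intro hg'
    obtain ⟨γ, hγ, h⟩ := exists_conj_mem_Γ' (P := UGroup.clm p) hx hy hpi hΦ
      ((hS' _).2 ⟨g', hg', rfl⟩)
    obtain ⟨g, hg, rfl⟩ := (hS γ).1 hγ
    refine ⟨g, hg, UGroup.ext_apply fun m => ?_⟩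
    have := h ((p⁻¹).apply m)
    simp only [UGroup.clm_apply, UGroup.apply_inv_apply] at this
    change (p * g * p⁻¹).apply m = g'.apply m
    rw [UGroup.mul_apply, UGroup.mul_apply, this]
  · rintro ⟨g, hg, rfl⟩
    obtain ⟨γ', hγ', h⟩ := exists_conj_mem_Γ (P := UGroup.clm p) hx hy hΦ ((hS _).2 ⟨g, hg, rfl⟩)
    obtain ⟨g', hg', rfl⟩ := (hS' γ').1 hγ'
    have : p * g * p⁻¹ = g' := by
      refine UGroup.ext_apply fun m => ?_
      have := h ((p⁻¹).apply m)
      simp only [UGroup.clm_apply, UGroup.apply_inv_apply] at this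
      rw [UGroup.mul_apply, UGroup.mul_apply, this]
    change p * g * p⁻¹ ∈ S'
    rwa [this]

/-- A unitary frame restricted to a small ball, with the gauge changed by a constant unitary
map. -/
theorem IsUnitary.exists_modify (ht : IsUnitary q t) {S : Subgroup (UGroup k)}
    (hS : ∀ γ, γ ∈ t.Γ ↔ ∃ g ∈ S, γ = UGroup.clm g) (c : UGroup k) (hx : x ∈ t.B)
    {W : Set (CSpace d)} (hW : W ∈ 𝓝 x) :
    ∃ s : Frame σ D d k, IsConnected s.B ∧ x ∈ s.B ∧ s.B ⊆ W ∩ t.B ∧ IsUnitary q s ∧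
      (∀ γ, γ ∈ s.Γ ↔ ∃ g ∈ S.map (MulAut.conj c).toMonoidHom, γ = UGroup.clm g) ∧
      s.b = t.b ∧ ∀ z m, s.Φ (z, m) = t.Φ (z, (c⁻¹).apply m) := by
  obtain ⟨ε, hε, hεW⟩ := Metric.mem_nhds_iff.1 (inter_mem hW (t.isOpen_B.mem_nhds hx))
  have hci : (UGroup.clm c⁻¹).IsInvertible := by
    refine isInvertible_of_injective rfl fun m m' h => ?_
    have := congrArg c.apply h
    rwa [UGroup.clm_apply, UGroup.clm_apply, UGroup.apply_inv_apply,
      UGroup.apply_inv_apply] at this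
  refine ⟨t.modify (Metric.ball x ε) Metric.isOpen_ball (hεW.trans inter_subset_right)
    (fun _ => UGroup.clm c⁻¹) contDiffOn_const (fun _ _ => hci)
    (UGroup.clm '' (S.map (MulAut.conj c).toMonoidHom : Set (UGroup k))) (fun z hz γ' => ?_),
    ?_, Metric.mem_ball_self hε, hεW, fun z hz => ⟨fun m m' => ?_, fun m => ?_⟩, fun γ => ?_, rfl,
    fun z m => rfl⟩
  · constructor
    · rintro ⟨_, ⟨g, hg, rfl⟩, rfl⟩
      refine ⟨_, (hS _).2 ⟨g, hg, rfl⟩, fun m => ?_⟩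
      change g.apply ((c⁻¹).apply m) = (c⁻¹).apply ((c * g * c⁻¹).apply m)
      rw [UGroup.mul_apply, UGroup.mul_apply, UGroup.inv_apply_apply]
    · rintro ⟨γ, hγ, h⟩
      obtain ⟨g, hg, rfl⟩ := (hS γ).1 hγ
      refine ⟨c * g * c⁻¹, ⟨g, hg, rfl⟩, ?_⟩
      ext1 m
      have := congrArg c.apply (h m)
      simp only [UGroup.clm_apply, UGroup.apply_inv_apply] at this
      rw [UGroup.clm_apply, UGroup.mul_apply, UGroup.mul_apply, this]
  · exact ⟨⟨x, Metric.mem_ball_self hε⟩, (convex_ball x ε).isPreconnected⟩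
  · rw [modify_form, (ht z (hεW hz).2).1]
    exact congrArg Complex.im (UGroup.inner_apply_apply c⁻¹ m m')
  · rw [modify_Φ, modify_Φ]
    change q (t.Φ (z, (c⁻¹).apply (Complex.I • m))) = _
    rw [UGroup.apply_smul]
    exact (ht z (hεW hz).2).2 _
  · exact exists_congr fun g => and_congr_right fun _ => eq_comm

end Frame

end OrbifoldAtlas

/-! ### The orbifold atlas of unitary frames. -/

namespace OrbifoldAtlas

variable {E : Type uE} [NormedAddCommGroup E] [NormedSpace ℝ E] [CompleteSpace E]
  {X : Type uX} [TopologicalSpace X] {A : OrbifoldAtlas.{uE, uX, uI, uG} E X}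
  {σ : A.SymplecticForm} {D : Set X} {d k : ℕ} [Nonempty (σ.NormalBundle D)]

/-- A unitary frame over a connected domain, whose group is the chosen representative of its
conjugacy class. -/
structure BundleFrame (q : σ.NormalBundle D → ℝ)
    (rep : Subgroup (UGroup k) → Subgroup (UGroup k)) (d : ℕ) where
  t : Frame σ D d k
  S : Subgroup (UGroup k)
  isConnected_B : IsConnected t.B
  isUnitary : t.IsUnitary q
  mem_Γ_iff : ∀ γ, γ ∈ t.Γ ↔ ∃ g ∈ S, γ = UGroup.clm g
  rep_eq : rep S = S

namespace BundleFrame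

variable {q : σ.NormalBundle D → ℝ} {rep : Subgroup (UGroup k) → Subgroup (UGroup k)}

theorem finite_S (a : BundleFrame q rep d) : Finite a.S := by
  obtain ⟨x, hx⟩ := a.isConnected_B.nonempty
  have : Finite a.t.Γ := Frame.finite_Γ hx
  exact Finite.of_injective
    (fun g : a.S => (⟨UGroup.clm g.1, (a.mem_Γ_iff _).2 ⟨g.1, g.2, rfl⟩⟩ : a.t.Γ))
    fun g h hgh => Subtype.ext (UGroup.clm_injective (congrArg Subtype.val hgh))

/-- The orbifold chart of the normal bundle given by a unitary frame. -/
noncomputable def chart (a : BundleFrame q rep d) :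
    OrbifoldChart.{0, max uE uI, 0} (CSpace d × CSpace k) (σ.NormalBundle D) where
  U := a.t.B ×ˢ univ
  isOpen_U := a.t.isOpen_B.prod isOpen_univ
  isConnected_U := a.isConnected_B.prod isConnected_univ
  G := a.S
  group := inferInstance
  finite := a.finite_S
  act g p := (p.1, (g : UGroup k).apply p.2)
  act_mapsTo _ _ hp := ⟨hp.1, trivial⟩
  act_one p _ := Prod.ext rfl (UGroup.one_apply p.2)
  act_mul g h p _ := Prod.ext rfl (UGroup.mul_apply g.1 h.1 p.2)
  act_smooth g := by
    have h : ContDiff ℝ ∞ fun p : CSpace d × CSpace k => (p.1, UGroup.clm g.1 p.2) :=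
      contDiff_fst.prodMk (contDiff_const.clm_apply contDiff_snd)
    exact h.contDiffOn
  act_faithful g hg := by
    obtain ⟨x, hx⟩ := a.isConnected_B.nonempty
    refine Subtype.ext (UGroup.ext_apply fun m => ?_)
    exact (Prod.ext_iff.1 (hg (x, m) ⟨hx, trivial⟩)).2.trans (UGroup.one_apply m).symm
  φ := a.t.Φ
  φ_continuousOn := Frame.continuousOn_Φ
  φ_open _ hWU hW := Frame.isOpen_image_Φ hW hWU
  φ_eq_iff := by
    rintro ⟨x, m⟩ ⟨hx, -⟩ ⟨y, m'⟩ ⟨hy, -⟩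
    rw [Frame.Φ_eq_iff hx hy]
    constructor
    · rintro ⟨rfl, γ, hγ, rfl⟩
      obtain ⟨g, hg, rfl⟩ := (a.mem_Γ_iff γ).1 hγ
      exact ⟨⟨g, hg⟩, rfl⟩
    · rintro ⟨g, hg⟩
      exact ⟨(Prod.ext_iff.1 hg).1, UGroup.clm g.1, (a.mem_Γ_iff _).2 ⟨g.1, g.2, rfl⟩,
        (Prod.ext_iff.1 hg).2⟩

theorem mem_chart_V {a : BundleFrame q rep d} {x : CSpace d} (hx : x ∈ a.t.B) (m : CSpace k) :
    a.t.Φ (x, m) ∈ a.chart.V := ⟨(x, m), ⟨hx, trivial⟩, rfl⟩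

/-- Transition functions give embeddings of charts. -/
theorem isEmbedding_of_transition (hq : Frame.IsMetric d k q) {δ b : BundleFrame q rep d}
    {ψ ψ' : CSpace d → CSpace d} {P : CSpace d → CSpace k →L[ℝ] CSpace k} {W' : Set (CSpace d)}
    (hψ : ContDiffOn ℝ ∞ ψ δ.t.B) (hP : ContDiffOn ℝ ∞ P δ.t.B) (hW' : IsOpen W')
    (hψ' : ContDiffOn ℝ ∞ ψ' W')
    (h : ∀ z ∈ δ.t.B, ψ z ∈ b.t.B ∧ ψ z ∈ W' ∧ ψ' (ψ z) = z ∧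
      (∀ m m', b.t.form (ψ z) (P z m) (P z m') = δ.t.form z m m') ∧
      ∀ m, δ.t.Φ (z, m) = b.t.Φ (ψ z, P z m))
    (h' : ∀ y ∈ W', ψ' y ∈ δ.t.B → ψ (ψ' y) = y) :
    δ.chart.IsEmbedding b.chart fun p => (ψ p.1, P p.1 p.2) := by
  have hPi : ∀ z ∈ δ.t.B, (P z).IsInvertible := fun z hz =>
    Frame.isInvertible_of_form hz (h z hz).2.2.2.1
  have hPi' : ContDiffOn ℝ ∞ (fun z => (P z).inverse) δ.t.B := hP.clm_inverse hPi
  have himg : (fun p : CSpace d × CSpace k => (ψ p.1, P p.1 p.2)) '' (δ.t.B ×ˢ univ) =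
      (W' ∩ ψ' ⁻¹' δ.t.B) ×ˢ univ := by
    ext ⟨y, m⟩
    constructor
    · rintro ⟨⟨z, m⟩, ⟨hz, -⟩, he⟩
      obtain ⟨rfl, rfl⟩ := Prod.ext_iff.1 he
      obtain ⟨-, h1, h2, -⟩ := h z hz
      exact ⟨⟨h1, by rwa [mem_preimage, h2]⟩, trivial⟩
    · rintro ⟨⟨hy, hyB⟩, -⟩
      refine ⟨(ψ' y, (P (ψ' y)).inverse m), ⟨hyB, trivial⟩, Prod.ext (h' y hy hyB) ?_⟩
      exact (hPi _ hyB).self_apply_inverse _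
  obtain ⟨z₀, hz₀⟩ := δ.isConnected_B.nonempty
  obtain ⟨p, hp⟩ := δ.isUnitary.exists_eq_clm hq b.isUnitary hz₀ (h z₀ hz₀).1
    (h z₀ hz₀).2.2.2.1 (h z₀ hz₀).2.2.2.2
  have hconj := Frame.map_conj_eq δ.mem_Γ_iff b.mem_Γ_iff hz₀ (h z₀ hz₀).1 (p := p) fun m => by
    rw [(h z₀ hz₀).2.2.2.2, hp]
    rfl
  have hρ : ∀ g : δ.S, MulAut.conj p (g : UGroup k) ∈ b.S := fun g => by
    rw [hconj]
    exact ⟨g, g.2, rfl⟩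
  -- The conjugate of `g` by `P z` depends continuously on `z` and takes values in a finite set, so
  -- it is constant on the connected base. Hence conjugation by the value of `P` at `z₀` serves as
  -- the group homomorphism of the whole chart.
  have heq : ∀ g : δ.S, ∀ z ∈ δ.t.B, ∀ m,
      P z ((g : UGroup k).apply m) = (MulAut.conj p (g : UGroup k)).apply (P z m) := by
    intro g z hz m
    have hf : ContinuousOn (fun z => (P z).comp ((UGroup.clm g.1).comp (P z).inverse)) δ.t.B :=
      (hP.clm_comp (contDiffOn_const.clm_comp hPi')).continuousOn
    have hm : MapsTo (fun z => (P z).comp ((UGroup.clm g.1).comp (P z).inverse)) δ.t.B b.t.Γ := by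
      intro z hz
      obtain ⟨γ', hγ', hγ⟩ := Frame.exists_conj_mem_Γ hz (h z hz).1 (h z hz).2.2.2.2
        ((δ.mem_Γ_iff _).2 ⟨g.1, g.2, rfl⟩)
      convert hγ' using 1
      ext1 m
      simp only [ContinuousLinearMap.comp_apply]
      rw [hγ, (hPi z hz).self_apply_inverse]
    have hc := δ.isConnected_B.isPreconnected.constant_of_mapsTo
      (Frame.finite_Γ (h z hz).1).isDiscrete hf hm hz hz₀
    have hc' := congrArg (fun S : CSpace k →L[ℝ] CSpace k => S (P z m)) hc
    simp only [ContinuousLinearMap.comp_apply] at hc'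
    rw [(hPi z hz).inverse_apply_self] at hc'
    refine hc'.trans ?_
    have hinv : (P z₀).inverse (P z m) = (p⁻¹).apply (P z m) := by
      apply (hPi z₀ hz₀).injective
      rw [(hPi z₀ hz₀).self_apply_inverse, hp, UGroup.clm_apply, UGroup.apply_inv_apply]
    change _ = (p * g.1 * p⁻¹).apply (P z m)
    rw [hinv, hp, UGroup.clm_apply, UGroup.clm_apply, UGroup.mul_apply, UGroup.mul_apply]
  refine ⟨fun z hz => ⟨(h z.1 hz.1).1, trivial⟩, ?_, ?_, ?_, fun z hz => ?_, ?_⟩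
  · have h1 : ContDiffOn ℝ ∞ (fun p : CSpace d × CSpace k => ψ p.1) (δ.t.B ×ˢ univ) :=
      hψ.comp contDiff_fst.contDiffOn fun p hp => hp.1
    have h2 : ContDiffOn ℝ ∞ (fun p : CSpace d × CSpace k => P p.1) (δ.t.B ×ˢ univ) :=
      hP.comp contDiff_fst.contDiffOn fun p hp => hp.1
    exact h1.prodMk (h2.clm_apply contDiff_snd.contDiffOn)
  · change IsOpen (_ '' (δ.t.B ×ˢ univ))
    rw [himg]
    exact (hψ'.continuousOn.isOpen_inter_preimage hW' δ.t.isOpen_B).prod isOpen_univ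
  · refine ⟨fun p => (ψ' p.1, (P (ψ' p.1)).inverse p.2), ?_, ?_⟩
    · change ContDiffOn ℝ ∞ _ (_ '' (δ.t.B ×ˢ univ))
      rw [himg]
      have h1 : ContDiffOn ℝ ∞ (fun p : CSpace d × CSpace k => ψ' p.1)
          ((W' ∩ ψ' ⁻¹' δ.t.B) ×ˢ univ) :=
        hψ'.comp contDiff_fst.contDiffOn fun p hp => hp.1.1
      have h2 : ContDiffOn ℝ ∞ (fun p : CSpace d × CSpace k => (P (ψ' p.1)).inverse)
          ((W' ∩ ψ' ⁻¹' δ.t.B) ×ˢ univ) :=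
        hPi'.comp h1 fun p hp => hp.1.2
      exact h1.prodMk (h2.clm_apply contDiff_snd.contDiffOn)
    · rintro ⟨z, m⟩ ⟨hz, -⟩
      simp only [(h z hz).2.2.1]
      rw [(hPi z hz).inverse_apply_self]
  · exact ((h z.1 hz.1).2.2.2.2 z.2).symm
  · refine ⟨((MulAut.conj p).toMonoidHom.comp δ.S.subtype).codRestrict b.S hρ, fun g g' hg => ?_,
      fun g z hz => Prod.ext rfl (heq g z.1 hz.1 z.2)⟩
    exact Subtype.ext ((MulAut.conj p).injective (congrArg Subtype.val hg))

/-- The inclusion of a restricted frame. -/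
theorem exists_restrict (hq : Frame.IsMetric d k q) (a : BundleFrame q rep d) {x : CSpace d}
    (hx : x ∈ a.t.B) {W : Set (CSpace d)} (hW : W ∈ 𝓝 x) :
    ∃ δ : BundleFrame q rep d, x ∈ δ.t.B ∧ δ.t.B ⊆ W ∩ a.t.B ∧ δ.t.b = a.t.b ∧
      (∀ z m, δ.t.Φ (z, m) = a.t.Φ (z, m)) ∧ δ.chart.IsEmbedding a.chart id := by
  obtain ⟨s, hs1, hs2, hs3, hs4, hs5, hs6, hs7⟩ := a.isUnitary.exists_modify a.mem_Γ_iff 1 hx hW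
  have hS : a.S.map (MulAut.conj (1 : UGroup k)).toMonoidHom = a.S := by
    ext g
    simp [Subgroup.mem_map]
  rw [hS] at hs5
  have hΦ : ∀ z m, s.Φ (z, m) = a.t.Φ (z, m) := fun z m => by
    rw [hs7, inv_one, UGroup.one_apply]
  let δ : BundleFrame q rep d := ⟨s, a.S, hs1, hs4, hs5, a.rep_eq⟩
  refine ⟨δ, hs2, hs3, hs6, hΦ, ?_⟩
  exact isEmbedding_of_transition hq (δ := δ) (b := a) (ψ := id) (ψ' := id)
    (P := fun _ => ContinuousLinearMap.id ℝ (CSpace k)) (W' := s.B) contDiffOn_id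
    contDiffOn_const s.isOpen_B contDiffOn_id
    (fun z hz => ⟨(hs3 hz).2, hz, rfl, fun m m' =>
      ((a.isUnitary z (hs3 hz).2).1 m m').trans ((hs4 z hz).1 m m').symm, hΦ z⟩)
    fun y _ _ => rfl

/-- Two frames over a common point contain a common restriction. -/
theorem exists_common_restriction (hq : Frame.IsMetric d k q) (a b : BundleFrame q rep d)
    {x y : CSpace d} (hx : x ∈ a.t.B) (hy : y ∈ b.t.B) (hxy : a.t.b x = b.t.b y) :
    ∃ δ : BundleFrame q rep d, x ∈ δ.t.B ∧ δ.t.B ⊆ a.t.B ∧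
      (∀ z m, δ.t.Φ (z, m) = a.t.Φ (z, m)) ∧
      (∀ z ∈ δ.t.B, ∃ y ∈ b.t.B, ∀ m, ∃ m', δ.t.Φ (z, m) = b.t.Φ (y, m')) ∧
      δ.chart.IsEmbedding a.chart id ∧ ∃ f, δ.chart.IsEmbedding b.chart f := by
  obtain ⟨W, ψ, P, hW, hxW, hWt, hψs, hPs, hψ, h⟩ := Frame.exists_frame_transition hx hy hxy
  obtain ⟨W', ψ', P', hW', hyW', hWs, hψs', -, hψ', h'⟩ :=
    Frame.exists_frame_transition hy hx hxy.symm
  -- Where both transition maps are defined they are inverse to each other, because each preserves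
  -- the point of `D` and `b` is injective on the domain of a frame.
  have hN : W ∩ ψ ⁻¹' W' ∈ 𝓝 x :=
    (hψs.continuousOn.isOpen_inter_preimage hW hW').mem_nhds ⟨hxW, by rwa [mem_preimage, hψ]⟩
  obtain ⟨δ, hδx, hδ, -, hΦ, hemb⟩ := a.exists_restrict hq hx hN
  refine ⟨δ, hδx, fun z hz => (hδ hz).2, hΦ, fun z hz => ?_, hemb, _, isEmbedding_of_transition hq
    (hψs.mono fun z hz => (hδ hz).1.1) (hPs.mono fun z hz => (hδ hz).1.1) hW' hψs'
    (fun z hz => ?_) fun w hw hwδ => ?_⟩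
  · obtain ⟨h1, -, -, h4⟩ := h z (hδ hz).1.1
    exact ⟨ψ z, h1, fun m => ⟨P z m, by rw [hΦ, h4]⟩⟩
  · obtain ⟨⟨hzW, hzW'⟩, hza⟩ := hδ hz
    obtain ⟨h1, h2, h3, h4⟩ := h z hzW
    obtain ⟨h1', h2', -⟩ := h' (ψ z) hzW'
    refine ⟨h1, hzW', Frame.b_injOn h1' hza (by rw [h2', h2]), fun m m' => ?_, fun m => ?_⟩
    · rw [h3, (a.isUnitary z hza).1, (δ.isUnitary z hz).1]
    · rw [hΦ, h4]
  · obtain ⟨⟨hzW, hzW'⟩, hza⟩ := hδ hwδ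
    obtain ⟨h1, h2, -⟩ := h _ hzW
    obtain ⟨-, h2', -⟩ := h' w hw
    exact Frame.b_injOn h1 (hWs hw) (by rw [h2, h2'])

theorem exists_bundleFrame (hq : Frame.IsMetric d k q)
    (hrep : ∀ S, ∃ c : UGroup k, rep S = S.map (MulAut.conj c).toMonoidHom)
    (hrep' : ∀ S c, rep (S.map (MulAut.conj c).toMonoidHom) = rep S)
    {t : Frame σ D d k} {x : CSpace d} (hx : x ∈ t.B) :
    ∃ a : BundleFrame q rep d, x ∈ a.t.B ∧ a.t.b x = t.b x := by
  obtain ⟨s, hs, hxs, hst⟩ := Frame.exists_isUnitary hq hx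
  obtain ⟨S, hS⟩ := hs.exists_subgroup hq hxs
  obtain ⟨c, hc⟩ := hrep S
  obtain ⟨s', h1, h2, h3, h4, h5, h6, -⟩ := hs.exists_modify hS c hxs univ_mem
  exact ⟨⟨s', _, h1, h4, h5, by rw [hrep', hc]⟩, h2, by rw [h6, hst]⟩

/-- The orbifold atlas of the normal bundle given by the unitary frames. -/
noncomputable def atlas (hq : Frame.IsMetric d k q)
    (hcov : ∀ p ∈ D, ∃ a : BundleFrame q rep d, ∃ x ∈ a.t.B, a.t.b x = p) :
    OrbifoldAtlas.{0, max uE uI, max uE uI, 0} (CSpace d × CSpace k) (σ.NormalBundle D) where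
  Index := BundleFrame q rep d
  chart := chart
  cover p := by
    obtain ⟨a, x, hx, hxp⟩ := hcov _ (SymplecticForm.normalProj_mem p)
    obtain ⟨m, rfl⟩ := Frame.exists_Φ_eq hx hxp.symm
    exact ⟨a, mem_chart_V hx m⟩
  compat a b p := by
    rintro ⟨⟨⟨x, m⟩, ⟨hx, -⟩, rfl⟩, ⟨y, m'⟩, ⟨hy, -⟩, he⟩
    have hxy : a.t.b x = b.t.b y := by
      rw [← Frame.normalProj_Φ hx m, ← Frame.normalProj_Φ hy m']
      exact congrArg _ he.symm
    obtain ⟨δ, h1, h2, h3, h4, h5, h6⟩ := exists_common_restriction hq a b hx hy hxy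
    refine ⟨δ, ⟨(x, m), ⟨h1, trivial⟩, h3 x m⟩, ?_, ⟨_, h5⟩, h6⟩
    rintro _ ⟨⟨z, v⟩, ⟨hz, -⟩, rfl⟩
    refine ⟨⟨(z, v), ⟨h2 hz, trivial⟩, (h3 z v).symm⟩, ?_⟩
    obtain ⟨w, hw, h⟩ := h4 z hz
    obtain ⟨v', hv'⟩ := h v
    exact ⟨(w, v'), ⟨hw, trivial⟩, hv'.symm⟩

/-- Unitary frames over the same point have the same group. -/
theorem S_eq (hq : Frame.IsMetric d k q)
    (hrep' : ∀ S c, rep (S.map (MulAut.conj c).toMonoidHom) = rep S)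
    (a b : BundleFrame q rep d) {x y : CSpace d} (hx : x ∈ a.t.B) (hy : y ∈ b.t.B)
    (hxy : a.t.b x = b.t.b y) : a.S = b.S := by
  obtain ⟨W, ψ, P, -, hxW, -, -, -, hψ, h⟩ := Frame.exists_frame_transition hx hy hxy
  obtain ⟨-, -, h3, h4⟩ := h x hxW
  rw [hψ] at h3 h4
  obtain ⟨p, hp⟩ := a.isUnitary.exists_eq_clm hq b.isUnitary hx hy h3 h4
  have hconj := Frame.map_conj_eq a.mem_Γ_iff b.mem_Γ_iff hx hy (p := p) fun m => by
    rw [h4, hp]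
    rfl
  rw [← b.rep_eq, hconj, hrep', a.rep_eq]

/-- Unitary frames over the same connected part of `D` have the same group. -/
theorem S_eq_of_isPreconnected (hq : Frame.IsMetric d k q)
    (hrep' : ∀ S c, rep (S.map (MulAut.conj c).toMonoidHom) = rep S)
    (hcov : ∀ p ∈ D, ∃ a : BundleFrame q rep d, ∃ x ∈ a.t.B, a.t.b x = p)
    {C : Set X} (hC : IsPreconnected C) (hCD : C ⊆ D) (a b : BundleFrame q rep d)
    {x y : CSpace d} (hx : x ∈ a.t.B) (hy : y ∈ b.t.B) (hxC : a.t.b x ∈ C) (hyC : b.t.b y ∈ C) :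
    a.S = b.S := by
  have : Nonempty (BundleFrame q rep d) := ⟨a⟩
  choose! T z hz hzT using hcov
  have hS : ∀ (a : BundleFrame q rep d), ∀ x ∈ a.t.B, (T (a.t.b x)).S = a.S := fun a x hx =>
    S_eq hq hrep' _ _ (hz _ (Frame.b_mem hx)) hx (hzT _ (Frame.b_mem hx))
  let _ : TopologicalSpace (Subgroup (UGroup k)) := ⊥
  have : DiscreteTopology (Subgroup (UGroup k)) := ⟨rfl⟩
  -- By `S_eq` the group depends only on the point of `D`. Since the frame at `p` covers a
  -- neighbourhood of `p` in `D`, the group is locally constant.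
  have hcont : ContinuousOn (fun p => (T p).S) C := by
    intro p hp
    have hp' := hCD hp
    refine ContinuousWithinAt.mono ?_ hCD
    refine continuousWithinAt_const.congr_of_eventuallyEq (f := fun _ => (T p).S) ?_ rfl
    have h1 := Frame.image_b_mem_nhdsWithin (T p).t (hz p hp') univ_mem
    rw [hzT p hp'] at h1
    filter_upwards [h1]
    rintro _ ⟨w, ⟨-, hw⟩, rfl⟩
    exact hS _ w hw
  rw [← hS a x hx, ← hS b y hy]
  exact hC.constant hcont hxC hyC

end BundleFrame

end OrbifoldAtlas

/-! ### Embeddings of the atlas are fibrewise unitary. -/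

/-- A differentiable map which agrees at each point with one of finitely many linear maps is
linear. -/
theorem eq_fderiv_zero_of_mem_finite {V V' : Type*} [NormedAddCommGroup V] [NormedSpace ℝ V]
    [NormedAddCommGroup V'] [NormedSpace ℝ V'] {Γ : Set (V →L[ℝ] V')} (hΓ : Γ.Finite) {h : V → V'}
    (hc : Continuous h) (hd : DifferentiableAt ℝ h 0) (hh : ∀ m, ∃ γ ∈ Γ, h m = γ m) (m : V) :
    h m = fderiv ℝ h 0 m := by
  have h0 : h 0 = 0 := by
    obtain ⟨γ, -, hγ⟩ := hh 0
    rw [hγ, map_zero]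
  -- For s > 0 the quotient h(sm)/s is continuous and takes values in the finite set of all γ m, so
  -- it is constant. At s = 1 it is h(m), and as s tends to 0 it tends to the derivative.
  have hconst : ∀ s ∈ Ioi (0 : ℝ), s⁻¹ • h (s • m) = h m := by
    intro s hs
    have hcont : ContinuousOn (fun s : ℝ => s⁻¹ • h (s • m)) (Ioi 0) :=
      (continuousOn_id.inv₀ fun s hs => ne_of_gt hs).smul
        (hc.comp (continuous_id.smul continuous_const)).continuousOn
    have hm : MapsTo (fun s : ℝ => s⁻¹ • h (s • m)) (Ioi 0) ((fun γ : V →L[ℝ] V' => γ m) '' Γ) := by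
      intro s hs
      obtain ⟨γ, hγ, h1⟩ := hh (s • m)
      refine ⟨γ, hγ, ?_⟩
      simp only [h1]
      rw [map_smul, inv_smul_smul₀ (ne_of_gt hs)]
    have := isPreconnected_Ioi.constant_of_mapsTo (hΓ.image _).isDiscrete hcont hm hs
      (mem_Ioi.2 one_pos)
    simpa using this
  have hder : HasDerivAt (fun s : ℝ => h (s • m)) (fderiv ℝ h 0 m) 0 := by
    have h1 : HasDerivAt (fun s : ℝ => s • m) m 0 := by
      simpa using (hasDerivAt_id (0 : ℝ)).smul_const m
    have h2 : HasFDerivAt h (fderiv ℝ h 0) ((0 : ℝ) • m) := by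
      rw [zero_smul]
      exact hd.hasFDerivAt
    exact h2.comp_hasDerivAt 0 h1
  have hlim := hder.tendsto_slope_zero_right
  refine tendsto_nhds_unique ?_ hlim
  refine tendsto_const_nhds.congr' ?_
  filter_upwards [self_mem_nhdsWithin] with s hs
  rw [zero_add, zero_smul, h0, sub_zero, hconst s hs]

namespace OrbifoldAtlas

namespace BundleFrame

variable {E : Type uE} [NormedAddCommGroup E] [NormedSpace ℝ E] [CompleteSpace E]
  {X : Type uX} [TopologicalSpace X] {A : OrbifoldAtlas.{uE, uX, uI, uG} E X}
  {σ : A.SymplecticForm} {D : Set X} {d k : ℕ} [Nonempty (σ.NormalBundle D)]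
  {q : σ.NormalBundle D → ℝ} {rep : Subgroup (UGroup k) → Subgroup (UGroup k)}

theorem isNormalTrivialization (a : BundleFrame q rep d) :
    σ.IsNormalTrivialization D a.t.B a.t.Φ := by
  intro x₀ hx₀
  refine ⟨a.t.α, a.t.B, a.t.j, a.t.L, a.t.isOpen_B, hx₀, subset_rfl, a.t.j_smooth, a.t.L_smooth,
    fun x hx => ⟨?_, a.t.range_fderiv_j x hx, Frame.L_injective hx, a.t.range_L x hx,
      fun m m' => ?_, fun m => ⟨_, Frame.Φ_eq hx m⟩⟩⟩
  · have hj : HasFDerivAt a.t.j (fderiv ℝ a.t.j x) x :=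
      ((a.t.j_smooth.contDiffAt (a.t.isOpen_B.mem_nhds hx)).differentiableAt (by simp)).hasFDerivAt
    have hr : HasFDerivAt a.t.r (fderiv ℝ a.t.r (a.t.j x)) (a.t.j x) :=
      ((a.t.r_smooth.contDiffAt (a.t.isOpen_O.mem_nhds (a.t.j_mem x hx))).differentiableAt
        (by simp)).hasFDerivAt
    have h1 : (fderiv ℝ a.t.r (a.t.j x)).comp (fderiv ℝ a.t.j x) =
        ContinuousLinearMap.id ℝ (CSpace d) := by
      refine (hr.comp x hj).unique ((hasFDerivAt_id x).congr_of_eventuallyEq ?_)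
      filter_upwards [a.t.isOpen_B.mem_nhds hx] with z hz using a.t.r_j z hz
    exact Function.LeftInverse.injective (g := fderiv ℝ a.t.r (a.t.j x)) fun v =>
      congrArg (fun S : CSpace d →L[ℝ] CSpace d => S v) h1
  · rw [← SymplecticForm.bil_apply]
    exact (a.isUnitary x hx).1 m m'

/-- Embeddings of charts are fibrewise unitary. -/
theorem exists_embedding_eq (hq : Frame.IsMetric d k q) {δ a : BundleFrame q rep d}
    {f : CSpace d × CSpace k → CSpace d × CSpace k} (hf : δ.chart.IsEmbedding a.chart f)
    {z : CSpace d} (hz : z ∈ δ.t.B) : ∃ p : UGroup k,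
      a.S = δ.S.map (MulAut.conj p).toMonoidHom ∧ ∀ m, f (z, m) = ((f (z, 0)).1, p.apply m) := by
  have hmem : ∀ m, (f (z, m)).1 ∈ a.t.B := fun m => (hf.mapsTo (x := (z, m)) ⟨hz, trivial⟩).1
  have hcomm : ∀ m, a.t.Φ (f (z, m)) = δ.t.Φ (z, m) := fun m => hf.comm (z, m) ⟨hz, trivial⟩
  have hb : ∀ m, a.t.b (f (z, m)).1 = δ.t.b z := fun m => by
    rw [← Frame.normalProj_Φ (hmem m) (f (z, m)).2, ← Frame.normalProj_Φ hz m, ← hcomm]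
  have hfst : ∀ m, (f (z, m)).1 = (f (z, 0)).1 := fun m =>
    Frame.b_injOn (hmem m) (hmem 0) (by rw [hb, hb])
  obtain ⟨W, ψ, P, -, hzW, -, -, -, hψ, h⟩ := Frame.exists_frame_transition hz (hmem 0) (hb 0).symm
  obtain ⟨-, -, h3, h4⟩ := h z hzW
  rw [hψ] at h3 h4
  obtain ⟨p, hp⟩ := δ.isUnitary.exists_eq_clm hq a.isUnitary hz (hmem 0) h3 h4
  rw [hp] at h4
  have hconj := Frame.map_conj_eq δ.mem_Γ_iff a.mem_Γ_iff hz (hmem 0) (p := p) h4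
  have hfin := Frame.finite_Γ (hmem 0)
  -- The embedding and the unitary transition map `p` lie over the same map to the normal bundle, so
  -- they differ at each vector by an element of the group, which may depend on the vector.
  -- Smoothness and finiteness remove this dependence below.
  have hΓ : ∀ m, ∃ γ ∈ a.t.Γ, (f (z, m)).2 = γ (UGroup.clm p m) := by
    intro m
    have h5 : a.t.Φ ((f (z, 0)).1, UGroup.clm p m) = a.t.Φ ((f (z, m)).1, (f (z, m)).2) := by
      exact (h4 m).symm.trans (hcomm m).symm
    obtain ⟨-, γ, hγ, h6⟩ := (Frame.Φ_eq_iff (hmem 0) (hmem m) _ _).1 h5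
    exact ⟨γ, hγ, h6.symm⟩
  have hsm : ContDiff ℝ ∞ fun m => (f (z, m)).2 := by
    have h5 : ContDiff ℝ ∞ fun m : CSpace k => (z, m) := contDiff_const.prodMk contDiff_id
    exact contDiff_snd.comp (contDiffOn_univ.1 (hf.smooth.comp h5.contDiffOn
      fun m _ => ⟨hz, trivial⟩))
  have hlin := eq_fderiv_zero_of_mem_finite (hfin.image fun γ => γ.comp (UGroup.clm p)) hsm.continuous
    (hsm.differentiable (by simp) 0) fun m => by
      obtain ⟨γ, hγ, h5⟩ := hΓ m
      exact ⟨_, ⟨γ, hγ, rfl⟩, h5⟩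
  obtain ⟨γ, hγ, h5⟩ := hfin.exists_forall_apply_eq (Q := fderiv ℝ (fun m => (f (z, m)).2) 0)
    (R := UGroup.clm p) fun m => by
      rw [← hlin]
      exact hΓ m
  obtain ⟨g, hg, rfl⟩ := (a.mem_Γ_iff γ).1 hγ
  -- As `g` belongs to the group of `a`, multiplying `p` by it does not change the conjugated
  -- subgroup.
  refine ⟨g * p, ?_, fun m => Prod.ext (hfst m) ?_⟩
  · rw [hconj]
    ext c
    simp only [Subgroup.mem_map, MulEquiv.coe_toMonoidHom, MulAut.conj_apply]
    constructor
    · rintro ⟨s, hs, rfl⟩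
      have hgs : g⁻¹ * (p * s * p⁻¹) * g ∈ a.S := a.S.mul_mem (a.S.mul_mem (a.S.inv_mem hg)
        (by rw [hconj]; exact ⟨s, hs, rfl⟩)) hg
      rw [hconj] at hgs
      obtain ⟨s', hs', h6⟩ := hgs
      refine ⟨s', hs', ?_⟩
      replace h6 : p * s' * p⁻¹ = g⁻¹ * (p * s * p⁻¹) * g := h6
      calc g * p * s' * (g * p)⁻¹ = g * (p * s' * p⁻¹) * g⁻¹ := by group
        _ = p * s * p⁻¹ := by rw [h6]; group
    · rintro ⟨s, hs, rfl⟩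
      have hgs : g * (p * s * p⁻¹) * g⁻¹ ∈ a.S := a.S.mul_mem (a.S.mul_mem hg
        (by rw [hconj]; exact ⟨s, hs, rfl⟩)) (a.S.inv_mem hg)
      rw [hconj] at hgs
      obtain ⟨s', hs', h6⟩ := hgs
      refine ⟨s', hs', ?_⟩
      replace h6 : p * s' * p⁻¹ = g * (p * s * p⁻¹) * g⁻¹ := h6
      rw [h6]
      group
  · rw [UGroup.mul_apply, hlin, h5]
    rfl

/-- The changes of charts are fibrewise unitary. -/
theorem transitionsIn (hq : Frame.IsMetric d k q)
    (hcov : ∀ p ∈ D, ∃ a : BundleFrame q rep d, ∃ x ∈ a.t.B, a.t.b x = p)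
    {S : Subgroup (UGroup k)} (hS : ∀ (a b : BundleFrame q rep d) (c : UGroup k),
      b.S = a.S.map (MulAut.conj c).toMonoidHom → c ∈ S) :
    TransitionsIn (atlas hq hcov) S := by
  intro δ a b f g hf hg
  change BundleFrame q rep d at δ a b
  change δ.chart.IsEmbedding a.chart f at hf
  change δ.chart.IsEmbedding b.chart g at hg
  change ∃ (ψ : CSpace d → CSpace d) (P : CSpace d → UGroup k),
    ContDiffOn ℝ ∞ ψ (Prod.fst '' (f '' δ.chart.U)) ∧
    (∀ i j, ContDiffOn ℝ ∞ (fun x => (P x : Matrix (Fin k) (Fin k) ℂ) i j)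
      (Prod.fst '' (f '' δ.chart.U))) ∧
    (∀ x ∈ Prod.fst '' (f '' δ.chart.U), P x ∈ S) ∧
    ∀ p ∈ δ.chart.U, g p = (ψ (f p).1, (P (f p).1).apply (f p).2)
  obtain ⟨f', hf', hff⟩ := hf.smooth_inverse
  -- The image of an embedding is a union of whole fibres, since a unitary map is surjective; so the
  -- change of charts is defined on all of each fibre that it meets.
  have hmem : ∀ x ∈ Prod.fst '' (f '' δ.chart.U), ∀ m, (x, m) ∈ f '' δ.chart.U := by
    rintro _ ⟨_, ⟨⟨z, m₀⟩, hz, rfl⟩, rfl⟩ m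
    obtain ⟨p, -, hp⟩ := exists_embedding_eq hq hf hz.1
    refine ⟨(z, (p⁻¹).apply m), ⟨hz.1, trivial⟩, ?_⟩
    rw [hp, hp m₀, UGroup.apply_inv_apply]
  have hsm : ContDiffOn ℝ ∞ (g ∘ f') (f '' δ.chart.U) := hg.smooth.comp hf' (by
    rintro _ ⟨w, hw, rfl⟩
    rwa [hff w hw])
  have hsm' : ∀ m, ContDiffOn ℝ ∞ (fun x => g (f' (x, m))) (Prod.fst '' (f '' δ.chart.U)) :=
    fun m => hsm.comp (contDiff_id.prodMk contDiff_const).contDiffOn fun x hx => hmem x hx m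
  have key : ∀ x ∈ Prod.fst '' (f '' δ.chart.U), ∃ c : UGroup k, c ∈ S ∧
      ∀ m, g (f' (x, m)) = ((g (f' (x, 0))).1, c.apply m) := by
    rintro _ ⟨_, ⟨⟨z, m₀⟩, hz, rfl⟩, rfl⟩
    obtain ⟨p, hpS, hp⟩ := exists_embedding_eq hq hf hz.1
    obtain ⟨p', hpS', hp'⟩ := exists_embedding_eq hq hg hz.1
    have hinv : ∀ m, f' ((f (z, m₀)).1, m) = (z, (p⁻¹).apply m) := by
      intro m
      rw [← hff (z, (p⁻¹).apply m) ⟨hz.1, trivial⟩, hp ((p⁻¹).apply m), hp m₀,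
        UGroup.apply_inv_apply]
    -- With `p` and `p'` the fibre maps of `f` and `g`, the change of charts is p'p⁻¹ on the fibre.
    -- It conjugates the group of `a` to that of `b`, so `hS` applies.
    refine ⟨p' * p⁻¹, hS a b _ ?_, fun m => ?_⟩
    · rw [hpS', hpS, Subgroup.map_map]
      congr 1
      ext1 s
      change p' * s * p'⁻¹ = p' * p⁻¹ * (p * s * p⁻¹) * (p' * p⁻¹)⁻¹
      group
    · rw [hinv, hinv, hp', hp' ((p⁻¹).apply 0), UGroup.mul_apply]
  choose! P hPS hP using key
  refine ⟨fun x => (g (f' (x, 0))).1, P, contDiff_fst.comp_contDiffOn (hsm' 0), fun i j => ?_, hPS,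
    fun w hw => ?_⟩
  -- The j-th column of the matrix is the fibre component of the smooth change of charts at the j-th
  -- basis vector.
  · have h1 : ContDiffOn ℝ ∞ (fun x => (g (f' (x, EuclideanSpace.single j 1))).2 i)
        (Prod.fst '' (f '' δ.chart.U)) := by
      have h2 := (contDiff_snd (𝕜 := ℝ) (n := ∞) (E := CSpace d)
        (F := CSpace k)).comp_contDiffOn (hsm' (EuclideanSpace.single j 1))
      have h3 : ContDiff ℝ ∞ (fun m : CSpace k => m i) :=
        ((EuclideanSpace.proj (𝕜 := ℂ) i).restrictScalars ℝ).contDiff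
      exact h3.comp_contDiffOn h2
    refine h1.congr fun x hx => ?_
    rw [hP x hx]
    simp [UGroup.apply]
  · have h1 := hP (f w).1 ⟨_, ⟨w, hw, rfl⟩, rfl⟩ (f w).2
    rw [Prod.mk.eta, hff w hw] at h1
    exact h1

end BundleFrame

end OrbifoldAtlas

/-! ### Real linear conjugacy of the groups over all of `D`. -/

namespace OrbifoldAtlas

section

variable {E : Type uE} [NormedAddCommGroup E] [NormedSpace ℝ E]
  {X : Type uX} [TopologicalSpace X] {A : OrbifoldAtlas.{uE, uX, uI, uG} E X}

/-- The normal space depends only on the isotropy representation. -/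
theorem SymplecticForm.normalSpace_eq_span (σ : A.SymplecticForm) {α : A.Index} {u : E}
    (hu : u ∈ (A.chart α).U) : σ.normalSpace α u =
      Submodule.span ℝ {v | ∃ L ∈ (A.chart α).isotropy u, ∃ w, v = L w - w} := by
  refine le_antisymm (fun v hv => ?_) (Submodule.span_le.2 ?_)
  · rw [σ.mem_normalSpace_iff hu, OrbifoldChart.isotropySum_apply] at hv
    have hc := (A.chart α).card_stab_ne_zero hu
    set s := (Set.toFinite {g : (A.chart α).G | (A.chart α).act g u = u}).toFinset with hs
    have h1 : ∑ g ∈ s, (fderiv ℝ ((A.chart α).act g) u v - v) = -((s.card : ℝ) • v) := by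
      rw [Finset.sum_sub_distrib, hv, Finset.sum_const, zero_sub, Nat.cast_smul_eq_nsmul]
    have h2 : v = -((s.card : ℝ)⁻¹ • ∑ g ∈ s, (fderiv ℝ ((A.chart α).act g) u v - v)) := by
      rw [h1, smul_neg, neg_neg, inv_smul_smul₀ hc]
    rw [h2]
    refine Submodule.neg_mem _ (Submodule.smul_mem _ _ (Submodule.sum_mem _ fun g hg => ?_))
    exact Submodule.subset_span ⟨_, ⟨g, by simpa [hs] using hg, rfl⟩, v, rfl⟩
  · rintro _ ⟨_, ⟨g, hg, rfl⟩, w, rfl⟩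
    rw [SetLike.mem_coe, σ.mem_normalSpace]
    intro w' hw'
    have h1 := σ.bil_act hu hg w w'
    rw [(A.chart α).mem_fixedSpace.1 hw' g hg] at h1
    rw [map_sub, sub_apply, h1, sub_self]

theorem SymplecticForm.map_mem_normalSpace (σ : A.SymplecticForm) {α β : A.Index} {u w : E}
    (hu : u ∈ (A.chart α).U) (hw : w ∈ (A.chart β).U) {T : E →ₗ[ℝ] E}
    (hT : ∀ L ∈ (A.chart α).isotropy u, ∃ L' ∈ (A.chart β).isotropy w, ∀ v, T (L v) = L' (T v))
    {v : E} (hv : v ∈ σ.normalSpace α u) : T v ∈ σ.normalSpace β w := by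
  rw [σ.normalSpace_eq_span hu] at hv
  rw [σ.normalSpace_eq_span hw]
  refine (Submodule.map_span_le T _ _).2 ?_ ⟨v, hv, rfl⟩
  rintro _ ⟨L, hL, v, rfl⟩
  obtain ⟨L', hL', h⟩ := hT L hL
  exact Submodule.subset_span ⟨L', hL', T v, by rw [map_sub, h]⟩

end

variable {F : Type uE} [NormedAddCommGroup F] [InnerProductSpace ℝ F] [CompleteSpace F]
  {X : Type uX} [TopologicalSpace X] {A : OrbifoldAtlas.{uE, uX, uI, uG} F X}

/-- The isotropy representations at two points of an isotropy subset are conjugate. -/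
theorem exists_isotropy_conj {H : Subgroup (F ≃ₗᵢ[ℝ] F)} {α β : A.Index} {u w : F}
    (hu : u ∈ (A.chart α).U) (hw : w ∈ (A.chart β).U)
    (huD : (A.chart α).φ u ∈ A.isotropySubset H) (hwD : (A.chart β).φ w ∈ A.isotropySubset H) :
    ∃ T : F ≃L[ℝ] F, ∀ L ∈ (A.chart α).isotropy u, ∃ L' ∈ (A.chart β).isotropy w,
      ∀ v, T (L v) = L' (T v) := by
  obtain ⟨T, hT⟩ := (mem_isotropySubset_iff hu).1 huD
  obtain ⟨S, hS⟩ := (mem_isotropySubset_iff hw).1 hwD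
  refine ⟨T.trans S.symm, fun L hL => ?_⟩
  obtain ⟨h, hh, hhT⟩ := (hT L).1 hL
  refine ⟨(S.symm : F →L[ℝ] F).comp ((h.toContinuousLinearEquiv : F →L[ℝ] F).comp
    (S : F →L[ℝ] F)), (hS _).2 ⟨h, hh, fun v => by simp⟩, fun v => ?_⟩
  simp [hhT]

namespace Frame

/-- The groups of two frames are conjugate by a real linear map. -/
theorem exists_linear_conj {σ : A.SymplecticForm} {H : Subgroup (F ≃ₗᵢ[ℝ] F)} [Finite H] {d k : ℕ}
    {t s : Frame σ (A.isotropySubset H) d k} {x y : CSpace d} (hx : x ∈ t.B) (hy : y ∈ s.B) :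
    ∃ T : CSpace k ≃ₗ[ℝ] CSpace k,
      (∀ γ ∈ t.Γ, ∃ γ' ∈ s.Γ, ∀ m, T (γ m) = γ' (T m)) ∧
      ∀ γ' ∈ s.Γ, ∃ γ ∈ t.Γ, ∀ m, T (γ m) = γ' (T m) := by
  -- A conjugacy of isotropy representations need not respect the symplectic forms. It still maps
  -- normal space to normal space, because these are spanned by the differences Lv - v; so only a
  -- real linear conjugacy results.
  have key : ∀ {t s : Frame σ (A.isotropySubset H) d k} {x y : CSpace d}, x ∈ t.B → y ∈ s.B →
      ∃ T : CSpace k →ₗ[ℝ] CSpace k, Function.Injective T ∧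
        ∀ γ ∈ t.Γ, ∃ γ' ∈ s.Γ, ∀ m, T (γ m) = γ' (T m) := by
    intro t s x y hx hy
    obtain ⟨T, hT⟩ := exists_isotropy_conj (j_mem_U hx) (j_mem_U hy) (b_mem hx) (b_mem hy)
    have hTL : ∀ m, s.L y (s.M (s.j y) (T (t.L x m))) = T (t.L x m) := fun m =>
      L_M hy (σ.map_mem_normalSpace (j_mem_U hx) (j_mem_U hy)
        (T := (T.toLinearEquiv : F →ₗ[ℝ] F)) hT (L_mem hx m))
    let T' : CSpace k →L[ℝ] CSpace k := (s.M (s.j y)).comp ((T : F →L[ℝ] F).comp (t.L x))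
    have hT' : ∀ m, s.L y (T' m) = T (t.L x m) := hTL
    have hinj : Function.Injective T' := fun m m' h => by
      have h1 := congrArg (s.L y) h
      rw [hT', hT'] at h1
      exact L_injective hx (T.injective h1)
    have hTi : T'.IsInvertible := isInvertible_of_injective rfl hinj
    refine ⟨T', hinj, fun γ hγ => ?_⟩
    obtain ⟨g, hg, h⟩ := (t.mem_Γ_iff x hx γ).1 hγ
    obtain ⟨_, ⟨g', hg', rfl⟩, hgg⟩ := hT _ ⟨g, hg, rfl⟩
    refine ⟨T'.comp (γ.comp T'.inverse), (s.mem_Γ_iff y hy _).2 ⟨g', hg', fun m => ?_⟩, fun m => ?_⟩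
    · obtain ⟨m, rfl⟩ := hTi.surjective m
      simp only [ContinuousLinearMap.comp_apply]
      rw [hTi.inverse_apply_self, hT', hT', ← hgg, h]
    · simp only [ContinuousLinearMap.coe_coe, ContinuousLinearMap.comp_apply]
      rw [hTi.inverse_apply_self]
  obtain ⟨T, hTi, hT⟩ := key hx hy
  obtain ⟨T', hTi', hT'⟩ := key hy hx
  let e : CSpace k ≃ₗ[ℝ] CSpace k := LinearEquiv.ofInjectiveEndo T hTi
  have hfin := finite_Γ hx
  have hfin' := finite_Γ hy
  -- conjugation is injective, so the two finite groups have the same cardinality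
  choose! c hc hcT using hT
  choose! c' hc' hcT' using hT'
  have hci : InjOn c t.Γ := by
    intro γ₁ h₁ γ₂ h₂ h
    ext1 m
    apply hTi
    rw [hcT γ₁ h₁, hcT γ₂ h₂, h]
  have hci' : InjOn c' s.Γ := by
    intro γ₁ h₁ γ₂ h₂ h
    ext1 m
    apply hTi'
    rw [hcT' γ₁ h₁, hcT' γ₂ h₂, h]
  have hsurj : SurjOn c t.Γ s.Γ := by
    have h1 : s.Γ.ncard ≤ t.Γ.ncard := ncard_le_ncard_of_injOn c' hc' hci' hfin
    have h2 : c '' t.Γ = s.Γ := by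
      refine eq_of_subset_of_ncard_le (image_subset_iff.2 hc) ?_ hfin'
      rwa [hci.ncard_image]
    exact h2.ge
  refine ⟨e, fun γ hγ => ⟨c γ, hc γ hγ, hcT γ hγ⟩, fun γ' hγ' => ?_⟩
  obtain ⟨γ, hγ, rfl⟩ := hsurj hγ'
  exact ⟨γ, hγ, hcT γ hγ⟩

end Frame

namespace BundleFrame

variable {σ : A.SymplecticForm} {H : Subgroup (F ≃ₗᵢ[ℝ] F)} [Finite H] {d k : ℕ}
  [Nonempty (σ.NormalBundle (A.isotropySubset H))]
  {q : σ.NormalBundle (A.isotropySubset H) → ℝ} {rep : Subgroup (UGroup k) → Subgroup (UGroup k)}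

theorem isBundleAtlas (hq : Frame.IsMetric d k q)
    (hcov : ∀ p ∈ A.isotropySubset H, ∃ a : BundleFrame q rep d, ∃ x ∈ a.t.B, a.t.b x = p) :
    σ.IsBundleAtlas (A.isotropySubset H) (atlas hq hcov)
      (fun a : BundleFrame q rep d => a.t.B) (fun a : BundleFrame q rep d => a.S) where
  domain _ := rfl
  action a := ⟨MulEquiv.refl _, fun _ _ _ _ => rfl⟩
  trivialization := isNormalTrivialization
  conjugate a b := by
    change BundleFrame q rep d at a b
    obtain ⟨x, hx⟩ := a.isConnected_B.nonempty
    obtain ⟨y, hy⟩ := b.isConnected_B.nonempty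
    obtain ⟨T, hT, hT'⟩ := Frame.exists_linear_conj hx hy
    refine ⟨T, fun γ hγ => ?_, fun γ' hγ' => ?_⟩
    · obtain ⟨γ', hγ', h⟩ := hT _ ((a.mem_Γ_iff _).2 ⟨γ, hγ, rfl⟩)
      obtain ⟨g, hg, rfl⟩ := (b.mem_Γ_iff _).1 hγ'
      exact ⟨g, hg, h⟩
    · obtain ⟨γ, hγ, h⟩ := hT' _ ((b.mem_Γ_iff _).2 ⟨γ', hγ', rfl⟩)
      obtain ⟨g, hg, rfl⟩ := (a.mem_Γ_iff _).1 hγ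
      exact ⟨g, hg, h⟩

end BundleFrame

end OrbifoldAtlas

/-! ### Assembly of the theorem. -/

theorem mainTheorem4 {X : Type uX} [TopologicalSpace X] [T2Space X]
    [SecondCountableTopology X] (n : ℕ)
    (A : OrbifoldAtlas.{0, uX, uI, uG} (EuclideanSpace ℝ (Fin (2 * n))) X)
    (σ : A.SymplecticForm) (D : Set X) (hD : A.IsHomogeneousIsotropy D) (hne : D.Nonempty) :
    T2Space (σ.NormalBundle D) ∧ SecondCountableTopology (σ.NormalBundle D) ∧
    ∃ d k : ℕ, d + k = n ∧
      (∃ (N : OrbifoldAtlas.{0, uI, uI, 0} (CSpace d × CSpace k) (σ.NormalBundle D))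
          (B : N.Index → Set (CSpace d)) (Γ : N.Index → Subgroup (UGroup k)),
        σ.IsBundleAtlas D N B Γ ∧
        (∀ a b, ∀ x ∈ B a, ∀ y ∈ B b,
          connectedComponentIn D (σ.normalProj D ((N.chart a).φ (x, 0))) =
              connectedComponentIn D (σ.normalProj D ((N.chart b).φ (y, 0))) →
            ∃ c : UGroup k, Γ b = (Γ a).map (MulAut.conj c).toMonoidHom) ∧
        N.TransitionsIn ⊤) ∧
      (IsConnected D →
        ∃ (Γ : Subgroup (UGroup k))
          (N : OrbifoldAtlas.{0, uI, uI, 0} (CSpace d × CSpace k) (σ.NormalBundle D))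
          (B : N.Index → Set (CSpace d)),
        σ.IsBundleAtlas D N B (fun _ => Γ) ∧
        N.TransitionsIn (Subgroup.normalizer (Γ : Set (UGroup k)))) := by
  obtain ⟨H, hH, rfl, -⟩ := hD
  obtain ⟨d, k, hdk, hdim⟩ := σ.exists_dimensions (n := n) (by simp) H hne
  have := OrbifoldAtlas.nonempty_normalBundle σ hne
  have hcov := OrbifoldAtlas.exists_frame_of_finrank σ hdim
  have hT2 := OrbifoldAtlas.Frame.t2Space_normalBundle hcov
  have hSC := OrbifoldAtlas.Frame.secondCountableTopology_normalBundle hcov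
  obtain ⟨q, hq₁, hq₂⟩ := OrbifoldAtlas.Frame.exists_quadratic hcov
  have hq : OrbifoldAtlas.Frame.IsMetric d k q := ⟨hq₁, hq₂⟩
  obtain ⟨rep, hrep, hrep'⟩ := exists_conjugacy_representative (UGroup k)
  have hcov' : ∀ p ∈ A.isotropySubset H, ∃ a : OrbifoldAtlas.BundleFrame q rep d,
      ∃ x ∈ a.t.B, a.t.b x = p := by
    intro p hp
    obtain ⟨t, x, hx, rfl⟩ := hcov p hp
    obtain ⟨a, hxa, ha⟩ := OrbifoldAtlas.BundleFrame.exists_bundleFrame hq hrep hrep' hx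
    exact ⟨a, x, hxa, ha⟩
  have hconn := fun C => OrbifoldAtlas.BundleFrame.S_eq_of_isPreconnected hq hrep' hcov' (C := C)
  have hatlas := OrbifoldAtlas.BundleFrame.isBundleAtlas hq hcov'
  refine ⟨hT2, hSC, d, k, hdk, ⟨_, _, _, hatlas, ?_,
    OrbifoldAtlas.BundleFrame.transitionsIn hq hcov' fun _ _ _ _ => Subgroup.mem_top _⟩,
    fun hDc => ?_⟩
  · intro a b x hx y hy hxy
    change OrbifoldAtlas.BundleFrame q rep d at a b
    -- With the representatives fixed, the groups over one component are equal, so the identity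
    -- conjugates one to the other.
    refine ⟨1, ?_⟩
    have hpa : σ.normalProj _ (a.t.Φ (x, 0)) = a.t.b x := OrbifoldAtlas.Frame.normalProj_Φ hx 0
    have hpb : σ.normalProj _ (b.t.Φ (y, 0)) = b.t.b y := OrbifoldAtlas.Frame.normalProj_Φ hy 0
    change connectedComponentIn _ (σ.normalProj _ (a.t.Φ (x, 0))) =
      connectedComponentIn _ (σ.normalProj _ (b.t.Φ (y, 0))) at hxy
    rw [hpa, hpb] at hxy
    have hS := hconn _ isPreconnected_connectedComponentIn (connectedComponentIn_subset _ _) a b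
      hx hy (mem_connectedComponentIn (OrbifoldAtlas.Frame.b_mem hx))
      (by rw [hxy]; exact mem_connectedComponentIn (OrbifoldAtlas.Frame.b_mem hy))
    change b.S = a.S.map _
    rw [hS]
    ext g
    simp [Subgroup.mem_map]
  · obtain ⟨p, hp⟩ := hne
    obtain ⟨a₀, x₀, hx₀, -⟩ := hcov' p hp
    have hS : ∀ a : OrbifoldAtlas.BundleFrame q rep d, a.S = a₀.S := by
      intro a
      obtain ⟨x, hx⟩ := a.isConnected_B.nonempty
      exact hconn _ hDc.isPreconnected subset_rfl a a₀ hx hx₀ (OrbifoldAtlas.Frame.b_mem hx)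
        (OrbifoldAtlas.Frame.b_mem hx₀)
    have hΓ : (fun a : OrbifoldAtlas.BundleFrame q rep d => a.S) = fun _ => a₀.S := funext hS
    rw [hΓ] at hatlas
    -- All groups coincide here, so an element that conjugates the group of one chart to that of
    -- another normalizes the common group.
    refine ⟨a₀.S, _, _, hatlas, OrbifoldAtlas.BundleFrame.transitionsIn hq hcov' fun a b c h => ?_⟩
    rw [hS a, hS b] at h
    exact Subgroup.mem_normalizer_iff_map_conj_eq.2 h.symm
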